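/- Let $p,q\ge 1$, let $G=\mathrm{SO}(p,q+1)_e$ be the identity component of the group $\mathrm{SO}(p,q+1)$ of the form $x_1^2+\dots+x_p^2-x_{p+1}^2-\dots-x_{p+q+1}^2$ on $\mathbb R^{p+q+1}$, and let $H=\mathrm{SO}(p,q)_e$ be the stabilizer of $x_0=e_{p+q+1}$ in $G$, so that $G/H$ is identified with the hyperboloid $Gx_0$, where the form equals $-1$. Let $K=\mathrm{SO}(p)\times\mathrm{SO}(q+1)$. Let $a_t\in G$ be the hyperbolic rotation by $t$ in the coordinates $1$ and $p+q+1$, and $k_\theta\in K$ the rotation by $\theta$ in the coordinates $p+1$ and $p+q+1$, so that $$k_\theta a_t x_0=(\sinh t,0,\dots,0;\ \sin\theta\cosh t,0,\dots,0,\cos\theta\cosh t).$$ A $K\cap H$-invariant function on $G/H$ is determined by its values at the points $k_\theta a_t x_0$. For $u\in\mathbb R^{p-1}$ and $v\in\mathbb R^{q}$ (rows) let $$n_{u,v}=\exp\begin{pmatrix}0&u&v&0\\-u^t&0&0&u^t\\v^t&0&0&-v^t\\0&u&v&0\end{pmatrix}\in G,$$ write $u=(u_1,\dots,u_{p-1})$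 and $v=(v_q,\dots,v_1)$, and let $N^*$ be the $\max(p-1,q)$-dimensional abelian group of all $n_{u,v}$ with $u_j=v_j$ for $1\le j\le\min(p-1,q)$, with a Haar measure $dn^*$. For a function $f$ on $G/H$ put $$Rf(g)=\int_{N^*}f(gn^*H)\,dn^*\qquad(g\in G),$$ provided that the integral converges absolutely. Let $\rho=\frac12(p+q-1)$, $\rho_c=\frac12(q-1)$, and $\rho_1=\frac12(p-q-1)$ if $p>q$, $\rho_1=\frac12(q-p+1)$ if $p\le q$. Put $\mu_\lambda=\lambda+\rho-2\rho_c$ for $\lambda>0$ and, if $q=1$, $\mu_\lambda=\lambda-\rho$ for $\lambda<0$. The discrete series of $G/H$ is parametrized, for $q>1$, by the $\lambda>0$ with $\mu_\lambda\in\mathbb Z$ and, for $q=1$, by the real $\lambda\ne0$ with $|\lambda|+\rho\in\mathbb Z$. For a discrete series parameter $\lambda$ let $f$ be the following $K\cap H$-invariant generating function of the corresponding representation: * if $q=1$: $f(k_\theta a_tx_0)=e^{i\mu_\lambda\theta}(\cosh t)^{-|\lambda|-\rho}$; * if $q>1$ and $\mu_\lambda\ge0$: $f(k_\theta a_tx_0)=R_{\mu_\lambda}(\cos\theta)(\cosh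 t)^{-\lambda-\rho}$, where $R_\mu=C_\mu^{(\rho_c)}/C_\mu^{(\rho_c)}(1)$ is the normalized Gegenbauer polynomial of degree $\mu$; * if $q>1$ and $\mu_\lambda=-n<0$: $f(k_\theta a_tx_0)=\phi_{n,m}(\sinh^2t)$ if $n=2m$ is even, and $f(k_\theta a_tx_0)=\cos\theta\cosh t\,\phi_{n,m}(\sinh^2t)$ if $n=2m-1$ is odd, where $\phi_{n,m}(s^2)$ is the value at $x=(s,0,\dots,0)\in\mathbb R^p$ of $\omega^m(1+|x|^2)^{n-\rho_c}$, with $\omega$ the Laplace operator of $\mathbb R^p$. Theorem 5.2. Let $\lambda\neq0$ be a discrete series parameter and $f$ the generating function above. 1. If $\lambda>0$ and $\mu_\lambda>0$, or if $\lambda<0$ and $\mu_\lambda<0$, then the integral defining $Rf(g)$ converges absolutely and $Rf(g)=0$ for every $g\in G$. 2. If $\lambda>0$ and $\mu_\lambda\le0$, then there is a constant $C\neq0$ such that, for every $s\in\mathbb R$, the integral defining $Rf(a_s)$ converges absolutely and $Rf(a_s)=Ce^{(\lambda-\rho_1)s}$. -/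

import Mathlib

namespace Hyperbolic

noncomputable section

open scoped Matrix

/-- Coordinates of `ℝ^{p+q+1}` for `p ≥ 1`, split as `1 + (p-1)` and `q + 1`; the first summand of
the outer sum carries the `p` positive, the second the `q+1` negative squares. -/
abbrev Idx (p q : ℕ) : Type := (Unit ⊕ Fin (p - 1)) ⊕ (Fin q ⊕ Unit)

abbrev Mat (p q : ℕ) : Type := Matrix (Idx p q) (Idx p q) ℝ

/-- The form `x_1² + … + x_p² - x_{p+1}² - … - x_{p+q+1}²`. -/
def form (p q : ℕ) : Mat p q :=
  LieAlgebra.Orthogonal.indefiniteDiagonal (Unit ⊕ Fin (p - 1)) (Fin q ⊕ Unit) ℝ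

/-- `G = SO(p,q+1)_e`, the identity component of `SO(p,q+1)`, as a set of matrices. -/
def groupG (p q : ℕ) : Set (Mat p q) :=
  connectedComponentIn {g | gᵀ * form p q * g = form p q ∧ g.det = 1} 1

/-- The base point `x_0 = e_{p+q+1}`. The space `G/H` is the orbit `G x_0`, the hyperboloid on
which the form takes the value `-1`. -/
def basePoint (p q : ℕ) : Idx p q → ℝ := Pi.single (Sum.inr (Sum.inr ())) 1

/-- The one-parameter group `a_t`. -/
def boost (p q : ℕ) (t : ℝ) : Mat p q :=
  Matrix.fromBlocks
    (Matrix.fromBlocks (Matrix.of fun _ _ => Real.cosh t) 0 0 1)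
    (Matrix.fromBlocks 0 (Matrix.of fun _ _ => Real.sinh t) 0 0)
    (Matrix.fromBlocks 0 0 (Matrix.of fun _ _ => Real.sinh t) 0)
    (Matrix.fromBlocks 1 0 0 (Matrix.of fun _ _ => Real.cosh t))

/-- The one-parameter group `k_θ`, rotating the first and the last of the `q+1` negative
coordinates. -/
def rot (p q : ℕ) (θ : ℝ) : Mat p q :=
  Matrix.fromBlocks 1 0 0
    (Matrix.fromBlocks (Matrix.diagonal fun k => if (k : ℕ) = 0 then Real.cos θ else 1)
      (Matrix.of fun k _ => if (k : ℕ) = 0 then Real.sin θ else 0)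
      (Matrix.of fun _ k => if (k : ℕ) = 0 then -Real.sin θ else 0)
      (Matrix.of fun _ _ => Real.cos θ))

/-- The Lie algebra element `Z_{u,v}`, with `u`, `v` as rows in the `1 + (p-1) + q + 1` block
decomposition. -/
def nilElt (p q : ℕ) (u : Fin (p - 1) → ℝ) (v : Fin q → ℝ) : Mat p q :=
  Matrix.fromBlocks
    (Matrix.fromBlocks 0 (Matrix.replicateRow Unit u) (-Matrix.replicateCol Unit u) 0)
    (Matrix.fromBlocks (Matrix.replicateRow Unit v) 0 0 (Matrix.replicateCol Unit u))
    (Matrix.fromBlocks (Matrix.replicateCol Unit v) 0 0 (Matrix.replicateRow Unit u))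
    (Matrix.fromBlocks 0 (-Matrix.replicateCol Unit v) (Matrix.replicateRow Unit v) 0)

/-- `n_{u,v} = exp Z_{u,v}`. -/
def unip (p q : ℕ) (u : Fin (p - 1) → ℝ) (v : Fin q → ℝ) : Mat p q :=
  NormedSpace.exp (nilElt p q u v)

/-- The entries `u = (u_1, …, u_{p-1})` with `u_j = w_j`. -/
def uPart (p q : ℕ) (w : Fin (max (p - 1) q) → ℝ) : Fin (p - 1) → ℝ :=
  fun i => w (Fin.castLE (le_max_left _ _) i)

/-- The entries `v = (v_q, …, v_1)`, numbered from right to left, with `v_j = w_j`. -/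
def vPart (p q : ℕ) (w : Fin (max (p - 1) q) → ℝ) : Fin q → ℝ :=
  fun k => w (Fin.castLE (le_max_right _ _) k.rev)

/-- The subgroup `N^*` of all `n_{u,v}` with `u_j = v_j` for `1 ≤ j ≤ min (p-1) q`
(the index `j` below is `j - 1`, and `v = (v_q, …, v_1)`). -/
def groupNStar (p q : ℕ) : Set (Mat p q) :=
  {n | ∃ (u : Fin (p - 1) → ℝ) (v : Fin q → ℝ),
    (∀ (j : ℕ) (hu : j < p - 1) (hv : j < q), u ⟨j, hu⟩ = v (Fin.rev ⟨j, hv⟩)) ∧ n = unip p q u v}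

/-- The coordinates `w ∈ ℝ^{max(p-1,q)}` on `N^*`. -/
def nStar (p q : ℕ) (w : Fin (max (p - 1) q) → ℝ) : Mat p q :=
  unip p q (uPart p q w) (vPart p q w)

/-- The coordinates `w` exhaust `N^*`. -/
theorem range_nStar (p q : ℕ) : Set.range (nStar p q) = groupNStar p q := by
  ext n
  constructor
  · rintro ⟨w, rfl⟩
    refine ⟨_, _, fun j hu hv => ?_, rfl⟩
    simp only [uPart, vPart, Fin.rev_rev]
    rfl
  · rintro ⟨u, v, h, rfl⟩
    refine ⟨fun j => if hu : (j : ℕ) < p - 1 then u ⟨j, hu⟩ else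
      if hv : (j : ℕ) < q then v (Fin.rev ⟨j, hv⟩) else 0, ?_⟩
    have h1 : uPart p q (fun j => if hu : (j : ℕ) < p - 1 then u ⟨j, hu⟩ else
      if hv : (j : ℕ) < q then v (Fin.rev ⟨j, hv⟩) else 0) = u := by
      funext i
      simp [uPart]
    have h2 : vPart p q (fun j => if hu : (j : ℕ) < p - 1 then u ⟨j, hu⟩ else
      if hv : (j : ℕ) < q then v (Fin.rev ⟨j, hv⟩) else 0) = v := by
      funext k
      simp only [vPart, Fin.val_castLE]
      split_ifs with ha hb
      · rw [h _ ha k.rev.isLt]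
        exact congrArg v (Fin.rev_rev k)
      · exact congrArg v (Fin.rev_rev k)
      · exact absurd k.rev.isLt hb
    rw [nStar, h1, h2]

/-- The coordinates `w` are additive-to-multiplicative, so Lebesgue measure in `w` is a Haar
measure of `N^*`. -/
theorem nStar_add (p q : ℕ) (w w' : Fin (max (p - 1) q) → ℝ) :
    nStar p q (w + w') = nStar p q w * nStar p q w' := by
  have hadd : nilElt p q (uPart p q (w + w')) (vPart p q (w + w')) =
      nilElt p q (uPart p q w) (vPart p q w) + nilElt p q (uPart p q w') (vPart p q w') := by
    ext (( i | i) | (i | i)) ((j | j) | (j | j)) <;>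
      simp [nilElt, uPart, vPart] <;> ring_nf
  have hcomm : Commute (nilElt p q (uPart p q w) (vPart p q w))
      (nilElt p q (uPart p q w') (vPart p q w')) := by
    have hrc : ∀ (n : ℕ) (a b : Fin n → ℝ), Matrix.replicateRow Unit a * Matrix.replicateCol Unit b
        = Matrix.replicateRow Unit b * Matrix.replicateCol Unit a := by
      intro n a b
      ext i j
      simp [Matrix.mul_apply, mul_comm]
    rw [Commute, SemiconjBy]
    simp [nilElt, Matrix.fromBlocks_multiply, Matrix.fromBlocks_add, hrc _ (uPart p q w),
      hrc _ (vPart p q w)]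
  rw [nStar, unip, hadd, Matrix.exp_add_of_commute _ _ hcomm]
  rfl

/-- The Radon transform `R f(g) = ∫_{N^*} f(g n H) dn` of a function on `G/H`, given as a function
of the point `g x_0`; only its values on the orbit `G x_0` matter. It is meaningful where
`RadonConverges` holds. -/
def radon (p q : ℕ) (f : (Idx p q → ℝ) → ℂ) (g : Mat p q) : ℂ :=
  ∫ w : Fin (max (p - 1) q) → ℝ, f ((g * nStar p q w) *ᵥ basePoint p q)

/-- The integral that defines `R f(g)` converges absolutely. -/
def RadonConverges (p q : ℕ) (f : (Idx p q → ℝ) → ℂ) (g : Mat p q) : Prop :=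
  MeasureTheory.Integrable
    (fun w : Fin (max (p - 1) q) → ℝ => f ((g * nStar p q w) *ᵥ basePoint p q))

def rho (p q : ℕ) : ℝ := ((p : ℝ) + q - 1) / 2

def rhoC (q : ℕ) : ℝ := ((q : ℝ) - 1) / 2

def rhoOne (p q : ℕ) : ℝ := if q < p then ((p : ℝ) - q - 1) / 2 else ((q : ℝ) - p + 1) / 2

/-- `μ_λ = λ + ρ - 2ρ_c` for `λ > 0`, and `μ_λ = λ - ρ` for `λ < 0` (which only occurs for
`q = 1`). -/
def muParam (p q : ℕ) (lam : ℝ) : ℝ :=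
  if 0 < lam then lam + rho p q - 2 * rhoC q else lam - rho p q

/-- The parameters of the discrete series of `G/H`. -/
def IsDiscreteSeriesParameter (p q : ℕ) (lam : ℝ) : Prop :=
  if q = 1 then lam ≠ 0 ∧ ∃ k : ℤ, |lam| + rho p q = k
  else 0 < lam ∧ ∃ k : ℤ, muParam p q lam = k

/-- The Gegenbauer polynomial `C_n^{(ν)}`. -/
def gegenbauer (ν : ℝ) : ℕ → ℝ → ℝ
  | 0, _ => 1
  | 1, x => 2 * ν * x
  | n + 2, x =>
    (2 * (n + 1 + ν) * x * gegenbauer ν (n + 1) x - (n + 2 * ν) * gegenbauer ν n x) / (n + 2)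

/-- The zonal spherical function of degree `n` of `SO(q+1)/SO(q)`, for `q > 1`: the Gegenbauer
polynomial of index `(q-1)/2`, normalized to take the value `1` at `1`. -/
def zonal (q n : ℕ) (x : ℝ) : ℝ := gegenbauer (rhoC q) n x / gegenbauer (rhoC q) n 1

/-- The length of the last `q+1` coordinates; it is `cosh t` at `k_θ a_t x_0`. -/
def coshPart (p q : ℕ) (x : Idx p q → ℝ) : ℝ := Real.sqrt (∑ k, x (Sum.inr k) ^ 2)

/-- The last coordinate; it is `cos θ cosh t` at `k_θ a_t x_0`. -/
def lastCoord (p q : ℕ) (x : Idx p q → ℝ) : ℝ := x (Sum.inr (Sum.inr ()))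

/-- The `m`-th power of the Laplace operator of `ℝ^p`, applied to `(1 + |z|²)^{n-ρ_c}`, at the
point `z` that consists of the first `p` coordinates; `z = (sinh t, 0, …, 0)` at `k_θ a_t x_0`. -/
def phi (p q n m : ℕ) (x : Idx p q → ℝ) : ℝ :=
  (fun h : EuclideanSpace ℝ (Unit ⊕ Fin (p - 1)) → ℝ => Laplacian.laplacian h)^[m]
    (fun z => (1 + ‖z‖ ^ 2) ^ ((n : ℝ) - rhoC q)) (WithLp.toLp 2 fun i => x (Sum.inl i))

/-- The `K ∩ H`-invariant generating function of the discrete series representation with parameter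
`λ`, where `μ = μ_λ`, as a function on the orbit `G x_0`. In polar coordinates `k_θ a_t x_0` it is
* `exp (iμθ) (cosh t)^{-|λ|-ρ}` if `q = 1`,
* `R_μ(cos θ) (cosh t)^{-λ-ρ}` if `q > 1` and `μ ≥ 0`,
* `φ_{n,m}(sinh² t)` if `q > 1` and `-μ = n = 2m > 0`,
* `cos θ cosh t φ_{n,m}(sinh² t)` if `q > 1` and `-μ = n = 2m - 1 > 0`. -/
def generatingFunction (p q : ℕ) (lam : ℝ) (μ : ℤ) (x : Idx p q → ℝ) : ℂ :=
  if hq : q = 1 then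
    (((lastCoord p q x / coshPart p q x : ℝ) : ℂ) +
      Complex.I * ((x (Sum.inr (Sum.inl ⟨0, by omega⟩)) / coshPart p q x : ℝ) : ℂ)) ^ μ *
      ((coshPart p q x ^ (-|lam| - rho p q) : ℝ) : ℂ)
  else if 0 ≤ μ then
    ((zonal q μ.toNat (lastCoord p q x / coshPart p q x) *
      coshPart p q x ^ (-lam - rho p q) : ℝ) : ℂ)
  else if Even μ then
    ((phi p q (-μ).toNat ((-μ).toNat / 2) x : ℝ) : ℂ)
  else
    ((lastCoord p q x * phi p q (-μ).toNat (((-μ).toNat + 1) / 2) x : ℝ) : ℂ)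

/-- `k_θ a_t x_0 = (sinh t, 0, …, 0; sin θ cosh t, 0, …, 0, cos θ cosh t)`. -/
theorem polar_point (p q : ℕ) (θ t : ℝ) :
    (rot p q θ * boost p q t) *ᵥ basePoint p q =
      Sum.elim (Sum.elim (fun _ => Real.sinh t) 0)
        (Sum.elim (fun k : Fin q => if (k : ℕ) = 0 then Real.sin θ * Real.cosh t else 0)
          (fun _ => Real.cos θ * Real.cosh t)) := by
  rw [← Matrix.mulVec_mulVec]
  have h : boost p q t *ᵥ basePoint p q = Sum.elim (Sum.elim (fun _ => Real.sinh t) 0)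
      (Sum.elim 0 (fun _ => Real.cosh t)) := by
    ext ((i | i) | (i | i)) <;> simp [boost, basePoint, Matrix.fromBlocks]
  rw [h]
  ext ((i | i) | (i | i)) <;>
    simp [rot, Matrix.fromBlocks, Matrix.mulVec, dotProduct, Fintype.sum_sum_type, Matrix.one_apply,
      Matrix.diagonal_apply]

theorem coshPart_polar (p q : ℕ) (hq : 1 ≤ q) (θ t : ℝ) :
    coshPart p q ((rot p q θ * boost p q t) *ᵥ basePoint p q) = Real.cosh t := by
  obtain ⟨r, rfl⟩ : ∃ r, q = r + 1 := ⟨q - 1, by omega⟩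
  rw [polar_point, coshPart]
  have h : (∑ k, (Sum.elim (Sum.elim (fun _ : Unit => Real.sinh t) (0 : Fin (p - 1) → ℝ))
      (Sum.elim (fun k : Fin (r + 1) => if (k : ℕ) = 0 then Real.sin θ * Real.cosh t else 0)
        (fun _ : Unit => Real.cos θ * Real.cosh t)) (Sum.inr k)) ^ 2) = Real.cosh t ^ 2 := by
    simp only [Sum.elim_inr, Fintype.sum_sum_type, Fin.sum_univ_succ]
    simp
    linear_combination Real.cosh t ^ 2 * Real.sin_sq_add_cos_sq θ
  rw [h, Real.sqrt_sq (Real.cosh_pos t).le]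

/-- The polar coordinate form of the generating function for `q = 1`. -/
theorem generatingFunction_polar_one (p : ℕ) (lam : ℝ) (μ : ℤ) (θ t : ℝ) :
    generatingFunction p 1 lam μ ((rot p 1 θ * boost p 1 t) *ᵥ basePoint p 1) =
      Complex.exp (Complex.I * μ * θ) * ((Real.cosh t ^ (-|lam| - rho p 1) : ℝ) : ℂ) := by
  have hc := (Real.cosh_pos t).ne'
  rw [generatingFunction, dif_pos rfl, coshPart_polar p 1 le_rfl, polar_point]
  congr 1
  simp only [lastCoord, Sum.elim_inr, Sum.elim_inl, if_true, mul_div_cancel_right₀ _ hc]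
  rw [mul_right_comm, mul_comm _ (μ : ℂ), Complex.exp_int_mul, mul_comm Complex.I (θ : ℂ),
    Complex.exp_mul_I]
  push_cast
  ring_nf

/-- The polar coordinate form of the generating function for `q > 1` and `μ ≥ 0`. -/
theorem generatingFunction_polar_nonneg (p q : ℕ) (hq : 1 < q) (lam : ℝ) (n : ℕ) (θ t : ℝ) :
    generatingFunction p q lam n ((rot p q θ * boost p q t) *ᵥ basePoint p q) =
      ((zonal q n (Real.cos θ) * Real.cosh t ^ (-lam - rho p q) : ℝ) : ℂ) := by
  have hc := (Real.cosh_pos t).ne'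
  rw [generatingFunction, dif_neg hq.ne', if_pos (by positivity), coshPart_polar p q hq.le,
    polar_point]
  simp [lastCoord, mul_div_cancel_right₀ _ hc]

end

end Hyperbolic

/-! The orbit `N^* x_0` is a paraboloid. The generator `Z = Z_{u,v}` satisfies `Z³ = 0`, so `n_{u,v}
x_0` is quadratic in `(u, v)`, with quadratic part governed by `|u|² - |v|² = Σ e_j w_j²`.
Coordinates common to `u` and `v` cancel (`e_j = 0`); the remaining ones all carry the same sign
`e_j = ±1`.

Vanishing. Let `y` be the last `q + 1` coordinates. In these cases the generating function is `F(y)`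
with `F` harmonic on `ℝ^{q+1} ∖ {0}` and homogeneous of degree `-N`, where `N = |λ| + ρ`: a power of
`y_l ± i y_0` if `q = 1`, and the Kelvin transform of a zonal harmonic if `q > 1` (`kelvin`). Since
`g` preserves the form, `x ↦ F((g x)_{neg})` solves the wave equation of the form on `ℝ^{p+q+1}`
(`wave_of_harmonic`). The orbit is deformed, keeping the coordinates `w`, into the paraboloid on
which the form equals `-ε`. Let `I(ε)` be the integral of `F` over it and `b(ε)` that of the
derivative of `F` in the null direction `z` in which the paraboloid moves, so that `I' = b / 2`. The
wave equation, Euler's identity and integration by parts along the paraboloid give `(|λ| + 1) b + ε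
b' = 0`. Hence `ε^{|λ|+1} b` is constant; as `b` stays bounded for `ε → 0`, it is zero
(`integral_fderiv_eq_zero`), and `I` is constant (`integral_eq`). Finally `I(ε) → 0` for `ε → ∞`
(`integral_eq_zero`): by dominated convergence if all `e_j ≥ 0`, and by a radial estimate if all
`e_j ≤ 0`. The latter needs `|λ| + (p - q + 1)/2 > 0`, which for `λ > 0` is the condition `μ_λ > 0`.
The analytic input is `|F| ≤ C Q^{-N/2}` on the paraboloids, `Q` being `orbitWeight`, and the
integrability of `Q^{-N/2}`.

Non-vanishing. If `λ > 0` and `μ_λ = -n ≤ 0`, then `q > p + 1`, and `f` is `lastCoord^l Δ^m (1 +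
|x|²)^{n - ρ_c}` with `l ∈ {0, 1}` and `2m = n + l`. On `a_s N^* x_0` it depends only on the norms
of the `p - 1` coordinates `u` and of the `q - p + 1` remaining ones, `y`. Integrating over `u`
turns `Δ^m` into a one-dimensional derivative of order `2m` of `(1 + x²)^{-λ-1/2}`
(`integral_lapPow`). With `τ = e^s |y|²/2` there remains an integral over `τ > 0` at `x = sinh s -
τ`, multiplied by `e^{-ρ_1 s}`. Integration by parts in `τ` (`fracInt_add`) reduces it to `∫ τ^λ (1
+ (sinh s - τ)²)^{-λ-1/2} dτ`, and the substitution `v = √τ - cosh s/√τ` shows that this is a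
positive multiple of `e^{λs}` (`fracInt_zero`). -/

namespace Hyperbolic

open MeasureTheory Filter Topology Set

/-! ### The weight of the orbit points and the integrability of its powers. -/

/-- The weight `1 + |w|² + (ε + Σ e_j w_j²)²`, which controls the size of the points of an orbit of
`N^*`. -/
def orbitWeight {ι : Type*} [Fintype ι] (e : ι → ℝ) (ε : ℝ) (w : ι → ℝ) : ℝ :=
  1 + ∑ j, w j ^ 2 + (ε + ∑ j, e j * w j ^ 2) ^ 2

section Weight

variable {ι : Type*} [Fintype ι] {e : ι → ℝ}

lemma one_le_orbitWeight (ε : ℝ) (w : ι → ℝ) : 1 ≤ orbitWeight e ε w := by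
  have := Finset.sum_nonneg fun j (_ : j ∈ Finset.univ) => sq_nonneg (w j)
  have := sq_nonneg (ε + ∑ j, e j * w j ^ 2)
  unfold orbitWeight; linarith

lemma orbitWeight_pos (ε : ℝ) (w : ι → ℝ) : 0 < orbitWeight e ε w :=
  one_pos.trans_le (one_le_orbitWeight ε w)

lemma continuous_orbitWeight (ε : ℝ) : Continuous (orbitWeight e ε) := by
  unfold orbitWeight; fun_prop

lemma sq_le_orbitWeight (ε : ℝ) (w : ι → ℝ) (j : ι) : w j ^ 2 ≤ orbitWeight e ε w := by
  have h1 := Finset.single_le_sum (fun i (_ : i ∈ Finset.univ) => sq_nonneg (w i))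
    (Finset.mem_univ j)
  have := sq_nonneg (ε + ∑ j, e j * w j ^ 2)
  unfold orbitWeight; linarith

/-- From `d² ≤ 2(ε + d)² + 2ε²`. It makes the weight with parameter `0` an integrable majorant that
is uniform for bounded `ε`, down to `ε = 0`. -/
lemma orbitWeight_zero_le {ε M : ℝ} (h0 : 0 ≤ ε) (hM : ε ≤ M) (w : ι → ℝ) :
    orbitWeight e 0 w ≤ (2 + 2 * M ^ 2) * orbitWeight e ε w := by
  have h1 := Finset.sum_nonneg fun j (_ : j ∈ Finset.univ) => sq_nonneg (w j)
  unfold orbitWeight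
  set d := ∑ j, e j * w j ^ 2
  nlinarith [sq_nonneg (d + 2 * ε), mul_nonneg (sq_nonneg M) h1, sq_nonneg (M * (ε + d)),
    mul_nonneg h0 (sub_nonneg.2 hM), mul_nonneg (h0.trans hM) (sub_nonneg.2 hM)]

/-- Terms of one sign cannot cancel, so each is bounded by the whole sum. -/
lemma sq_sum_mul_sq_ge (hs : (∀ j, 0 ≤ e j) ∨ ∀ j, e j ≤ 0) (w : ι → ℝ) (j : ι) :
    (e j * w j ^ 2) ^ 2 ≤ (∑ j, e j * w j ^ 2) ^ 2 := by
  rcases hs with hs | hs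
  · have h := Finset.single_le_sum (f := fun i => e i * w i ^ 2)
      (fun i _ => mul_nonneg (hs i) (sq_nonneg _)) (Finset.mem_univ j)
    have := mul_nonneg (hs j) (sq_nonneg (w j))
    exact pow_le_pow_left₀ this h 2
  · have h := Finset.single_le_sum (f := fun i => -e i * w i ^ 2)
      (fun i _ => mul_nonneg (neg_nonneg.2 (hs i)) (sq_nonneg _)) (Finset.mem_univ j)
    have := mul_nonneg (neg_nonneg.2 (hs j)) (sq_nonneg (w j))
    have h2 := pow_le_pow_left₀ this h 2
    simpa only [neg_mul, Finset.sum_neg_distrib, neg_sq] using h2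

lemma eq_zero_or_sq_eq_one {ι : Type*} {e : ι → ℝ} (he : ∀ j, e j ^ 3 = e j) (j : ι) : e j = 0 ∨ e j ^ 2 = 1 := by
  have h : e j * (e j ^ 2 - 1) = 0 := by linear_combination he j
  rcases mul_eq_zero.1 h with h | h
  · exact Or.inl h
  · exact Or.inr (by linarith)

lemma rpow_neg_le_of_le {a b c r : ℝ} (ha : 0 < a) (hc : 0 < c) (hr : 0 ≤ r) (h : a ≤ c * b) :
    b ^ (-r) ≤ c ^ r * a ^ (-r) := by
  have hb : 0 < b := pos_of_mul_pos_right (ha.trans_le h) hc.le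
  rw [Real.rpow_neg hb.le, Real.rpow_neg ha.le, ← div_eq_mul_inv, inv_le_comm₀ (by positivity)
    (by positivity), inv_div, div_le_iff₀ (by positivity), ← Real.mul_rpow hb.le hc.le, mul_comm b]
  exact Real.rpow_le_rpow ha.le h hr

/-- Integrability of the powers of the orbit weight. -/
theorem integrable_orbitWeight_rpow [Nonempty ι] (he : ∀ j, e j ^ 3 = e j)
    (hs : (∀ j, 0 ≤ e j) ∨ ∀ j, e j ≤ 0) {lam N : ℝ} (hlam : 0 < lam)
    (hN : N = lam + ∑ j, (1 - e j ^ 2 / 2)) :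
    Integrable (fun w : ι → ℝ => orbitWeight e 0 w ^ (-(N / 2))) := by
  set D : ℝ := ((Fintype.card ι : ℕ) : ℝ) with hD
  have hDpos : 0 < D := by rw [hD]; exact_mod_cast Fintype.card_pos
  have hlD : 0 < lam / D := div_pos hlam hDpos
  -- The exponent `N/2` is distributed over the coordinates. Since `2Q ≥ (1 + w_j²)^{1+e_j²}`, the
  -- share `r j` produces decay of order `1 + λ/D` or `1 + 2λ/D` in `w_j`; the surplus from `λ`
  -- makes every one-dimensional factor integrable.
  let r : ι → ℝ := fun j => (1 - e j ^ 2 / 2 + lam / D) / 2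
  have hr : ∀ j, 0 ≤ r j := fun j => by
    rcases eq_zero_or_sq_eq_one he j with h | h
    · simp only [r, h]; positivity
    · simp only [r, h]; linarith
  have hrs : ∑ j, r j = N / 2 := by
    simp only [r]
    rw [← Finset.sum_div, Finset.sum_add_distrib, hN]
    simp only [Finset.sum_const, Finset.card_univ, nsmul_eq_mul, ← hD]
    field_simp; ring
  let h : ι → ℝ → ℝ := fun j x => 2 ^ (r j) * ((1 + x ^ 2) ^ (1 + e j ^ 2)) ^ (-(r j))
  have hint : ∀ j, Integrable (h j) := fun j => by
    refine Integrable.const_mul ?_ _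
    have key : ∀ s : ℝ, 1 < s → Integrable (fun x : ℝ => (1 + x ^ 2) ^ (-s / 2)) := by
      intro s hs
      have := integrable_rpow_neg_one_add_norm_sq (E := ℝ) (μ := volume) (r := s) (by simpa using hs)
      simpa using this
    have h2 : ∀ x : ℝ, ((1 + x ^ 2) ^ (1 + e j ^ 2)) ^ (-(r j)) =
        (1 + x ^ 2) ^ (-((1 + e j ^ 2) * (2 * r j)) / 2) := fun x => by
      rw [← Real.rpow_mul (by positivity)]; congr 1; ring
    simp_rw [h2]
    refine key _ ?_
    rcases eq_zero_or_sq_eq_one he j with h | h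
    · simp only [r, h]; linarith
    · simp only [r, h]; linarith
  have hprod := Integrable.fintype_prod (μ := fun _ : ι => (volume : Measure ℝ)) hint
  refine Integrable.mono' hprod ?_ (Eventually.of_forall fun w => ?_)
  · refine Continuous.aestronglyMeasurable ?_
    exact (continuous_orbitWeight 0).rpow_const fun w => Or.inl (orbitWeight_pos 0 w).ne'
  · rw [Real.norm_of_nonneg (Real.rpow_nonneg (orbitWeight_pos 0 w).le _), ← hrs,
      ← Finset.sum_neg_distrib, Real.rpow_sum_of_pos (orbitWeight_pos 0 w)]
    refine Finset.prod_le_prod (fun j _ => Real.rpow_nonneg (orbitWeight_pos 0 w).le _)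
      fun j _ => rpow_neg_le_of_le (by positivity) two_pos (hr j) ?_
    have h1 := sq_sum_mul_sq_ge hs w j
    have h2 := Finset.single_le_sum (fun i (_ : i ∈ Finset.univ) => sq_nonneg (w i))
      (Finset.mem_univ j)
    rcases eq_zero_or_sq_eq_one he j with h | h
    · simp only [h]; norm_num
      have := sq_le_orbitWeight (e := e) 0 w j
      have := one_le_orbitWeight (e := e) 0 w
      linarith
    · rw [h]; norm_num
      have h3 : (e j * w j ^ 2) ^ 2 = (w j ^ 2) ^ 2 := by rw [mul_pow, h, one_mul]
      rw [h3] at h1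
      have : 1 + (w j ^ 2) ^ 2 ≤ orbitWeight e 0 w := by
        unfold orbitWeight
        have := Finset.sum_nonneg fun j (_ : j ∈ Finset.univ) => sq_nonneg (w j)
        rw [zero_add]; linarith
      nlinarith [sq_nonneg (w j ^ 2 - 1)]

end Weight

/-! ### Homogeneous functions of negative degree and Euler's identity. -/

section Homogeneous

variable {E W : Type*} [NormedAddCommGroup E] [NormedSpace ℝ E]
  [NormedAddCommGroup W] [NormedSpace ℝ W]

/-- `G` is positively homogeneous of degree `-N` away from the origin. -/
def IsHomogeneousNeg (G : E → W) (N : ℝ) : Prop :=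
  ∀ r : ℝ, 0 < r → ∀ y : E, y ≠ 0 → G (r • y) = r ^ (-N) • G y

lemma IsHomogeneousNeg.exists_bound [FiniteDimensional ℝ E] {G : E → W} {N : ℝ} (h : IsHomogeneousNeg G N)
    (hc : ContinuousOn G {0}ᶜ) : ∃ C, 0 ≤ C ∧ ∀ y, y ≠ 0 → ‖G y‖ ≤ C * ‖y‖ ^ (-N) := by
  have hcpt : IsCompact (Metric.sphere (0 : E) 1) := isCompact_sphere 0 1
  obtain ⟨C, hC⟩ := hcpt.exists_bound_of_continuousOn (hc.mono fun y hy => by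
    rintro (rfl : y = 0); simp at hy)
  refine ⟨max C 0, le_max_right _ _, fun y hy => ?_⟩
  have hn : 0 < ‖y‖ := norm_pos_iff.2 hy
  have h1 : ‖y‖⁻¹ • y ∈ Metric.sphere (0 : E) 1 := by simp [norm_smul, hn.ne']
  have h2 : y = ‖y‖ • (‖y‖⁻¹ • y) := by rw [smul_smul, mul_inv_cancel₀ hn.ne', one_smul]
  have h3 : G y = ‖y‖ ^ (-N) • G (‖y‖⁻¹ • y) := by
    conv_lhs => rw [h2]
    exact h _ hn _ (by simp [hy])
  rw [h3, norm_smul, Real.norm_of_nonneg (by positivity), mul_comm]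
  gcongr
  exact (hC _ h1).trans (le_max_left _ _)

lemma IsHomogeneousNeg.fderiv_real {G : E → W} {N : ℝ} (h : IsHomogeneousNeg G N) :
    IsHomogeneousNeg (fderiv ℝ G) (N + 1) := by
  intro r hr y hy
  have h1 : (fun x => G (r • x)) =ᶠ[𝓝 y] fun x => r ^ (-N) • G x := by
    filter_upwards [isOpen_compl_singleton.mem_nhds hy] with x hx using h r hr x hx
  have h2 := h1.fderiv_eq (𝕜 := ℝ)
  rw [fderiv_comp_smul, show (fun x => r ^ (-N) • G x) = r ^ (-N) • G from rfl,
    fderiv_const_smul_field] at h2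
  have h3 : r • fderiv ℝ G (r • y) = r • (r ^ (-(N + 1)) • fderiv ℝ G y) := by
    rw [h2, Pi.smul_apply, smul_smul, show -(N + 1) = -N - 1 by ring, Real.rpow_sub_one hr.ne',
      mul_div_cancel₀ _ hr.ne']
  exact smul_right_injective _ hr.ne' h3

lemma IsHomogeneousNeg.euler {G : E → W} {N : ℝ} (h : IsHomogeneousNeg G N) {y : E} (hy : y ≠ 0)
    (hd : DifferentiableAt ℝ G y) : fderiv ℝ G y y = -N • G y := by
  have h1 : HasDerivAt (fun r : ℝ => G (r • y)) (fderiv ℝ G y y) 1 := by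
    have h2 : HasDerivAt (fun r : ℝ => r • y) y 1 := by
      simpa using (hasDerivAt_id (1 : ℝ)).smul_const y
    have h3 : HasFDerivAt G (fderiv ℝ G y) ((1 : ℝ) • y) := by rw [one_smul]; exact hd.hasFDerivAt
    exact h3.comp_hasDerivAt (1 : ℝ) h2
  have h4 : HasDerivAt (fun r : ℝ => G (r • y)) (-N • G y) 1 := by
    have h5 : HasDerivAt (fun r : ℝ => r ^ (-N) • G y) (-N • G y) 1 := by
      simpa using (Real.hasDerivAt_rpow_const (x := 1) (p := -N) (Or.inl one_ne_zero)).smul_const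
        (G y)
    refine h5.congr_of_eventuallyEq ?_
    filter_upwards [lt_mem_nhds (zero_lt_one' ℝ)] with r hr using h r hr y hy
  exact h1.unique h4

end Homogeneous

end Hyperbolic

/-! ### Families of paraboloids: uniform bounds and differentiation in the parameter. -/

namespace Hyperbolic

open MeasureTheory Filter Topology Set

/-- A homogeneous function `F` on `E ∖ {0}`, annihilated by a second order operator, and a family of
paraboloids in `E` adapted to this operator. -/
structure ParaboloidFamily (ι E : Type*) [Fintype ι] [NormedAddCommGroup E] [NormedSpace ℝ E]
    (F : E → ℂ) (lam : ℝ) where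
  e : ι → ℝ
  z : E
  zm : E
  ξ : ι → E
  ξ' : ι → E
  c : ℝ
  N : ℝ
  lam_pos : 0 < lam
  c_pos : 0 < c
  cube : ∀ j, e j ^ 3 = e j
  sign : (∀ j, 0 ≤ e j) ∨ ∀ j, e j ≤ 0
  compat : ∀ j, e j • ξ' j = e j ^ 2 • ξ j
  N_eq : N = lam + ∑ j, (1 - e j ^ 2 / 2)
  smooth : ∀ y, y ≠ 0 → ContDiffAt ℝ 2 F y
  homog : IsHomogeneousNeg F N
  wave : ∀ y, y ≠ 0 →
    fderiv ℝ (fderiv ℝ F) y z zm = ∑ j, fderiv ℝ (fderiv ℝ F) y (ξ j) (ξ' j)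
  lower : ∀ ε w, 0 ≤ ε → c * orbitWeight e ε w ≤
    ‖(1 / 2 : ℝ) • zm + ((ε + ∑ j, e j * w j ^ 2) / 2) • z + ∑ j, w j • ξ j‖ ^ 2

namespace ParaboloidFamily

variable {ι E : Type*} [Fintype ι] [NormedAddCommGroup E] [NormedSpace ℝ E]
  {F : E → ℂ} {lam : ℝ} (O : ParaboloidFamily ι E F lam)

/-- The points of the paraboloid with parameter `ε`. -/
noncomputable def pt (ε : ℝ) (w : ι → ℝ) : E :=
  (1 / 2 : ℝ) • O.zm + ((ε + ∑ j, O.e j * w j ^ 2) / 2) • O.z + ∑ j, w j • O.ξ j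

lemma lower_pt {ε : ℝ} (hε : 0 ≤ ε) (w : ι → ℝ) :
    O.c * orbitWeight O.e ε w ≤ ‖O.pt ε w‖ ^ 2 := O.lower ε w hε

lemma pt_ne_zero {ε : ℝ} (hε : 0 ≤ ε) (w : ι → ℝ) : O.pt ε w ≠ 0 := by
  intro h
  have := O.lower_pt hε w
  rw [h, norm_zero] at this
  have := mul_pos O.c_pos (orbitWeight_pos (e := O.e) ε w)
  linarith

lemma continuous_pt (ε : ℝ) : Continuous (O.pt ε) := by
  unfold pt; fun_prop

lemma N_nonneg : 0 ≤ O.N := by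
  rw [O.N_eq]
  refine add_nonneg O.lam_pos.le (Finset.sum_nonneg fun j _ => ?_)
  rcases eq_zero_or_sq_eq_one O.cube j with h | h <;> rw [h] <;> norm_num

lemma continuousOn_F (O : ParaboloidFamily ι E F lam) : ContinuousOn F {0}ᶜ :=
  fun y hy => (O.smooth y hy).continuousAt.continuousWithinAt

lemma contDiffAt_fderiv (O : ParaboloidFamily ι E F lam) {y : E} (hy : y ≠ 0) :
    ContDiffAt ℝ 1 (fderiv ℝ F) y :=
  (O.smooth y hy).fderiv_right (by norm_num)

lemma continuousOn_fderiv (O : ParaboloidFamily ι E F lam) : ContinuousOn (fderiv ℝ F) {0}ᶜ :=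
  fun _ hy => (O.contDiffAt_fderiv hy).continuousAt.continuousWithinAt

lemma continuousOn_fderiv_fderiv (O : ParaboloidFamily ι E F lam) :
    ContinuousOn (fderiv ℝ (fderiv ℝ F)) {0}ᶜ :=
  fun _ hy => ((O.contDiffAt_fderiv hy).fderiv_right (m := 0)
    (by norm_num)).continuousAt.continuousWithinAt

lemma continuous_comp_pt {W : Type*} [TopologicalSpace W] {G : E → W} (hG : ContinuousOn G {0}ᶜ)
    {ε : ℝ} (hε : 0 ≤ ε) : Continuous fun w => G (O.pt ε w) :=
  hG.comp_continuous (O.continuous_pt ε) fun w => O.pt_ne_zero hε w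

lemma exists_bound_weight [FiniteDimensional ℝ E] {W : Type*} [NormedAddCommGroup W]
    [NormedSpace ℝ W] {G : E → W} {M : ℝ} (hM : 0 ≤ M) (h : IsHomogeneousNeg G M)
    (hc : ContinuousOn G {0}ᶜ) :
    ∃ C, 0 ≤ C ∧ ∀ ε w, 0 ≤ ε → ‖G (O.pt ε w)‖ ≤ C * orbitWeight O.e ε w ^ (-(M / 2)) := by
  obtain ⟨C, hC0, hC⟩ := h.exists_bound hc
  have hcpos := O.c_pos
  refine ⟨C * O.c⁻¹ ^ (M / 2), by positivity, fun ε w hε => (hC _ (O.pt_ne_zero hε w)).trans ?_⟩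
  rw [mul_assoc]
  gcongr
  have h1 : ‖O.pt ε w‖ ^ (-M) = (‖O.pt ε w‖ ^ 2) ^ (-(M / 2)) := by
    rw [← Real.rpow_natCast, ← Real.rpow_mul (norm_nonneg _)]; congr 1; push_cast; ring
  rw [h1]
  refine rpow_neg_le_of_le (orbitWeight_pos ε w) (inv_pos.2 hcpos) (by positivity) ?_
  rw [inv_mul_eq_div, le_div_iff₀ hcpos, mul_comm]
  exact O.lower_pt hε w

/-- A bound, locally uniform in the parameter, by the weight with parameter `0`. -/
lemma orbitWeight_rpow_le {ε M : ℝ} (h0 : 0 ≤ ε) (hM : ε ≤ M) (w : ι → ℝ) :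
    orbitWeight O.e ε w ^ (-(O.N / 2)) ≤
      (2 + 2 * M ^ 2) ^ (O.N / 2) * orbitWeight O.e 0 w ^ (-(O.N / 2)) :=
  rpow_neg_le_of_le (orbitWeight_pos _ _) (by positivity) (by have := O.N_nonneg; positivity)
    (orbitWeight_zero_le h0 hM w)

/-- Each further derivative of `F` lowers the degree by one and so leaves a spare factor `Q^{1/2}`.
The spare factors absorb the powers of `w` that appear in the integrations by parts. -/
lemma exists_bound_zero [FiniteDimensional ℝ E] {W : Type*} [NormedAddCommGroup W]
    [NormedSpace ℝ W] {G : E → W} {i : ℝ} (hi : 0 ≤ i) (h : IsHomogeneousNeg G (O.N + i))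
    (hc : ContinuousOn G {0}ᶜ) (M : ℝ) :
    ∃ C, 0 ≤ C ∧ ∀ ε w, 0 ≤ ε → ε ≤ M →
      ‖G (O.pt ε w)‖ * orbitWeight O.e ε w ^ (i / 2) ≤ C * orbitWeight O.e 0 w ^ (-(O.N / 2)) := by
  obtain ⟨C, hC0, hC⟩ := O.exists_bound_weight (add_nonneg O.N_nonneg hi) h hc
  refine ⟨C * (2 + 2 * M ^ 2) ^ (O.N / 2), by positivity, fun ε w h0 hM => ?_⟩
  have hp := orbitWeight_pos (e := O.e) ε w
  calc _ ≤ C * orbitWeight O.e ε w ^ (-((O.N + i) / 2)) * orbitWeight O.e ε w ^ (i / 2) := by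
        gcongr; exact hC ε w h0
    _ = C * orbitWeight O.e ε w ^ (-(O.N / 2)) := by
        rw [mul_assoc, ← Real.rpow_add hp]; congr 2; ring
    _ ≤ _ := by
        rw [mul_assoc]; gcongr; exact O.orbitWeight_rpow_le h0 hM w

lemma exists_bound_zero' [FiniteDimensional ℝ E] {W : Type*} [NormedAddCommGroup W]
    [NormedSpace ℝ W] {G : E → W} {i : ℝ} (hi : 0 ≤ i) (h : IsHomogeneousNeg G (O.N + i))
    (hc : ContinuousOn G {0}ᶜ) (M : ℝ) :
    ∃ C, 0 ≤ C ∧ ∀ ε w, 0 ≤ ε → ε ≤ M →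
      ‖G (O.pt ε w)‖ ≤ C * orbitWeight O.e 0 w ^ (-(O.N / 2)) := by
  obtain ⟨C, hC0, hC⟩ := O.exists_bound_zero hi h hc M
  refine ⟨C, hC0, fun ε w h0 hM => le_trans ?_ (hC ε w h0 hM)⟩
  refine le_mul_of_one_le_right (norm_nonneg _) (Real.one_le_rpow (one_le_orbitWeight ε w) ?_)
  positivity

lemma homog_fderiv : IsHomogeneousNeg (fderiv ℝ F) (O.N + 1) := O.homog.fderiv_real

lemma homog_fderiv_fderiv : IsHomogeneousNeg (fderiv ℝ (fderiv ℝ F)) (O.N + 2) := by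
  have := O.homog_fderiv.fderiv_real
  rwa [add_assoc, one_add_one_eq_two] at this

variable [Nonempty ι]

lemma integrable_weight :
    Integrable (fun w : ι → ℝ => orbitWeight O.e 0 w ^ (-(O.N / 2))) :=
  integrable_orbitWeight_rpow O.cube O.sign O.lam_pos O.N_eq

variable [FiniteDimensional ℝ E]

lemma integrable_comp_pt {W : Type*} [NormedAddCommGroup W] [NormedSpace ℝ W]
    [SecondCountableTopology W] {G : E → W} {i : ℝ}
    (hi : 0 ≤ i) (h : IsHomogeneousNeg G (O.N + i)) (hc : ContinuousOn G {0}ᶜ) {ε : ℝ}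
    (hε : 0 ≤ ε) : Integrable fun w => G (O.pt ε w) := by
  obtain ⟨C, -, hC⟩ := O.exists_bound_zero' hi h hc ε
  exact Integrable.mono' (O.integrable_weight.const_mul C)
    (O.continuous_comp_pt hc hε).aestronglyMeasurable
    (Eventually.of_forall fun w => hC ε w hε le_rfl)

lemma integrable_F {ε : ℝ} (hε : 0 ≤ ε) : Integrable fun w => F (O.pt ε w) :=
  O.integrable_comp_pt le_rfl (by simpa using O.homog) O.continuousOn_F hε

lemma integrable_fderiv {ε : ℝ} (hε : 0 ≤ ε) (a : E) :
    Integrable fun w => fderiv ℝ F (O.pt ε w) a :=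
  (O.integrable_comp_pt zero_le_one O.homog_fderiv O.continuousOn_fderiv hε).apply_continuousLinearMap
    a

/-- Differentiation under the integral sign with respect to the parameter. -/
lemma hasDerivAt_integral {W : Type*} [NormedAddCommGroup W] [NormedSpace ℝ W]
    [SecondCountableTopology W] {G : E → W} {i : ℝ} (hi : 0 ≤ i)
    (h : IsHomogeneousNeg G (O.N + i)) (hd : ∀ y, y ≠ 0 → ContDiffAt ℝ 1 G y) {ε : ℝ}
    (hε : 0 < ε) :
    HasDerivAt (fun ε => ∫ w, G (O.pt ε w)) (∫ w, fderiv ℝ G (O.pt ε w) ((1 / 2 : ℝ) • O.z)) ε := by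
  have hc : ContinuousOn G {0}ᶜ := fun y hy => (hd y hy).continuousAt.continuousWithinAt
  have hc' : ContinuousOn (fderiv ℝ G) {0}ᶜ := fun y hy =>
    ((hd y hy).fderiv_right (m := 0) (by norm_num)).continuousAt.continuousWithinAt
  have h' : IsHomogeneousNeg (fderiv ℝ G) (O.N + (i + 1)) := by
    rw [← add_assoc]; exact h.fderiv_real
  obtain ⟨C, -, hC⟩ := O.exists_bound_zero' (by positivity) h' hc' (2 * ε)
  refine (hasDerivAt_integral_of_dominated_loc_of_deriv_le (s := Ioo 0 (2 * ε))
    (F := fun ε w => G (O.pt ε w)) (F' := fun ε w => fderiv ℝ G (O.pt ε w) ((1 / 2 : ℝ) • O.z))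
    (bound := fun w => C * orbitWeight O.e 0 w ^ (-(O.N / 2)) * ‖(1 / 2 : ℝ) • O.z‖)
    (Ioo_mem_nhds hε (by linarith)) ?_ (O.integrable_comp_pt hi h hc hε.le) ?_ ?_
    ((O.integrable_weight.const_mul C).mul_const _) ?_).2
  · filter_upwards [lt_mem_nhds hε] with x hx
    exact (O.continuous_comp_pt hc hx.le).aestronglyMeasurable
  · exact ((O.continuous_comp_pt hc' hε.le).clm_apply continuous_const).aestronglyMeasurable
  · refine Eventually.of_forall fun w x hx => ?_
    refine (ContinuousLinearMap.le_opNorm _ _).trans ?_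
    gcongr
    exact hC x w hx.1.le hx.2.le
  · refine Eventually.of_forall fun w x hx => ?_
    have h1 : HasDerivAt (fun x => O.pt x w) ((1 / 2 : ℝ) • O.z) x := by
      unfold pt
      have h2 : HasDerivAt (fun x : ℝ => ((x + ∑ j, O.e j * w j ^ 2) / 2) • O.z)
          ((1 / 2 : ℝ) • O.z) x := (((hasDerivAt_id x).add_const _).div_const 2).smul_const _
      exact (h2.const_add _).add_const _
    exact ((hd _ (O.pt_ne_zero hx.1.le w)).differentiableAt (by norm_num)).hasFDerivAt.comp_hasDerivAt
      x h1

end ParaboloidFamily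

end Hyperbolic

/-! ### The differential equation in the parameter; the integral is constant. -/

namespace Hyperbolic

open MeasureTheory Filter Topology Set

namespace ParaboloidFamily

variable {ι E : Type*} [Fintype ι] [NormedAddCommGroup E] [NormedSpace ℝ E]
  {F : E → ℂ} {lam : ℝ} (O : ParaboloidFamily ι E F lam)

/-- The tangent vector of the paraboloid in the direction of the coordinate `w_j`. -/
noncomputable def tangent (w : ι → ℝ) (j : ι) : E := O.ξ j + (O.e j * w j) • O.z

lemma symm_fderiv_fderiv (O : ParaboloidFamily ι E F lam) {y : E} (hy : y ≠ 0) (a b : E) :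
    fderiv ℝ (fderiv ℝ F) y a b = fderiv ℝ (fderiv ℝ F) y b a :=
  (O.smooth y hy).isSymmSndFDerivAt (by simp) a b

lemma euler_fderiv (O : ParaboloidFamily ι E F lam) {y : E} (hy : y ≠ 0) (a : E) :
    fderiv ℝ (fderiv ℝ F) y y a = -((O.N + 1 : ℝ) : ℂ) * fderiv ℝ F y a := by
  rw [O.homog_fderiv.euler hy ((O.contDiffAt_fderiv hy).differentiableAt (by norm_num))]
  simp

/-- The wave equation and Euler's identity, rewritten in terms of derivatives along the
paraboloid. -/
lemma pointwise_identity {ε : ℝ} (hε : 0 ≤ ε) (w : ι → ℝ) :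
    ((O.N + 1 : ℝ) : ℂ) * fderiv ℝ F (O.pt ε w) O.z +
      (ε / 2 : ℝ) * fderiv ℝ (fderiv ℝ F) (O.pt ε w) O.z O.z =
    ∑ j, (-(1 / 2) * fderiv ℝ (fderiv ℝ F) (O.pt ε w) (O.tangent w j) (O.ξ' j) -
      ((1 - O.e j ^ 2 / 2 : ℝ) : ℂ) *
        (w j • fderiv ℝ (fderiv ℝ F) (O.pt ε w) (O.tangent w j) O.z)) := by
  have hy := O.pt_ne_zero hε w
  set y := O.pt ε w with hydef
  set B := fderiv ℝ (fderiv ℝ F) y with hB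
  have hsymm : ∀ a b, B a b = B b a := O.symm_fderiv_fderiv hy
  have h1 := O.euler_fderiv hy O.z
  have h2 : B y O.z = (1 / 2 : ℂ) * B O.z O.zm +
      ((ε + ∑ j, O.e j * w j ^ 2) / 2 : ℝ) * B O.z O.z + ∑ j, (w j : ℂ) * B (O.ξ j) O.z := by
    conv_lhs => rw [hydef, pt]
    simp only [map_add, map_smul, map_sum, _root_.add_apply, _root_.smul_apply,
      _root_.sum_apply, Complex.real_smul]
    rw [hsymm O.zm]
    push_cast
    ring
  -- The wave equation removes the direction `zm`, the only one in the expansion of `y` that is not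
  -- a combination of `z` and the tangent vectors.
  rw [O.wave y hy] at h2
  have h3 : ∀ j, -(1 / 2) * B (O.tangent w j) (O.ξ' j) -
      ((1 - O.e j ^ 2 / 2 : ℝ) : ℂ) * (w j • B (O.tangent w j) O.z) =
      -(1 / 2) * B (O.ξ j) (O.ξ' j) - (w j : ℂ) * B (O.ξ j) O.z
        - ((1 / 2 : ℝ) : ℂ) * ((O.e j * w j ^ 2 : ℝ) : ℂ) * B O.z O.z := by
    intro j
    -- `compat` exchanges `ξ'` for `ξ` in the term that `tangent` adds to the wave operator; this
    -- produces the correction `e_j²/2` in `1 - e_j²/2`.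
    have h4 : (O.e j : ℂ) * B O.z (O.ξ' j) = (O.e j : ℂ) ^ 2 * B (O.ξ j) O.z := by
      have := congrArg (B O.z) (O.compat j)
      simp only [map_smul, Complex.real_smul] at this
      rw [hsymm (O.ξ j)]
      exact_mod_cast this
    have h5 : (O.e j : ℂ) ^ 3 = O.e j := by exact_mod_cast O.cube j
    simp only [tangent, map_add, map_smul, _root_.add_apply, _root_.smul_apply,
      Complex.real_smul]
    push_cast
    linear_combination (-(1 / 2) * (w j : ℂ)) * h4 + ((w j : ℂ) ^ 2 * B O.z O.z / 2) * h5
  rw [Finset.sum_congr rfl fun j _ => h3 j, Finset.sum_sub_distrib, Finset.sum_sub_distrib,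
    ← Finset.mul_sum, ← Finset.sum_mul, ← Finset.mul_sum]
  rw [h1] at h2
  push_cast at h2 ⊢
  linear_combination -h2

lemma hasDerivAt_pt_line [DecidableEq ι] (ε : ℝ) (w : ι → ℝ) (j : ι) :
    HasDerivAt (fun t : ℝ => O.pt ε (w + t • Pi.single j 1)) (O.tangent w j) 0 := by
  have h1 : ∀ t : ℝ, O.pt ε (w + t • Pi.single j 1) =
      O.pt ε w + (t • O.ξ j + (O.e j * (2 * t * w j + t ^ 2) / 2) • O.z) := by
    intro t
    have h2 : ∀ i, O.e i * (w + t • (Pi.single j 1 : ι → ℝ)) i ^ 2 =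
        O.e i * w i ^ 2 + if i = j then O.e j * (2 * t * w j + t ^ 2) else 0 := by
      intro i
      by_cases h : i = j
      · subst h; simp; ring
      · simp [h]
    have h3 : ∀ i, (w + t • (Pi.single j 1 : ι → ℝ)) i • O.ξ i =
        w i • O.ξ i + if i = j then t • O.ξ j else 0 := by
      intro i
      by_cases h : i = j
      · subst h; simp [add_smul]
      · simp [h]
    unfold pt
    rw [Finset.sum_congr rfl fun i _ => h2 i, Finset.sum_congr rfl fun i _ => h3 i,
      Finset.sum_add_distrib, Finset.sum_add_distrib]
    simp only [Finset.sum_ite_eq', Finset.mem_univ, if_true]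
    module
  simp_rw [h1]
  refine HasDerivAt.const_add _ ?_
  have h4 : HasDerivAt (fun t : ℝ => O.e j * (2 * t * w j + t ^ 2) / 2) (O.e j * w j) 0 := by
    have h5 := ((((hasDerivAt_id (0 : ℝ)).const_mul 2).mul_const (w j)).add
      ((hasDerivAt_id (0 : ℝ)).pow 2)).const_mul (O.e j) |>.div_const 2
    refine h5.congr_deriv ?_
    simp
    ring
  have h6 := ((hasDerivAt_id (0 : ℝ)).smul_const (O.ξ j)).add (h4.smul_const O.z)
  refine h6.congr_deriv ?_
  simp [tangent]

lemma hasLineDerivAt_fderiv [DecidableEq ι] {ε : ℝ} (hε : 0 ≤ ε) (a : E) (w : ι → ℝ) (j : ι) :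
    HasLineDerivAt ℝ (fun w => fderiv ℝ F (O.pt ε w) a)
      (fderiv ℝ (fderiv ℝ F) (O.pt ε w) (O.tangent w j) a) w (Pi.single j 1) := by
  have h1 := ((O.contDiffAt_fderiv (O.pt_ne_zero hε w)).differentiableAt (by norm_num)).hasFDerivAt
  have h2 : HasFDerivAt (fderiv ℝ F) (fderiv ℝ (fderiv ℝ F) (O.pt ε w))
      (O.pt ε (w + (0 : ℝ) • Pi.single j 1)) := by simpa using h1
  have h3 := h2.comp_hasDerivAt (0 : ℝ) (O.hasDerivAt_pt_line ε w j)
  exact h3.clm_apply (hasDerivAt_const _ a) |>.congr_deriv (by simp)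

lemma continuous_snd {ε : ℝ} (hε : 0 ≤ ε) (a : E) (j : ι) :
    Continuous fun w => fderiv ℝ (fderiv ℝ F) (O.pt ε w) (O.tangent w j) a := by
  refine ((O.continuous_comp_pt O.continuousOn_fderiv_fderiv hε).clm_apply ?_).clm_apply
    continuous_const
  unfold tangent; fun_prop

lemma norm_tangent_le (w : ι → ℝ) (j : ι) :
    ‖O.tangent w j‖ ≤ ‖O.ξ j‖ + |O.e j| * |w j| * ‖O.z‖ := by
  refine (norm_add_le _ _).trans ?_
  rw [norm_smul, Real.norm_eq_abs, abs_mul]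

variable [FiniteDimensional ℝ E] [Nonempty ι]

/-- Second derivatives of `F` have degree `-(N + 2)`, so a full factor `Q` is available. This is
exactly what `w_j * tangent`, of size `w_j²`, requires. -/
lemma integrable_of_le_snd {ε : ℝ} (hε : 0 ≤ ε) {g : (ι → ℝ) → ℂ} (hg : Continuous g) (K : ℝ)
    (h : ∀ w, ‖g w‖ ≤ K * (‖fderiv ℝ (fderiv ℝ F) (O.pt ε w)‖ * orbitWeight O.e ε w)) :
    Integrable g := by
  obtain ⟨C, hC0, hC⟩ := O.exists_bound_zero zero_le_two O.homog_fderiv_fderiv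
    O.continuousOn_fderiv_fderiv ε
  refine Integrable.mono' (O.integrable_weight.const_mul (|K| * C)) hg.aestronglyMeasurable
    (Eventually.of_forall fun w => (h w).trans ?_)
  have h1 := hC ε w hε le_rfl
  rw [div_self two_ne_zero, Real.rpow_one] at h1
  have h2 := orbitWeight_pos (e := O.e) ε w
  calc _ ≤ |K| * (‖fderiv ℝ (fderiv ℝ F) (O.pt ε w)‖ * orbitWeight O.e ε w) := by
        gcongr; exact le_abs_self K
    _ ≤ |K| * (C * orbitWeight O.e 0 w ^ (-(O.N / 2))) := by gcongr
    _ = _ := by ring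

lemma integrable_snd {ε : ℝ} (hε : 0 ≤ ε) (a : E) (j : ι) :
    Integrable fun w => fderiv ℝ (fderiv ℝ F) (O.pt ε w) (O.tangent w j) a := by
  refine O.integrable_of_le_snd hε (O.continuous_snd hε a j)
    ((‖O.ξ j‖ + |O.e j| * ‖O.z‖) * ‖a‖) fun w => ?_
  refine (ContinuousLinearMap.le_opNorm₂ _ _ _).trans ?_
  have h1 := O.norm_tangent_le w j
  have h2 := sq_le_orbitWeight (e := O.e) ε w j
  have h3 := one_le_orbitWeight (e := O.e) ε w
  have h4 : |w j| ≤ orbitWeight O.e ε w := by nlinarith [sq_nonneg (|w j| - 1), sq_abs (w j)]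
  have h5 : ‖O.tangent w j‖ ≤ (‖O.ξ j‖ + |O.e j| * ‖O.z‖) * orbitWeight O.e ε w := by
    have h6 : ‖O.ξ j‖ ≤ ‖O.ξ j‖ * orbitWeight O.e ε w := le_mul_of_one_le_right (norm_nonneg _) h3
    have h7 : |O.e j| * |w j| * ‖O.z‖ ≤ |O.e j| * orbitWeight O.e ε w * ‖O.z‖ := by gcongr
    linarith
  calc _ ≤ ‖fderiv ℝ (fderiv ℝ F) (O.pt ε w)‖ *
        ((‖O.ξ j‖ + |O.e j| * ‖O.z‖) * orbitWeight O.e ε w) * ‖a‖ := by gcongr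
    _ = _ := by ring

lemma integrable_coord_mul_snd {ε : ℝ} (hε : 0 ≤ ε) (a : E) (j : ι) :
    Integrable fun w => w j • fderiv ℝ (fderiv ℝ F) (O.pt ε w) (O.tangent w j) a := by
  refine O.integrable_of_le_snd hε ((continuous_apply j).smul (O.continuous_snd hε a j))
    ((‖O.ξ j‖ + |O.e j| * ‖O.z‖) * ‖a‖) fun w => ?_
  rw [norm_smul, Real.norm_eq_abs]
  have h0 := ContinuousLinearMap.le_opNorm₂ (fderiv ℝ (fderiv ℝ F) (O.pt ε w)) (O.tangent w j) a
  have h1 := O.norm_tangent_le w j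
  have h2 := sq_le_orbitWeight (e := O.e) ε w j
  have h3 := one_le_orbitWeight (e := O.e) ε w
  have h4 : |w j| ≤ orbitWeight O.e ε w := by nlinarith [sq_nonneg (|w j| - 1), sq_abs (w j)]
  have h5 : |w j| * ‖O.tangent w j‖ ≤
      (‖O.ξ j‖ + |O.e j| * ‖O.z‖) * orbitWeight O.e ε w := by
    have h6 : |w j| * ‖O.ξ j‖ ≤ orbitWeight O.e ε w * ‖O.ξ j‖ := by gcongr
    have h7 : |O.e j| * (|w j| * |w j|) * ‖O.z‖ ≤ |O.e j| * orbitWeight O.e ε w * ‖O.z‖ := by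
      gcongr; rwa [← pow_two, sq_abs]
    nlinarith [mul_le_mul_of_nonneg_left h1 (abs_nonneg (w j))]
  calc _ ≤ |w j| * (‖fderiv ℝ (fderiv ℝ F) (O.pt ε w)‖ * ‖O.tangent w j‖ * ‖a‖) := by gcongr
    _ = ‖fderiv ℝ (fderiv ℝ F) (O.pt ε w)‖ * (|w j| * ‖O.tangent w j‖) * ‖a‖ := by ring
    _ ≤ ‖fderiv ℝ (fderiv ℝ F) (O.pt ε w)‖ *
        ((‖O.ξ j‖ + |O.e j| * ‖O.z‖) * orbitWeight O.e ε w) * ‖a‖ := by gcongr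
    _ = _ := by ring

/-- The integrand is the derivative in `w_j` of an integrable function. -/
lemma integral_snd {ε : ℝ} (hε : 0 ≤ ε) (a : E) (j : ι) :
    ∫ w, fderiv ℝ (fderiv ℝ F) (O.pt ε w) (O.tangent w j) a = 0 := by
  classical
  have h := integral_bilinear_hasLineDerivAt_right_eq_neg_left_of_integrable
    (μ := (volume : Measure (ι → ℝ))) (f := fun _ => (1 : ℝ)) (f' := fun _ => 0)
    (g := fun w => fderiv ℝ F (O.pt ε w) a)
    (g' := fun w => fderiv ℝ (fderiv ℝ F) (O.pt ε w) (O.tangent w j) a)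
    (v := Pi.single j 1) (B := ContinuousLinearMap.lsmul ℝ ℝ) (by simp)
    (by simpa using O.integrable_snd hε a j) (by simpa using O.integrable_fderiv hε a)
    (fun x _ => hasDerivAt_const _ _) (fun x _ => O.hasLineDerivAt_fderiv hε a x j)
  simpa using h

/-- Integration by parts against `w_j`. The product `w_j ∂_a F` is integrable because `|w_j| ≤
Q^{1/2}` and first derivatives have a factor `Q^{1/2}` to spare. -/
lemma integral_coord_mul_snd {ε : ℝ} (hε : 0 ≤ ε) (a : E) (j : ι)  :
    ∫ w, w j • fderiv ℝ (fderiv ℝ F) (O.pt ε w) (O.tangent w j) a =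
      -∫ w, fderiv ℝ F (O.pt ε w) a := by
  classical
  have hi : Integrable fun w : ι → ℝ => w j • fderiv ℝ F (O.pt ε w) a := by
    obtain ⟨C, hC0, hC⟩ := O.exists_bound_zero zero_le_one O.homog_fderiv
      O.continuousOn_fderiv ε
    refine Integrable.mono' (O.integrable_weight.const_mul (C * ‖a‖)) ?_
      (Eventually.of_forall fun w => ?_)
    · exact ((continuous_apply j).smul ((O.continuous_comp_pt O.continuousOn_fderiv
        hε).clm_apply continuous_const)).aestronglyMeasurable
    · have h1 := hC ε w hε le_rfl
      have h2 : |w j| ≤ orbitWeight O.e ε w ^ (1 / 2 : ℝ) := by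
        rw [← Real.sqrt_eq_rpow]; exact Real.abs_le_sqrt (sq_le_orbitWeight ε w j)
      have h3 := ContinuousLinearMap.le_opNorm (fderiv ℝ F (O.pt ε w)) a
      rw [norm_smul, Real.norm_eq_abs]
      calc _ ≤ orbitWeight O.e ε w ^ (1 / 2 : ℝ) * (‖fderiv ℝ F (O.pt ε w)‖ * ‖a‖) := by
            gcongr; exact Real.rpow_nonneg (orbitWeight_pos _ _).le _
        _ = ‖fderiv ℝ F (O.pt ε w)‖ * orbitWeight O.e ε w ^ (1 / 2 : ℝ) * ‖a‖ := by ring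
        _ ≤ C * orbitWeight O.e 0 w ^ (-(O.N / 2)) * ‖a‖ := by gcongr
        _ = _ := by ring
  have h := integral_bilinear_hasLineDerivAt_right_eq_neg_left_of_integrable
    (μ := (volume : Measure (ι → ℝ))) (f := fun w => w j) (f' := fun _ => 1)
    (g := fun w => fderiv ℝ F (O.pt ε w) a)
    (g' := fun w => fderiv ℝ (fderiv ℝ F) (O.pt ε w) (O.tangent w j) a)
    (v := Pi.single j 1) (B := ContinuousLinearMap.lsmul ℝ ℝ)
    (by simpa using O.integrable_fderiv hε a)
    (by simpa using O.integrable_coord_mul_snd hε a j) (by simpa using hi)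
    (fun x _ => by
      have := ((hasDerivAt_id (0 : ℝ)).const_add (x j))
      simpa [HasLineDerivAt] using this)
    (fun x _ => O.hasLineDerivAt_fderiv hε a x j)
  simpa using h

/-- The differential equation in the parameter `ε`. -/
lemma integral_fderiv_add_integral_snd {ε : ℝ} (hε : 0 ≤ ε) :
    ((lam + 1 : ℝ) : ℂ) * (∫ w, fderiv ℝ F (O.pt ε w) O.z) +
      (ε / 2 : ℝ) * ∫ w, fderiv ℝ (fderiv ℝ F) (O.pt ε w) O.z O.z = 0 := by
  have hi2 : Integrable fun w => fderiv ℝ (fderiv ℝ F) (O.pt ε w) O.z O.z :=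
    ((O.integrable_comp_pt zero_le_two O.homog_fderiv_fderiv O.continuousOn_fderiv_fderiv
      hε).apply_continuousLinearMap O.z).apply_continuousLinearMap O.z
  have hi3 : ∀ j ∈ Finset.univ, Integrable fun w =>
      -(1 / 2) * fderiv ℝ (fderiv ℝ F) (O.pt ε w) (O.tangent w j) (O.ξ' j) -
      ((1 - O.e j ^ 2 / 2 : ℝ) : ℂ) *
        (w j • fderiv ℝ (fderiv ℝ F) (O.pt ε w) (O.tangent w j) O.z) := fun j _ =>
    ((O.integrable_snd hε _ j).const_mul _).sub ((O.integrable_coord_mul_snd hε _ j).const_mul _)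
  have h1 := congrArg (fun f : (ι → ℝ) → ℂ => ∫ w, f w)
    (funext fun w => O.pointwise_identity hε w)
  rw [integral_add ((O.integrable_fderiv hε O.z).const_mul _) (hi2.const_mul _),
    integral_const_mul, integral_const_mul, integral_finsetSum _ hi3]
    at h1
  have h2 : ∀ j, ∫ w, (-(1 / 2) * fderiv ℝ (fderiv ℝ F) (O.pt ε w) (O.tangent w j) (O.ξ' j) -
      ((1 - O.e j ^ 2 / 2 : ℝ) : ℂ) *
        (w j • fderiv ℝ (fderiv ℝ F) (O.pt ε w) (O.tangent w j) O.z)) =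
      ((1 - O.e j ^ 2 / 2 : ℝ) : ℂ) * ∫ w, fderiv ℝ F (O.pt ε w) O.z := by
    intro j
    rw [integral_sub ((O.integrable_snd hε _ j).const_mul _)
      ((O.integrable_coord_mul_snd hε _ j).const_mul _), integral_const_mul, integral_const_mul,
      O.integral_snd hε, O.integral_coord_mul_snd hε]
    ring
  rw [Finset.sum_congr rfl fun j _ => h2 j, ← Finset.sum_mul, ← Complex.ofReal_sum] at h1
  -- The integrations by parts contributed `Σ (1 - e_j²/2) = N - λ`, so the coefficient `N + 1`
  -- drops to `λ + 1`.
  rw [O.N_eq] at h1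
  push_cast at h1 ⊢
  linear_combination h1

/-- With `b(ε)` the integral, the derivative `b'` is half the integral of the second derivative in
the direction `z`, so the preceding identity reads `(λ + 1) b + ε b' = 0` and `ε^{λ+1} b` is
constant. The weight with parameter `0` bounds `b` on `(0, 1]`; letting the parameter tend to `0`
shows that the constant is zero. -/
lemma integral_fderiv_eq_zero {ε : ℝ} (hε : 0 < ε) :
    ∫ w, fderiv ℝ F (O.pt ε w) O.z = 0 := by
  set b : ℝ → ℂ := fun ε => ∫ w, fderiv ℝ F (O.pt ε w) O.z with hb
  have hlam := O.lam_pos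
  have hderiv : ∀ x : ℝ, 0 < x → HasDerivAt b
      (∫ w, fderiv ℝ (fderiv ℝ F) (O.pt x w) ((1 / 2 : ℝ) • O.z) O.z) x := by
    intro x hx
    have h1 := O.hasDerivAt_integral zero_le_one O.homog_fderiv
      (fun y hy => O.contDiffAt_fderiv hy) hx
    have h2 := h1.clm_apply (hasDerivAt_const x O.z)
    have h3 : ∀ y, 0 < y → (∫ w, fderiv ℝ F (O.pt y w)) O.z = b y := fun y hy =>
      ContinuousLinearMap.integral_apply
        (O.integrable_comp_pt zero_le_one O.homog_fderiv O.continuousOn_fderiv hy.le) O.z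
    have hi2 : Integrable fun w => fderiv ℝ (fderiv ℝ F) (O.pt x w) ((1 / 2 : ℝ) • O.z) :=
      (O.integrable_comp_pt zero_le_two O.homog_fderiv_fderiv O.continuousOn_fderiv_fderiv
      hx.le).apply_continuousLinearMap _
    rw [map_zero, add_zero, ContinuousLinearMap.integral_apply hi2] at h2
    refine h2.congr_of_eventuallyEq ?_
    filter_upwards [lt_mem_nhds hx] with y hy using (h3 y hy).symm
  have hd : ∀ x : ℝ, 0 < x → HasDerivAt (fun x : ℝ => x ^ (lam + 1) • b x) 0 x := by
    intro x hx
    refine ((Real.hasDerivAt_rpow_const (Or.inl hx.ne')).smul (hderiv x hx)).congr_deriv ?_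
    have h1 := O.integral_fderiv_add_integral_snd hx.le
    have h2 : ∫ w, fderiv ℝ (fderiv ℝ F) (O.pt x w) ((1 / 2 : ℝ) • O.z) O.z =
        (1 / 2 : ℂ) * ∫ w, fderiv ℝ (fderiv ℝ F) (O.pt x w) O.z O.z := by
      rw [← integral_const_mul]; congr 1; ext w; simp
    rw [h2, add_sub_cancel_right, Complex.real_smul, Complex.real_smul,
      Real.rpow_add_one hx.ne']
    push_cast at h1 ⊢
    linear_combination ((x ^ lam : ℝ) : ℂ) * h1
  have hconst : ∀ x : ℝ, 0 < x → x ^ (lam + 1) • b x = ε ^ (lam + 1) • b ε := fun x hx =>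
    isOpen_Ioi.is_const_of_deriv_eq_zero (s := Ioi (0 : ℝ)) (f := fun x : ℝ => x ^ (lam + 1) • b x)
      isPreconnected_Ioi
      (fun y hy => (hd y hy).differentiableAt.differentiableWithinAt) (fun y hy => (hd y hy).deriv)
      hx hε
  obtain ⟨C, hC0, hC⟩ := O.exists_bound_zero' zero_le_one O.homog_fderiv O.continuousOn_fderiv 1
  set K := ∫ w, C * orbitWeight O.e 0 w ^ (-(O.N / 2)) * ‖O.z‖
  have hbound : ∀ x : ℝ, 0 < x → x ≤ 1 → ‖b x‖ ≤ K := fun x hx hx1 => by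
    refine norm_integral_le_of_norm_le ((O.integrable_weight.const_mul C).mul_const _)
      (Eventually.of_forall fun w => ?_)
    refine (ContinuousLinearMap.le_opNorm _ _).trans ?_
    gcongr
    exact hC x w hx.le hx1
  have hlim : Tendsto (fun x : ℝ => x ^ (lam + 1) * K) (𝓝[>] 0) (𝓝 0) := by
    have h1 : Tendsto (fun x : ℝ => x ^ (lam + 1)) (𝓝 0) (𝓝 (0 ^ (lam + 1))) :=
      (Real.continuousAt_rpow_const 0 (lam + 1) (Or.inr (by positivity))).tendsto
    rw [Real.zero_rpow (by positivity)] at h1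
    simpa using (h1.mono_left nhdsWithin_le_nhds).mul_const K
  have hle : ‖ε ^ (lam + 1) • b ε‖ ≤ 0 := by
    refine ge_of_tendsto hlim ?_
    filter_upwards [Ioc_mem_nhdsGT (zero_lt_one' ℝ)] with x hx
    rw [← hconst x hx.1, norm_smul, Real.norm_of_nonneg (Real.rpow_nonneg hx.1.le _)]
    have := Real.rpow_nonneg hx.1.le (lam + 1)
    gcongr
    exact hbound x hx.1 hx.2
  have h0 := norm_le_zero_iff.1 hle
  exact (smul_eq_zero.1 h0).resolve_left (Real.rpow_pos_of_pos hε _).ne'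

/-- The integral over the paraboloid does not depend on the parameter. -/
theorem integral_eq {ε ε' : ℝ} (hε : 0 < ε) (hε' : 0 < ε') :
    ∫ w, F (O.pt ε w) = ∫ w, F (O.pt ε' w) := by
  have hd : ∀ x : ℝ, 0 < x → HasDerivAt (fun x => ∫ w, F (O.pt x w)) 0 x := by
    intro x hx
    refine (O.hasDerivAt_integral le_rfl (by simpa using O.homog)
      (fun y hy => (O.smooth y hy).of_le (by norm_num)) hx).congr_deriv ?_
    have h2 : ∫ w, fderiv ℝ F (O.pt x w) ((1 / 2 : ℝ) • O.z) =
        (1 / 2 : ℂ) * ∫ w, fderiv ℝ F (O.pt x w) O.z := by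
      rw [← integral_const_mul]; congr 1; ext w; simp
    rw [h2, O.integral_fderiv_eq_zero hx, mul_zero]
  exact isOpen_Ioi.is_const_of_deriv_eq_zero (s := Ioi (0 : ℝ)) (f := fun x => ∫ w, F (O.pt x w))
    isPreconnected_Ioi
    (fun y hy => (hd y hy).differentiableAt.differentiableWithinAt) (fun y hy => (hd y hy).deriv)
    hε hε'

end ParaboloidFamily

end Hyperbolic

/-! ### A radial integral concentrated near `r = T`. -/

namespace Hyperbolic

open MeasureTheory Filter Topology Set

section Split

variable {ι : Type*} [Fintype ι] (P : ι → Prop) [DecidablePred P]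

/-- The splitting of the coordinates into those with `P` and those without, as vectors of two
Euclidean spaces. -/
noncomputable def splitEquiv :
    (ι → ℝ) ≃ᵐ EuclideanSpace ℝ {i // P i} × EuclideanSpace ℝ {i // ¬P i} :=
  (MeasurableEquiv.piEquivPiSubtypeProd (fun _ => ℝ) P).trans
    (MeasurableEquiv.prodCongr (MeasurableEquiv.toLp 2 _) (MeasurableEquiv.toLp 2 _))

lemma measurePreserving_splitEquiv : MeasurePreserving (splitEquiv P) := by
  refine MeasurePreserving.trans (volume_preserving_piEquivPiSubtypeProd (fun _ : ι => ℝ) P) ?_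
  exact (EuclideanSpace.volume_preserving_symm_measurableEquiv_toLp _).symm.prod
    (EuclideanSpace.volume_preserving_symm_measurableEquiv_toLp _).symm

lemma norm_splitEquiv_fst (w : ι → ℝ) : ‖(splitEquiv P w).1‖ ^ 2 = ∑ i : {i // P i}, w i ^ 2 := by
  rw [EuclideanSpace.norm_sq_eq]
  simp [splitEquiv, MeasurableEquiv.prodCongr, MeasurableEquiv.piEquivPiSubtypeProd]

lemma norm_splitEquiv_snd (w : ι → ℝ) : ‖(splitEquiv P w).2‖ ^ 2 = ∑ i : {i // ¬P i}, w i ^ 2 := by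
  rw [EuclideanSpace.norm_sq_eq]
  simp [splitEquiv, MeasurableEquiv.prodCongr, MeasurableEquiv.piEquivPiSubtypeProd]

end Split

/-- Both bounds follow from `(T² - r²)² = (r - T)² (r + T)²`, with `r + T` bounded below by `r` in
the first and by `|r - T|` in the second. -/
lemma quartic_ge {r T : ℝ} (hr : 0 ≤ r) (hT : 0 ≤ T) :
    (1 + r ^ 2) * (1 + (r - T) ^ 2) ≤ 3 * (1 + r ^ 2 + (T ^ 2 - r ^ 2) ^ 2) ∧
    (1 + (r - T) ^ 2) ^ 2 ≤ 2 * (1 + r ^ 2 + (T ^ 2 - r ^ 2) ^ 2) := by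
  have h0 : (T ^ 2 - r ^ 2) ^ 2 = (r - T) ^ 2 * (r + T) ^ 2 := by ring
  have h1 : (r - T) ^ 2 * r ^ 2 ≤ (T ^ 2 - r ^ 2) ^ 2 := by
    rw [h0]; gcongr; linarith
  have h2 : (r - T) ^ 2 * (r - T) ^ 2 ≤ (T ^ 2 - r ^ 2) ^ 2 := by
    rw [h0]; gcongr ?_ * ?_; nlinarith [mul_nonneg hr hT]
  constructor
  · nlinarith [sq_nonneg ((r - T) ^ 2 - 1), sq_nonneg r]
  · nlinarith [sq_nonneg ((r - T) ^ 2 - 1), sq_nonneg r]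

/-- The part `k - 1 + η` of the exponent is spent on the first bound of `quartic_ge`, where it
cancels `r^{k-1}` and leaves decay of order `η` in `r`; the rest is spent on the second, for the
best decay in `r - T`. -/
lemma radial_integrand_le {k : ℕ} (hk : 1 ≤ k) {β η : ℝ} (hη : 0 < η)
    (h2 : (k : ℝ) - 1 + η ≤ β) {r T : ℝ} (hr : 0 < r) (hT : 0 ≤ T) :
    r ^ (k - 1) * (1 + r ^ 2 + (T ^ 2 - r ^ 2) ^ 2) ^ (-(β / 2)) ≤
      (3 ^ (((k : ℝ) - 1 + η) / 2) * 2 ^ ((β - ((k : ℝ) - 1 + η)) / 2)) *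
        ((1 + r ^ 2) ^ (-(η / 2)) *
          (1 + (r - T) ^ 2) ^ (-(2 * β - ((k : ℝ) - 1 + η)) / 2)) := by
  set x := (k : ℝ) - 1 + η with hx
  set y := β - x with hy
  have hk1 : (1 : ℝ) ≤ k := by exact_mod_cast hk
  have hx0 : 0 ≤ x := by rw [hx]; linarith
  have hy0 : 0 ≤ y := by rw [hy]; linarith
  set Q := 1 + r ^ 2 + (T ^ 2 - r ^ 2) ^ 2 with hQ
  have hQ0 : 0 < Q := by positivity
  obtain ⟨q1, q2⟩ := quartic_ge hr.le hT
  have e1 : Q ^ (-(β / 2)) = Q ^ (-(x / 2)) * Q ^ (-(y / 2)) := by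
    rw [← Real.rpow_add hQ0]; congr 1; rw [hy]; ring
  have e2 := rpow_neg_le_of_le (b := Q) (r := x / 2) (by positivity) three_pos (by positivity) q1
  have e3 := rpow_neg_le_of_le (b := Q) (r := y / 2) (by positivity) two_pos (by positivity) q2
  have e4 : r ^ (k - 1) ≤ (1 + r ^ 2) ^ (((k : ℝ) - 1) / 2) := by
    rw [← Real.rpow_natCast, Nat.cast_sub hk, Nat.cast_one]
    have : r ≤ (1 + r ^ 2) ^ (1 / 2 : ℝ) := by
      rw [← Real.sqrt_eq_rpow]; exact Real.le_sqrt_of_sq_le (by linarith)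
    calc r ^ ((k : ℝ) - 1) ≤ ((1 + r ^ 2) ^ (1 / 2 : ℝ)) ^ ((k : ℝ) - 1) :=
          Real.rpow_le_rpow hr.le this (by linarith)
      _ = _ := by rw [← Real.rpow_mul (by positivity)]; congr 1; ring
  have e5 : ((1 + r ^ 2) * (1 + (r - T) ^ 2)) ^ (-(x / 2)) =
      (1 + r ^ 2) ^ (-(x / 2)) * (1 + (r - T) ^ 2) ^ (-(x / 2)) :=
    Real.mul_rpow (by positivity) (by positivity)
  have e6 : ((1 + (r - T) ^ 2) ^ 2) ^ (-(y / 2)) = (1 + (r - T) ^ 2) ^ (-y) := by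
    rw [← Real.rpow_natCast, ← Real.rpow_mul (by positivity)]; congr 1; push_cast; ring
  have e7 : (1 + r ^ 2) ^ (-(η / 2)) =
      (1 + r ^ 2) ^ (((k : ℝ) - 1) / 2) * (1 + r ^ 2) ^ (-(x / 2)) := by
    rw [← Real.rpow_add (by positivity)]; congr 1; rw [hx]; ring
  have e8 : (1 + (r - T) ^ 2) ^ (-(2 * β - x) / 2) =
      (1 + (r - T) ^ 2) ^ (-(x / 2)) * (1 + (r - T) ^ 2) ^ (-y) := by
    rw [← Real.rpow_add (by positivity)]; congr 1; rw [hy]; ring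
  rw [e5] at e2
  rw [e6] at e3
  rw [e1, e7, e8]
  calc _ ≤ (1 + r ^ 2) ^ (((k : ℝ) - 1) / 2) *
        ((3 ^ (x / 2) * ((1 + r ^ 2) ^ (-(x / 2)) * (1 + (r - T) ^ 2) ^ (-(x / 2)))) *
        (2 ^ (y / 2) * (1 + (r - T) ^ 2) ^ (-y))) := by gcongr
    _ = _ := by ring

lemma integrable_one_add_sq_rpow {s : ℝ} (hs : 1 < s) :
    Integrable (fun x : ℝ => (1 + x ^ 2) ^ (-s / 2)) := by
  have := integrable_rpow_neg_one_add_norm_sq (E := ℝ) (μ := volume) (r := s) (by simpa using hs)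
  simpa using this

/-- The radial integral of the orbit weight tends to zero. -/
lemma tendsto_radial_integral {k : ℕ} (hk : 1 ≤ k) {β : ℝ} (h1 : (k : ℝ) < 2 * β)
    (h2 : (k : ℝ) - 1 < β) :
    Tendsto (fun T : ℝ => ∫ r in Ioi (0 : ℝ), r ^ (k - 1) •
      (1 + r ^ 2 + (T ^ 2 - r ^ 2) ^ 2) ^ (-(β / 2))) atTop (𝓝 0) := by
  -- The bound `η < 2β - k` makes the decay in `r - T` integrable, as it gives `s > 1`; `η < β - k +
  -- 1` keeps the two parts of the exponent nonnegative.
  obtain ⟨η, hη, hη1, hη2⟩ : ∃ η : ℝ, 0 < η ∧ η < 2 * β - k ∧ η < β - k + 1 := by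
    refine ⟨min (2 * β - k) (β - k + 1) / 2, ?_, ?_, ?_⟩
    · have : 0 < min (2 * β - k) (β - k + 1) := lt_min (by linarith) (by linarith)
      positivity
    · have := min_le_left (2 * β - k) (β - k + 1); linarith
    · have := min_le_right (2 * β - k) (β - k + 1)
      have : 0 < min (2 * β - k) (β - k + 1) := lt_min (by linarith) (by linarith)
      linarith
  set C : ℝ := 3 ^ (((k : ℝ) - 1 + η) / 2) * 2 ^ ((β - ((k : ℝ) - 1 + η)) / 2)
  have hC : 0 ≤ C := by positivity
  set s := 2 * β - ((k : ℝ) - 1 + η) with hs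
  set g : ℝ → ℝ → ℝ := fun T => (Ioi (0 : ℝ)).indicator fun r => r ^ (k - 1) •
    (1 + r ^ 2 + (T ^ 2 - r ^ 2) ^ 2) ^ (-(β / 2)) with hg
  have hcont : ∀ T : ℝ, Continuous fun r : ℝ => r ^ (k - 1) •
      (1 + r ^ 2 + (T ^ 2 - r ^ 2) ^ 2) ^ (-(β / 2)) := fun T =>
    (continuous_pow _).smul (Continuous.rpow_const (by fun_prop) fun r => Or.inl (by positivity))
  -- In the shifted variable `t = r - T` the majorant is integrable uniformly in `T`, and its first
  -- factor tends to `0` pointwise.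
  have key : ∀ T t : ℝ, 0 ≤ T → ‖g T (t + T)‖ ≤
      C * ((1 + (t + T) ^ 2) ^ (-(η / 2)) * (1 + t ^ 2) ^ (-s / 2)) := by
    intro T t hT
    by_cases h : t + T ∈ Ioi (0 : ℝ)
    · have h' : 0 < t + T := h
      simp only [hg, indicator_of_mem h, smul_eq_mul]
      rw [Real.norm_of_nonneg (by positivity)]
      have := radial_integrand_le hk hη (by linarith) h' hT (β := β)
      rwa [add_sub_cancel_right] at this
    · simp only [hg, indicator_of_notMem h, norm_zero]; positivity
  have hrew : ∀ T : ℝ, ∫ r in Ioi (0 : ℝ), r ^ (k - 1) •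
      (1 + r ^ 2 + (T ^ 2 - r ^ 2) ^ 2) ^ (-(β / 2)) = ∫ t, g T (t + T) := fun T => by
    rw [integral_add_right_eq_self (g T) T, integral_indicator measurableSet_Ioi]
  simp_rw [hrew]
  have hlim : ∀ t : ℝ, Tendsto (fun T : ℝ =>
      C * ((1 + (t + T) ^ 2) ^ (-(η / 2)) * (1 + t ^ 2) ^ (-s / 2))) atTop (𝓝 0) := by
    intro t
    have a1 : Tendsto (fun T : ℝ => 1 + (t + T) ^ 2) atTop atTop :=
      tendsto_atTop_add_const_left _ _ ((tendsto_pow_atTop two_ne_zero).comp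
        (tendsto_atTop_add_const_left _ _ tendsto_id))
    have a2 := (tendsto_rpow_neg_atTop (half_pos hη)).comp a1
    have a3 := (a2.mul_const ((1 + t ^ 2) ^ (-s / 2))).const_mul C
    simpa using a3
  have hint : Integrable fun t : ℝ => C * (1 + t ^ 2) ^ (-s / 2) :=
    (integrable_one_add_sq_rpow (by rw [hs]; linarith)).const_mul C
  have := tendsto_integral_filter_of_dominated_convergence (l := (atTop : Filter ℝ))
    (μ := volume) (F := fun T t => g T (t + T)) (f := fun _ => (0 : ℝ))
    (fun t : ℝ => C * (1 + t ^ 2) ^ (-s / 2)) ?_ ?_ hint ?_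
  · simpa using this
  · refine Eventually.of_forall fun T => ?_
    have : Measurable (g T) := (hcont T).measurable.indicator measurableSet_Ioi
    exact (this.comp (measurable_add_const T)).aestronglyMeasurable
  · filter_upwards [eventually_ge_atTop 0] with T hT
    refine Eventually.of_forall fun t => (key T t hT).trans ?_
    gcongr
    refine mul_le_of_le_one_left (by positivity) (Real.rpow_le_one_of_one_le_of_nonpos ?_ ?_)
    · nlinarith [sq_nonneg (t + T)]
    · linarith
  · refine Eventually.of_forall fun t => ?_
    refine squeeze_zero_norm' ?_ (hlim t)
    filter_upwards [eventually_ge_atTop 0] with T hT using key T t hT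

end Hyperbolic

/-! ### Decay for large parameter, and vanishing of the integral over the paraboloids. -/

namespace Hyperbolic

open MeasureTheory Filter Topology Set

section Decay

variable {ι : Type*} [Fintype ι] {e : ι → ℝ}

lemma sum_sq_eq_card (he : ∀ j, e j ^ 3 = e j) [DecidablePred fun j => e j = 0] :
    ∑ j, e j ^ 2 = Fintype.card {j // ¬e j = 0} := by
  rw [← Fintype.sum_subtype_add_sum_subtype (fun j => e j = 0),
    Finset.sum_eq_zero fun j _ => by rw [j.2]; norm_num, zero_add,
    Finset.sum_congr rfl fun j _ => (eq_zero_or_sq_eq_one he j.1).resolve_left j.2]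
  simp

lemma sum_one_sub_eq_card (he : ∀ j, e j ^ 3 = e j) [DecidablePred fun j => e j = 0] :
    ∑ j, (1 - e j ^ 2 / 2) =
      (Fintype.card {j // e j = 0} : ℝ) + (Fintype.card {j // ¬e j = 0} : ℝ) / 2 := by
  rw [Finset.sum_sub_distrib, ← Finset.sum_div, sum_sq_eq_card he]
  have h : ((Fintype.card ι : ℕ) : ℝ) =
      (Fintype.card {j // e j = 0} : ℝ) + (Fintype.card {j // ¬e j = 0} : ℝ) := by
    rw [← Nat.cast_add, Fintype.card_subtype_compl,
      Nat.add_sub_cancel' (Fintype.card_subtype_le _)]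
  simp only [Finset.sum_const, Finset.card_univ, nsmul_eq_mul, mul_one, h]
  ring

lemma orbitWeight_eq_split (he : ∀ j, e j ^ 3 = e j) (hs : ∀ j, e j ≤ 0)
    [DecidablePred fun j => e j = 0] (ε : ℝ) (w : ι → ℝ) :
    orbitWeight e ε w = 1 + ‖(splitEquiv (fun j => e j = 0) w).1‖ ^ 2 +
      ‖(splitEquiv (fun j => e j = 0) w).2‖ ^ 2 +
      (ε - ‖(splitEquiv (fun j => e j = 0) w).2‖ ^ 2) ^ 2 := by
  rw [norm_splitEquiv_fst, norm_splitEquiv_snd, orbitWeight,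
    ← Fintype.sum_subtype_add_sum_subtype (fun j => e j = 0) fun j => w j ^ 2,
    ← Fintype.sum_subtype_add_sum_subtype (fun j => e j = 0) fun j => e j * w j ^ 2,
    Finset.sum_eq_zero (s := (Finset.univ : Finset {j // e j = 0})) (f := fun j => e j * w j ^ 2)
      fun j _ => by rw [j.2]; ring, zero_add]
  have h : ∀ j : {j // ¬e j = 0}, e j * w j ^ 2 = -w j ^ 2 := fun j => by
    have h1 := (eq_zero_or_sq_eq_one he j.1).resolve_left j.2
    have h2 : e j = -1 := by nlinarith [hs j.1]
    rw [h2]; ring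
  rw [Finset.sum_congr rfl fun j _ => h j, Finset.sum_neg_distrib]
  ring

/-- For fixed `ε` the base dominates a multiple of `(1 + ‖y‖²)²`, which doubles the available decay.
-/
lemma integrable_quartic_rpow {V : Type*} [NormedAddCommGroup V] [NormedSpace ℝ V]
    [FiniteDimensional ℝ V] [MeasurableSpace V] [BorelSpace V] {μ : Measure V}
    [μ.IsAddHaarMeasure] {β : ℝ} (h : (Module.finrank ℝ V : ℝ) < 2 * β) (ε : ℝ) :
    Integrable (fun y : V => (1 + ‖y‖ ^ 2 + (ε - ‖y‖ ^ 2) ^ 2) ^ (-(β / 2))) μ := by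
  have hβ : 0 ≤ β := by
    have : (0 : ℝ) ≤ Module.finrank ℝ V := by positivity
    linarith
  refine Integrable.mono' ((integrable_rpow_neg_one_add_norm_sq (μ := μ) h).const_mul
    ((4 + 4 * ε ^ 2) ^ (β / 2))) ?_ (Eventually.of_forall fun y => ?_)
  · exact (Continuous.rpow_const (by fun_prop)
      fun y => Or.inl (by positivity)).aestronglyMeasurable
  · rw [Real.norm_of_nonneg (by positivity)]
    have h1 : (1 + ‖y‖ ^ 2) ^ 2 ≤ (4 + 4 * ε ^ 2) * (1 + ‖y‖ ^ 2 + (ε - ‖y‖ ^ 2) ^ 2) := by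
      nlinarith [sq_nonneg (‖y‖ ^ 2 - 2 * ε), sq_nonneg (‖y‖ ^ 2 - 1), sq_nonneg ‖y‖,
        mul_nonneg (sq_nonneg ε) (sq_nonneg ‖y‖), mul_nonneg (sq_nonneg ε)
        (sq_nonneg (ε - ‖y‖ ^ 2))]
    have h2 := rpow_neg_le_of_le (r := β / 2) (by positivity) (by positivity) (by positivity) h1
    refine h2.trans_eq ?_
    rw [← Real.rpow_natCast (1 + ‖y‖ ^ 2), ← Real.rpow_mul (by positivity)]
    congr 2
    push_cast; ring

/-- For coefficients of negative sign the integral of the orbit weight tends to zero. -/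
lemma tendsto_integral_orbitWeight (he : ∀ j, e j ^ 3 = e j) (hs : ∀ j, e j ≤ 0)
    (hne : ∃ j, e j ≠ 0) {lam N : ℝ} (hlam : 0 < lam) (hN : N = lam + ∑ j, (1 - e j ^ 2 / 2))
    (hmu : 0 < lam + 1 - (∑ j, e j ^ 2) / 2) :
    Tendsto (fun T : ℝ => ∫ w, orbitWeight e (T ^ 2) w ^ (-(N / 2))) atTop (𝓝 0) := by
  classical
  set P : ι → Prop := fun j => e j = 0
  set k := Fintype.card {j // ¬P j} with hk
  set l := Fintype.card {j // P j} with hl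
  have hk1 : 1 ≤ k := by
    obtain ⟨j, hj⟩ := hne
    exact Fintype.card_pos_iff.2 ⟨⟨j, hj⟩⟩
  have : Nonempty {j // ¬P j} := Fintype.card_pos_iff.1 hk1
  rw [sum_sq_eq_card he] at hmu
  rw [sum_one_sub_eq_card he] at hN
  change 0 < lam + 1 - (k : ℝ) / 2 at hmu
  change N = lam + ((l : ℝ) + (k : ℝ) / 2) at hN
  -- The exponent is split as `N = α + β`. The part `α = l + δ` suffices for integrability in the
  -- `l` coordinates with `e_j = 0`. The radial integral in the other `k` coordinates requires `k <
  -- 2β` and `k - 1 < β`, which are the two upper bounds on `δ`.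
  obtain ⟨δ, hδ, hδ1, hδ2⟩ : ∃ δ : ℝ, 0 < δ ∧ δ < lam ∧ δ < lam + 1 - (k : ℝ) / 2 :=
    let ⟨δ, h1, h2⟩ := exists_between (lt_min hlam hmu)
    ⟨δ, h1, h2.trans_le (min_le_left _ _), h2.trans_le (min_le_right _ _)⟩
  set α := (l : ℝ) + δ with hα
  set β := lam + (k : ℝ) / 2 - δ with hβ
  have hα0 : 0 ≤ α := by positivity
  have hβk : (k : ℝ) < 2 * β := by rw [hβ]; linarith
  have hβ0 : 0 ≤ β := by
    have : (0 : ℝ) ≤ k := by positivity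
    linarith
  set I := ∫ x : EuclideanSpace ℝ {j // P j}, (1 + ‖x‖ ^ 2) ^ (-α / 2)
  have hI : Integrable fun x : EuclideanSpace ℝ {j // P j} => (1 + ‖x‖ ^ 2) ^ (-α / 2) :=
    integrable_rpow_neg_one_add_norm_sq (by rw [finrank_euclideanSpace, hα]; linarith)
  have hJ : ∀ T : ℝ, Integrable fun y : EuclideanSpace ℝ {j // ¬P j} =>
      (1 + ‖y‖ ^ 2 + (T ^ 2 - ‖y‖ ^ 2) ^ 2) ^ (-(β / 2)) := fun T =>
    integrable_quartic_rpow (by rw [finrank_euclideanSpace]; exact hβk) _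
  have hbound : ∀ T : ℝ, ∫ w, orbitWeight e (T ^ 2) w ^ (-(N / 2)) ≤
      I * ∫ y : EuclideanSpace ℝ {j // ¬P j},
        (1 + ‖y‖ ^ 2 + (T ^ 2 - ‖y‖ ^ 2) ^ 2) ^ (-(β / 2)) := fun T => by
    rw [← integral_prod_mul, ← Measure.volume_eq_prod,
      ← (measurePreserving_splitEquiv P).integral_comp' (g := fun z => (1 + ‖z.1‖ ^ 2) ^ (-α / 2) *
        (1 + ‖z.2‖ ^ 2 + (T ^ 2 - ‖z.2‖ ^ 2) ^ 2) ^ (-(β / 2)))]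
    refine integral_mono_of_nonneg (Eventually.of_forall fun w =>
      Real.rpow_nonneg (orbitWeight_pos _ _).le _) ?_ (Eventually.of_forall fun w => ?_)
    · have := hI.mul_prod (hJ T)
      rw [← Measure.volume_eq_prod] at this
      exact ((measurePreserving_splitEquiv P).integrable_comp_emb
        (splitEquiv P).measurableEmbedding).2 this
    · have hp := orbitWeight_pos (e := e) (T ^ 2) w
      have h1 : orbitWeight e (T ^ 2) w ^ (-(N / 2)) =
          orbitWeight e (T ^ 2) w ^ (-α / 2) * orbitWeight e (T ^ 2) w ^ (-(β / 2)) := by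
        rw [← Real.rpow_add hp, hN, hα, hβ]; congr 1; ring
      simp only
      rw [h1, orbitWeight_eq_split he hs]
      set a := ‖(splitEquiv (fun j => e j = 0) w).1‖ ^ 2
      set b := ‖(splitEquiv (fun j => e j = 0) w).2‖ ^ 2
      have ha : 0 ≤ a := by positivity
      have hb : 0 ≤ b := by positivity
      have hc := sq_nonneg (T ^ 2 - b)
      refine mul_le_mul ?_ ?_ (by positivity) (by positivity)
      · exact Real.rpow_le_rpow_of_nonpos (by positivity) (by linarith) (by linarith)
      · exact Real.rpow_le_rpow_of_nonpos (by positivity) (by linarith) (by linarith)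
  have hrad : ∀ T : ℝ, ∫ y : EuclideanSpace ℝ {j // ¬P j},
      (1 + ‖y‖ ^ 2 + (T ^ 2 - ‖y‖ ^ 2) ^ 2) ^ (-(β / 2)) =
      k • (volume : Measure (EuclideanSpace ℝ {j // ¬P j})).real (Metric.ball 0 1) •
        ∫ r in Ioi (0 : ℝ), r ^ (k - 1) • (1 + r ^ 2 + (T ^ 2 - r ^ 2) ^ 2) ^ (-(β / 2)) :=
    fun T => by
      rw [integral_fun_norm_addHaar volume
        (fun r : ℝ => (1 + r ^ 2 + (T ^ 2 - r ^ 2) ^ 2) ^ (-(β / 2))), finrank_euclideanSpace]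
  simp_rw [hrad] at hbound
  refine squeeze_zero (fun T => integral_nonneg fun w =>
    Real.rpow_nonneg (orbitWeight_pos _ _).le _) hbound ?_
  have := (((tendsto_radial_integral hk1 hβk (by rw [hβ]; linarith)).const_smul
    ((volume : Measure (EuclideanSpace ℝ {j // ¬P j})).real (Metric.ball 0 1))).const_smul
      k).const_mul I
  simpa using this

end Decay

namespace ParaboloidFamily

variable {ι E : Type*} [Fintype ι] [Nonempty ι] [NormedAddCommGroup E] [NormedSpace ℝ E]
  {F : E → ℂ} {lam : ℝ} (O : ParaboloidFamily ι E F lam)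

/-- Without negative coefficients the weight is at least the one with parameter `0` and tends to
infinity pointwise, so dominated convergence applies. -/
lemma tendsto_integral_of_nonneg (h : ∀ j, 0 ≤ O.e j) :
    Tendsto (fun T : ℝ => ∫ w, orbitWeight O.e (T ^ 2) w ^ (-(O.N / 2))) atTop (𝓝 0) := by
  have hN : 0 < O.N := by
    have := O.N_nonneg
    rw [O.N_eq]
    refine add_pos_of_pos_of_nonneg O.lam_pos (Finset.sum_nonneg fun j _ => ?_)
    rcases eq_zero_or_sq_eq_one O.cube j with h | h <;> rw [h] <;> norm_num
  have hd : ∀ w : ι → ℝ, 0 ≤ ∑ j, O.e j * w j ^ 2 := fun w =>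
    Finset.sum_nonneg fun j _ => mul_nonneg (h j) (sq_nonneg _)
  have := tendsto_integral_filter_of_dominated_convergence (l := (atTop : Filter ℝ))
    (μ := volume) (F := fun T w => orbitWeight O.e (T ^ 2) w ^ (-(O.N / 2)))
    (f := fun _ => (0 : ℝ)) (fun w => orbitWeight O.e 0 w ^ (-(O.N / 2))) ?_ ?_
    O.integrable_weight ?_
  · simpa using this
  · exact Eventually.of_forall fun T => ((continuous_orbitWeight _).rpow_const
      fun w => Or.inl (orbitWeight_pos _ w).ne').aestronglyMeasurable
  · refine Eventually.of_forall fun T => Eventually.of_forall fun w => ?_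
    rw [Real.norm_of_nonneg (Real.rpow_nonneg (orbitWeight_pos _ _).le _)]
    refine Real.rpow_le_rpow_of_nonpos (orbitWeight_pos _ _) ?_ (by linarith)
    unfold orbitWeight
    have := hd w
    gcongr
    positivity
  · refine Eventually.of_forall fun w => (tendsto_rpow_neg_atTop (half_pos hN)).comp ?_
    refine tendsto_atTop_mono (f := fun T : ℝ => T ^ 2) (fun T => ?_)
      (tendsto_pow_atTop two_ne_zero)
    unfold orbitWeight
    have h1 := hd w
    have h2 := Finset.sum_nonneg fun j (_ : j ∈ Finset.univ) => sq_nonneg (w j)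
    nlinarith [sq_nonneg T, sq_nonneg (T ^ 2 + ∑ j, O.e j * w j ^ 2 - 1)]

/-- The vanishing of the integral over the paraboloids. -/
theorem integral_eq_zero [FiniteDimensional ℝ E]
    (h : (∀ j, 0 ≤ O.e j) ∨ (∀ j, O.e j ≤ 0) ∧ 0 < lam + 1 - (∑ j, O.e j ^ 2) / 2)
    {ε : ℝ} (hε : 0 < ε) : ∫ w, F (O.pt ε w) = 0 := by
  have ht : Tendsto (fun T : ℝ => ∫ w, orbitWeight O.e (T ^ 2) w ^ (-(O.N / 2))) atTop (𝓝 0) := by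
    by_cases h0 : ∃ j, O.e j ≠ 0
    · rcases h with h | ⟨h, hmu⟩
      · exact O.tendsto_integral_of_nonneg h
      · exact tendsto_integral_orbitWeight O.cube h h0 O.lam_pos O.N_eq hmu
    · push Not at h0
      exact O.tendsto_integral_of_nonneg fun j => (h0 j).ge
  obtain ⟨C, hC0, hC⟩ := O.exists_bound_weight O.N_nonneg O.homog O.continuousOn_F
  have hle : ‖∫ w, F (O.pt ε w)‖ ≤ 0 := by
    have h1 := ht.const_mul C
    rw [mul_zero] at h1
    refine ge_of_tendsto h1 ?_
    filter_upwards [eventually_gt_atTop 0] with T hT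
    -- Independence of the parameter moves the integral to the distant paraboloid with parameter
    -- `T²`.
    rw [O.integral_eq hε (by positivity : 0 < T ^ 2), ← integral_const_mul]
    refine norm_integral_le_of_norm_le ?_ (Eventually.of_forall fun w => hC _ w (sq_nonneg T))
    refine Integrable.const_mul ?_ _
    refine Integrable.mono' (O.integrable_weight.const_mul
      ((2 + 2 * (T ^ 2) ^ 2) ^ (O.N / 2))) ?_ (Eventually.of_forall fun w => ?_)
    · exact ((continuous_orbitWeight _).rpow_const
        fun w => Or.inl (orbitWeight_pos _ w).ne').aestronglyMeasurable
    · rw [Real.norm_of_nonneg (Real.rpow_nonneg (orbitWeight_pos _ _).le _)]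
      exact O.orbitWeight_rpow_le (sq_nonneg T) le_rfl w
  exact norm_le_zero_iff.1 hle

end ParaboloidFamily

end Hyperbolic

/-! ### The orbits of `N^*` in coordinates. -/

namespace Hyperbolic

open MeasureTheory Filter Topology Set
open scoped Matrix

section Coordinates

lemma sum_ite_lt_eq_sum_castLE {M : Type*} [AddCommMonoid M] {n m : ℕ} (h : n ≤ m)
    (f : Fin m → M) :
    ∑ j : Fin m, (if (j : ℕ) < n then f j else 0) = ∑ i : Fin n, f (Fin.castLE h i) := by
  rw [← Finset.sum_filter]
  symm
  refine Finset.sum_bij (fun i _ => Fin.castLE h i) ?_ ?_ ?_ ?_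
  · intro i _; simp
  · intro i _ j _ hij; exact Fin.castLE_injective h hij
  · intro j hj
    exact ⟨⟨j, (Finset.mem_filter.1 hj).2⟩, Finset.mem_univ _, rfl⟩
  · intro i _; rfl

variable (p q : ℕ)

lemma sum_uPart {M : Type*} [AddCommMonoid M] (f : ℝ → M) (w : Fin (max (p - 1) q) → ℝ) :
    ∑ i, f (uPart p q w i) =
      ∑ j : Fin (max (p - 1) q), if (j : ℕ) < p - 1 then f (w j) else 0 :=
  (sum_ite_lt_eq_sum_castLE (le_max_left _ _) fun j => f (w j)).symm

lemma sum_vPart {M : Type*} [AddCommMonoid M] (f : ℝ → M) (w : Fin (max (p - 1) q) → ℝ) :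
    ∑ i, f (vPart p q w i) =
      ∑ j : Fin (max (p - 1) q), if (j : ℕ) < q then f (w j) else 0 := by
  rw [sum_ite_lt_eq_sum_castLE (le_max_right _ _) fun j => f (w j)]
  exact Equiv.sum_comp Fin.revPerm fun k => f (w (Fin.castLE (le_max_right _ _) k))

/-- The sign with which `w_j²` occurs in `|u|² - |v|²`. -/
def signCoef (j : Fin (max (p - 1) q)) : ℝ :=
  (if (j : ℕ) < p - 1 then 1 else 0) - if (j : ℕ) < q then 1 else 0

lemma sum_sq_uPart_sub (w : Fin (max (p - 1) q) → ℝ) :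
    ∑ i, uPart p q w i ^ 2 - ∑ k, vPart p q w k ^ 2 = ∑ j, signCoef p q j * w j ^ 2 := by
  rw [sum_uPart p q (· ^ 2), sum_vPart p q (· ^ 2), ← Finset.sum_sub_distrib]
  refine Finset.sum_congr rfl fun j _ => ?_
  unfold signCoef
  split_ifs <;> ring

lemma sum_sq_le (w : Fin (max (p - 1) q) → ℝ) :
    ∑ j, w j ^ 2 ≤ ∑ i, uPart p q w i ^ 2 + ∑ k, vPart p q w k ^ 2 := by
  rw [sum_uPart p q (· ^ 2), sum_vPart p q (· ^ 2), ← Finset.sum_add_distrib]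
  refine Finset.sum_le_sum fun j _ => ?_
  have h := j.2
  rw [lt_max_iff] at h
  have := sq_nonneg (w j)
  rcases h with h | h <;> simp only [h, if_true] <;> split_ifs <;> linarith

lemma signCoef_cube (j : Fin (max (p - 1) q)) : signCoef p q j ^ 3 = signCoef p q j := by
  unfold signCoef; split_ifs <;> norm_num

/-- Coordinates shared by `u` and `v` cancel, and only the longer of the two rows has others. -/
lemma signCoef_sign : (∀ j, 0 ≤ signCoef p q j) ∨ ∀ j, signCoef p q j ≤ 0 := by
  rcases le_total q (p - 1) with h | h
  · left; intro j; unfold signCoef; split_ifs <;> first | omega | norm_num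
  · right; intro j; unfold signCoef; split_ifs <;> first | omega | norm_num

lemma one_sub_signCoef_sq (j : Fin (max (p - 1) q)) : 1 - signCoef p q j ^ 2 / 2 =
    (if (j : ℕ) < p - 1 then 1 / 2 else 0) + if (j : ℕ) < q then 1 / 2 else 0 := by
  have h := j.2
  rw [lt_max_iff] at h
  unfold signCoef
  rcases h with h | h <;> simp only [h, if_true] <;> split_ifs <;> norm_num

/-- A coordinate counts `1` if it occurs in both rows and `1/2` if it occurs in one. This matches
the degree `-(λ + ρ)` of the generating functions to the condition `N_eq` on a `ParaboloidFamily`.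
-/
lemma sum_one_sub_signCoef_sq (hp : 1 ≤ p) :
    ∑ j, (1 - signCoef p q j ^ 2 / 2) = rho p q := by
  rw [Finset.sum_congr rfl fun j _ => one_sub_signCoef_sq p q j, Finset.sum_add_distrib,
    sum_ite_lt_eq_sum_castLE (le_max_left _ _) fun _ => (1 / 2 : ℝ),
    sum_ite_lt_eq_sum_castLE (le_max_right _ _) fun _ => (1 / 2 : ℝ)]
  simp only [Finset.sum_const, Finset.card_univ, Fintype.card_fin, nsmul_eq_mul, Nat.cast_sub hp,
    Nat.cast_one, rho]
  ring

lemma sum_signCoef_sq (hp : 1 ≤ p) :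
    (∑ j, signCoef p q j ^ 2) / 2 = ((max (p - 1) q : ℕ) : ℝ) - rho p q := by
  rw [← sum_one_sub_signCoef_sq p q hp, Finset.sum_sub_distrib, ← Finset.sum_div]
  simp

/-- The point of the orbit of `N^*` with coordinates `w`, for the value `-ε` of the form. -/
noncomputable def orbitPoint (ε : ℝ) (w : Fin (max (p - 1) q) → ℝ) : Idx p q → ℝ :=
  Sum.elim (Sum.elim (fun _ => (ε + ∑ j, signCoef p q j * w j ^ 2 - 1) / 2) (uPart p q w))
    (Sum.elim (-vPart p q w) fun _ => (ε + ∑ j, signCoef p q j * w j ^ 2 + 1) / 2)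

lemma nilElt_mulVec (u : Fin (p - 1) → ℝ) (v : Fin q → ℝ) (a b : ℝ) (x : Fin (p - 1) → ℝ)
    (y : Fin q → ℝ) :
    nilElt p q u v *ᵥ (Sum.elim (Sum.elim (fun _ => a) x) (Sum.elim y fun _ => b)) =
      Sum.elim (Sum.elim (fun _ => u ⬝ᵥ x + v ⬝ᵥ y) ((b - a) • u))
        (Sum.elim (-((b - a) • v)) fun _ => u ⬝ᵥ x + v ⬝ᵥ y) := by
  ext ((i | i) | (i | i)) <;>
    simp [nilElt, Matrix.mulVec, dotProduct, Fintype.sum_sum_type, Matrix.fromBlocks] <;> ring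

/-- This makes the exponential series stop at the quadratic term, so that the orbit is a paraboloid.
-/
lemma nilElt_pow_three (u : Fin (p - 1) → ℝ) (v : Fin q → ℝ) : nilElt p q u v ^ 3 = 0 := by
  refine Matrix.ext_of_mulVec_single fun i => ?_
  have h : ∀ x : Idx p q → ℝ, nilElt p q u v ^ 3 *ᵥ x = 0 := by
    intro x
    have hx : x = Sum.elim (Sum.elim (fun _ => x (Sum.inl (Sum.inl ())))
        fun i => x (Sum.inl (Sum.inr i))) (Sum.elim (fun i => x (Sum.inr (Sum.inl i)))
        fun _ => x (Sum.inr (Sum.inr ()))) := by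
      ext ((i | i) | (i | i)) <;> rfl
    rw [hx, pow_succ, pow_two, ← Matrix.mulVec_mulVec, ← Matrix.mulVec_mulVec, nilElt_mulVec,
      nilElt_mulVec, nilElt_mulVec]
    ext ((i | i) | (i | i)) <;> simp
  rw [h, Matrix.zero_mulVec]

lemma unip_eq (u : Fin (p - 1) → ℝ) (v : Fin q → ℝ) :
    unip p q u v = 1 + nilElt p q u v + (1 / 2 : ℝ) • nilElt p q u v ^ 2 := by
  rw [unip, NormedSpace.exp_eq_tsum ℝ]
  simp only
  rw [tsum_eq_sum (s := Finset.range 3)]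
  · simp [Finset.sum_range_succ]
  · intro n hn
    have hn' : 3 ≤ n := by simpa using hn
    rw [← Nat.add_sub_cancel' hn', pow_add, nilElt_pow_three, zero_mul, smul_zero]

lemma nStar_mulVec_basePoint (w : Fin (max (p - 1) q) → ℝ) :
    nStar p q w *ᵥ basePoint p q = orbitPoint p q 1 w := by
  have hx : basePoint p q = Sum.elim (Sum.elim (fun _ => 0) 0) (Sum.elim 0 fun _ => 1) := by
    ext ((i | i) | (i | i)) <;> simp [basePoint]
  rw [nStar, unip_eq, Matrix.add_mulVec, Matrix.add_mulVec, Matrix.one_mulVec,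
    Matrix.smul_mulVec, pow_two, ← Matrix.mulVec_mulVec, hx, nilElt_mulVec, nilElt_mulVec,
    orbitPoint, ← sum_sq_uPart_sub]
  ext ((i | i) | (i | i)) <;> simp [dotProduct, ← pow_two] <;> ring

lemma mul_nStar_mulVec_basePoint (g : Mat p q) (w : Fin (max (p - 1) q) → ℝ) :
    (g * nStar p q w) *ᵥ basePoint p q = g *ᵥ orbitPoint p q 1 w := by
  rw [← Matrix.mulVec_mulVec, nStar_mulVec_basePoint]

/-- The signs of the form. -/
def formSign : Idx p q → ℝ := Sum.elim (fun _ => 1) fun _ => -1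

lemma form_eq : form p q = Matrix.diagonal (formSign p q) := rfl

lemma form_mul_form : form p q * form p q = 1 := by
  rw [form_eq, Matrix.diagonal_mul_diagonal, ← Matrix.diagonal_one]
  congr 1
  ext (i | i) <;> simp [formSign]

variable {p q} in
lemma inverse_of_preserves_form {g : Mat p q} (hg : gᵀ * form p q * g = form p q) :
    (form p q * gᵀ * form p q) * g = 1 := by
  rw [mul_assoc (form p q), mul_assoc (form p q), hg, form_mul_form]

variable {p q} in
lemma mul_form_mul_transpose {g : Mat p q} (hg : gᵀ * form p q * g = form p q) :
    g * form p q * gᵀ = form p q := by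
  have h := mul_eq_one_comm.1 (inverse_of_preserves_form hg)
  have h2 := congrArg (· * form p q) h
  simp only [one_mul, mul_assoc, form_mul_form, mul_one] at h2
  rw [mul_assoc, h2]

lemma sum_formSign_mul_sq (x : Idx p q → ℝ) :
    ∑ b, formSign p q b * x b ^ 2 = x ⬝ᵥ form p q *ᵥ x := by
  rw [form_eq]
  refine Finset.sum_congr rfl fun b _ => ?_
  rw [Matrix.mulVec_diagonal]
  ring

variable {p q} in
lemma sum_formSign_mulVec {g : Mat p q} (hg : gᵀ * form p q * g = form p q) (x : Idx p q → ℝ) :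
    ∑ b, formSign p q b * (g *ᵥ x) b ^ 2 = ∑ b, formSign p q b * x b ^ 2 := by
  rw [sum_formSign_mul_sq, sum_formSign_mul_sq, Matrix.mulVec_mulVec, ← Matrix.vecMul_transpose,
    ← Matrix.dotProduct_mulVec, Matrix.mulVec_mulVec, ← mul_assoc, hg]

lemma sum_formSign_orbitPoint (ε : ℝ) (w : Fin (max (p - 1) q) → ℝ) :
    ∑ b, formSign p q b * orbitPoint p q ε w b ^ 2 = -ε := by
  have h := sum_sq_uPart_sub p q w
  simp only [Fintype.sum_sum_type, formSign, orbitPoint, Sum.elim_inl, Sum.elim_inr, one_mul,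
    neg_one_mul, Finset.univ_unique, Finset.sum_singleton, Finset.sum_neg_distrib, Pi.neg_apply,
    neg_sq]
  linear_combination h

lemma sum_sq_orbitPoint (ε : ℝ) (w : Fin (max (p - 1) q) → ℝ) :
    orbitWeight (signCoef p q) ε w ≤ 2 * ∑ b, orbitPoint p q ε w b ^ 2 := by
  have h := sum_sq_le p q w
  have h1 : 0 ≤ ∑ j, w j ^ 2 := Finset.sum_nonneg fun j _ => sq_nonneg _
  simp only [Fintype.sum_sum_type, orbitPoint, Sum.elim_inl, Sum.elim_inr,
    Finset.univ_unique, Finset.sum_singleton, Pi.neg_apply, neg_sq, orbitWeight]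
  nlinarith

lemma sum_sq_mulVec_le {n : Type*} [Fintype n] (A : Matrix n n ℝ) (x : n → ℝ) :
    ∑ b, (A *ᵥ x) b ^ 2 ≤ (∑ b, ∑ c, A b c ^ 2) * ∑ c, x c ^ 2 := by
  rw [Finset.sum_mul]
  exact Finset.sum_le_sum fun b _ => Finset.sum_mul_sq_le_sq_mul_sq _ _ _

/-- The last `q + 1` coordinates. -/
noncomputable def negPart : (Idx p q → ℝ) →ₗ[ℝ] EuclideanSpace ℝ (Fin q ⊕ Unit) where
  toFun x := WithLp.toLp 2 fun k => x (Sum.inr k)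
  map_add' _ _ := rfl
  map_smul' _ _ := rfl

lemma norm_negPart_sq (x : Idx p q → ℝ) : ‖negPart p q x‖ ^ 2 = ∑ k, x (Sum.inr k) ^ 2 := by
  rw [EuclideanSpace.norm_sq_eq]
  exact Finset.sum_congr rfl fun k _ => sq_abs _

lemma norm_negPart (x : Idx p q → ℝ) : ‖negPart p q x‖ = coshPart p q x := by
  rw [coshPart, ← norm_negPart_sq, Real.sqrt_sq (norm_nonneg _)]

-- The form takes the value `-ε ≤ 0` at the point, so its positive part is at most its negative part
-- and the latter controls the full norm of `g x`. This in turn controls the norm of `x`, because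
-- `g` has the inverse `form * gᵀ * form`.
variable {p q} in
lemma exists_lower_bound {g : Mat p q} (hg : gᵀ * form p q * g = form p q) :
    ∃ c : ℝ, 0 < c ∧ ∀ ε w, 0 ≤ ε → c * orbitWeight (signCoef p q) ε w ≤
      ‖negPart p q (g *ᵥ orbitPoint p q ε w)‖ ^ 2 := by
  set A := form p q * gᵀ * form p q with hA
  set K := (∑ b, ∑ c, A b c ^ 2) + 1 with hK
  have hK0 : 0 < K := by
    have : 0 ≤ ∑ b, ∑ c, A b c ^ 2 :=
      Finset.sum_nonneg fun b _ => Finset.sum_nonneg fun c _ => sq_nonneg _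
    linarith
  refine ⟨(4 * K)⁻¹, by positivity, fun ε w hε => ?_⟩
  set x := orbitPoint p q ε w
  have h1 := sum_sq_orbitPoint p q ε w
  have h2 : ∑ b, x b ^ 2 ≤ K * ∑ b, (g *ᵥ x) b ^ 2 := by
    have h3 := sum_sq_mulVec_le A (g *ᵥ x)
    rw [Matrix.mulVec_mulVec, inverse_of_preserves_form hg, Matrix.one_mulVec] at h3
    have : 0 ≤ ∑ b, (g *ᵥ x) b ^ 2 := Finset.sum_nonneg fun b _ => sq_nonneg _
    nlinarith
  have h4 := sum_formSign_mulVec hg x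
  rw [sum_formSign_orbitPoint, Fintype.sum_sum_type] at h4
  simp only [formSign, Sum.elim_inl, Sum.elim_inr, one_mul, neg_one_mul,
    Finset.sum_neg_distrib] at h4
  rw [Fintype.sum_sum_type (fun b => (g *ᵥ x) b ^ 2)] at h2
  rw [norm_negPart_sq, inv_mul_le_iff₀ (by positivity)]
  have h5 : K * (∑ a, (g *ᵥ x) (Sum.inl a) ^ 2 + ∑ k, (g *ᵥ x) (Sum.inr k) ^ 2) ≤
      K * (2 * ∑ k, (g *ᵥ x) (Sum.inr k) ^ 2) := by gcongr; linarith
  linarith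

end Coordinates

end Hyperbolic

/-! ### The wave equation, and the orbits as a family of paraboloids. -/

namespace Hyperbolic

open MeasureTheory Filter Topology Set
open scoped Matrix

section Frame

variable (p q : ℕ)

/-- The vector `∂u/∂w_j`. -/
noncomputable def uVec (j : Fin (max (p - 1) q)) : Idx p q → ℝ :=
  Sum.elim (Sum.elim 0 (uPart p q (Pi.single j 1))) 0

/-- The vector `∂v/∂w_j`. -/
noncomputable def vVec (j : Fin (max (p - 1) q)) : Idx p q → ℝ :=
  Sum.elim 0 (Sum.elim (vPart p q (Pi.single j 1)) 0)

lemma uVec_castLE (i : Fin (p - 1)) :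
    uVec p q (Fin.castLE (le_max_left _ _) i) = Pi.single (Sum.inl (Sum.inr i)) 1 := by
  ext ((k | k) | (k | k)) <;> simp [uVec, uPart, Pi.single_apply]

lemma vVec_castLE (i : Fin q) :
    vVec p q (Fin.castLE (le_max_right _ _) i) = Pi.single (Sum.inr (Sum.inl i.rev)) 1 := by
  ext ((k | k) | (k | k)) <;> simp [vVec, vPart, Pi.single_apply, Fin.rev_eq_iff]

lemma uVec_eq_zero {j : Fin (max (p - 1) q)} (h : ¬(j : ℕ) < p - 1) : uVec p q j = 0 := by
  ext ((k | k) | (k | k)) <;> simp [uVec, uPart, Pi.single_apply]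
  rintro rfl
  exact h k.2

lemma vVec_eq_zero {j : Fin (max (p - 1) q)} (h : ¬(j : ℕ) < q) : vVec p q j = 0 := by
  ext ((k | k) | (k | k)) <;> simp [vVec, vPart, Pi.single_apply]
  rintro rfl
  exact h k.rev.2

/-- The null vector `e_{p+q+1} + e_1`. -/
noncomputable def zetaVec : Idx p q → ℝ :=
  Pi.single (Sum.inr (Sum.inr ())) 1 + Pi.single (Sum.inl (Sum.inl ())) 1

/-- The null vector `e_{p+q+1} - e_1`. -/
noncomputable def zetaVec' : Idx p q → ℝ :=
  Pi.single (Sum.inr (Sum.inr ())) 1 - Pi.single (Sum.inl (Sum.inl ())) 1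

lemma orbitPoint_eq (ε : ℝ) (w : Fin (max (p - 1) q) → ℝ) :
    orbitPoint p q ε w = (1 / 2 : ℝ) • zetaVec' p q +
      ((ε + ∑ j, signCoef p q j * w j ^ 2) / 2) • zetaVec p q +
      ∑ j, w j • (uVec p q j - vVec p q j) := by
  have h1 : ∀ i, ∑ j, w j * uPart p q (Pi.single j 1) i = uPart p q w i := fun i => by
    simp [uPart, Pi.single_apply]
  have h2 : ∀ i, ∑ j, w j * vPart p q (Pi.single j 1) i = vPart p q w i := fun i => by
    simp [vPart, Pi.single_apply]
  ext ((k | k) | (k | k)) <;>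
    simp [orbitPoint, zetaVec, zetaVec', uVec, vVec, Finset.sum_apply, h1, h2] <;> ring

/-- Either `e_j = 0`, or `e_j = 1` and the `v`-vector is zero, or `e_j = -1` and the `u`-vector is
zero. -/
lemma signCoef_smul (j : Fin (max (p - 1) q)) :
    signCoef p q j • (uVec p q j + vVec p q j) = signCoef p q j ^ 2 • (uVec p q j - vVec p q j) := by
  by_cases h1 : (j : ℕ) < p - 1 <;> by_cases h2 : (j : ℕ) < q <;>
    simp [signCoef, h1, h2, uVec_eq_zero, vVec_eq_zero]

variable {p q}

/-- The last `q + 1` coordinates of `g x`. -/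
noncomputable def translate (g : Mat p q) : (Idx p q → ℝ) →ₗ[ℝ] EuclideanSpace ℝ (Fin q ⊕ Unit) :=
  negPart p q ∘ₗ g.mulVecLin

lemma translate_single (g : Mat p q) (b : Idx p q) :
    translate g (Pi.single b 1) = ∑ k, g (Sum.inr k) b • EuclideanSpace.single k (1 : ℝ) := by
  ext k
  have h : translate g (Pi.single b 1) k = g (Sum.inr k) b := by
    change (g *ᵥ Pi.single b 1) (Sum.inr k) = _
    simp
  rw [h]
  simp only [WithLp.ofLp_sum, Finset.sum_apply, PiLp.smul_apply, PiLp.single_apply,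
    smul_eq_mul, mul_ite, mul_one, mul_zero, Finset.sum_ite_eq, Finset.mem_univ, if_true]

/-- The contraction of a bilinear form with the invariant form of `G`. -/
lemma sum_formSign_bilinear {g : Mat p q} (hg : gᵀ * form p q * g = form p q)
    (B : EuclideanSpace ℝ (Fin q ⊕ Unit) →L[ℝ] EuclideanSpace ℝ (Fin q ⊕ Unit) →L[ℝ] ℂ) :
    ∑ b, formSign p q b • B (translate g (Pi.single b 1)) (translate g (Pi.single b 1)) =
      -∑ k, B (EuclideanSpace.single k 1) (EuclideanSpace.single k 1) := by
  have h := mul_form_mul_transpose hg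
  -- This is the lower right block of `g * form * gᵀ = form`: the rows of `g` with negative index
  -- are orthogonal for the form, with square `-1`.
  have h1 : ∀ k l, ∑ b, formSign p q b * (g (Sum.inr k) b * g (Sum.inr l) b) =
      if k = l then -1 else 0 := by
    intro k l
    have h2 := congrFun (congrFun h (Sum.inr k)) (Sum.inr l)
    rw [form_eq, Matrix.mul_apply] at h2
    simp only [Matrix.mul_diagonal, Matrix.transpose_apply, Matrix.diagonal_apply, Sum.inr.injEq,
      formSign, Sum.elim_inr] at h2
    rw [← h2]
    refine Finset.sum_congr rfl fun b _ => ?_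
    simp only [formSign]
    ring
  calc _ = ∑ b, ∑ k, ∑ l, (formSign p q b * (g (Sum.inr k) b * g (Sum.inr l) b)) •
        B (EuclideanSpace.single k 1) (EuclideanSpace.single l 1) := by
        refine Finset.sum_congr rfl fun b _ => ?_
        rw [translate_single]
        simp only [map_sum, map_smul, _root_.sum_apply, _root_.smul_apply, Finset.smul_sum,
          smul_smul]
        rw [Finset.sum_comm]
        refine Finset.sum_congr rfl fun k _ => Finset.sum_congr rfl fun l _ => ?_
        congr 1; ring
    _ = ∑ k, ∑ l, (∑ b, formSign p q b * (g (Sum.inr k) b * g (Sum.inr l) b)) •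
        B (EuclideanSpace.single k 1) (EuclideanSpace.single l 1) := by
        rw [Finset.sum_comm]
        refine Finset.sum_congr rfl fun k _ => ?_
        rw [Finset.sum_comm]
        refine Finset.sum_congr rfl fun l _ => ?_
        rw [Finset.sum_smul]
    _ = _ := by
        simp_rw [h1]
        simp [Finset.sum_neg_distrib]

/-- The contraction of `B` with the form is minus the Laplacian, hence zero. In the frame adapted to
the orbit, the coordinates `1` and `p + q + 1` contribute `-B(ζ, ζ')` by polarization along the null
vectors, and each pair `u_j`, `v_j` contributes `B(u - v, u + v)`. -/
lemma wave_of_harmonic {g : Mat p q} (hg : gᵀ * form p q * g = form p q)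
    (B : EuclideanSpace ℝ (Fin q ⊕ Unit) →L[ℝ] EuclideanSpace ℝ (Fin q ⊕ Unit) →L[ℝ] ℂ)
    (hsymm : ∀ a b, B a b = B b a)
    (hB : ∑ k, B (EuclideanSpace.single k 1) (EuclideanSpace.single k 1) = 0) :
    B (translate g (zetaVec p q)) (translate g (zetaVec' p q)) =
      ∑ j, B (translate g (uVec p q j - vVec p q j)) (translate g (uVec p q j + vVec p q j)) := by
  have h := sum_formSign_bilinear hg B
  rw [hB, neg_zero] at h
  have hu : ∑ j, B (translate g (uVec p q j)) (translate g (uVec p q j)) =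
      ∑ i : Fin (p - 1), B (translate g (Pi.single (Sum.inl (Sum.inr i)) 1))
        (translate g (Pi.single (Sum.inl (Sum.inr i)) 1)) := by
    simp_rw [← uVec_castLE]
    rw [← sum_ite_lt_eq_sum_castLE (le_max_left _ _)
      fun j => B (translate g (uVec p q j)) (translate g (uVec p q j))]
    refine Finset.sum_congr rfl fun j _ => ?_
    split_ifs with hj
    · rfl
    · simp [uVec_eq_zero p q hj]
  have hv : ∑ j, B (translate g (vVec p q j)) (translate g (vVec p q j)) =
      ∑ i : Fin q, B (translate g (Pi.single (Sum.inr (Sum.inl i)) 1))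
        (translate g (Pi.single (Sum.inr (Sum.inl i)) 1)) := by
    rw [← Equiv.sum_comp Fin.revPerm fun i : Fin q =>
      B (translate g (Pi.single (Sum.inr (Sum.inl i)) 1))
        (translate g (Pi.single (Sum.inr (Sum.inl i)) 1))]
    simp_rw [Fin.revPerm_apply, ← vVec_castLE]
    rw [← sum_ite_lt_eq_sum_castLE (le_max_right _ _)
      fun j => B (translate g (vVec p q j)) (translate g (vVec p q j))]
    refine Finset.sum_congr rfl fun j _ => ?_
    split_ifs with hj
    · rfl
    · simp [vVec_eq_zero p q hj]
  simp only [Fintype.sum_sum_type, formSign, Sum.elim_inl, Sum.elim_inr, one_smul, neg_smul,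
    Finset.univ_unique, Finset.sum_singleton, Finset.sum_neg_distrib] at h
  rw [← hu, ← hv] at h
  have h2 : ∀ j, B (translate g (uVec p q j - vVec p q j)) (translate g (uVec p q j + vVec p q j)) =
      B (translate g (uVec p q j)) (translate g (uVec p q j)) -
      B (translate g (vVec p q j)) (translate g (vVec p q j)) := by
    intro j
    simp only [map_sub, map_add, _root_.sub_apply]
    rw [hsymm (translate g (vVec p q j)) (translate g (uVec p q j))]
    ring
  rw [Finset.sum_congr rfl fun j _ => h2 j, Finset.sum_sub_distrib, zetaVec, zetaVec']
  simp only [map_sub, map_add, _root_.add_apply]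
  rw [hsymm (translate g (Pi.single (Sum.inl (Sum.inl ())) 1))]
  linear_combination -h

/-- The integrals over the orbits of `N^*` of a homogeneous harmonic function of the last `q + 1`
coordinates vanish. -/
theorem radon_eq_zero_of_harmonic (hp : 1 ≤ p) (hq : 1 ≤ q) {g : Mat p q}
    (hg : gᵀ * form p q * g = form p q) {lam : ℝ} (hlam : 0 < lam)
    (hmu : 0 < lam + ((p : ℝ) - q + 1) / 2) {F : EuclideanSpace ℝ (Fin q ⊕ Unit) → ℂ}
    (hF : ∀ y, y ≠ 0 → ContDiffAt ℝ 2 F y) (hhom : IsHomogeneousNeg F (lam + rho p q))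
    (hharm : ∀ y, y ≠ 0 → ∑ k, fderiv ℝ (fderiv ℝ F) y (EuclideanSpace.single k 1)
      (EuclideanSpace.single k 1) = 0)
    {f : (Idx p q → ℝ) → ℂ} (hf : ∀ x, negPart p q x ≠ 0 → f x = F (negPart p q x)) :
    RadonConverges p q f g ∧ radon p q f g = 0 := by
  obtain ⟨c, hc, hlow⟩ := exists_lower_bound hg
  have hpt : ∀ ε w, negPart p q (g *ᵥ orbitPoint p q ε w) =
      (1 / 2 : ℝ) • translate g (zetaVec' p q) +
        ((ε + ∑ j, signCoef p q j * w j ^ 2) / 2) • translate g (zetaVec p q) +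
        ∑ j, w j • translate g (uVec p q j - vVec p q j) := by
    intro ε w
    rw [orbitPoint_eq]
    change translate g _ = _
    simp only [map_add, map_smul, map_sum]
  have : Nonempty (Fin (max (p - 1) q)) := ⟨⟨0, by omega⟩⟩
  let O : ParaboloidFamily (Fin (max (p - 1) q)) (EuclideanSpace ℝ (Fin q ⊕ Unit)) F lam :=
    { e := signCoef p q
      z := translate g (zetaVec p q)
      zm := translate g (zetaVec' p q)
      ξ := fun j => translate g (uVec p q j - vVec p q j)
      ξ' := fun j => translate g (uVec p q j + vVec p q j)
      c := c
      N := lam + rho p q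
      lam_pos := hlam
      c_pos := hc
      cube := signCoef_cube p q
      sign := signCoef_sign p q
      compat := fun j => by rw [← map_smul, ← map_smul, signCoef_smul]
      N_eq := by rw [sum_one_sub_signCoef_sq p q hp]
      smooth := hF
      homog := hhom
      wave := fun y hy => wave_of_harmonic hg _
        (fun a b => (hF y hy).isSymmSndFDerivAt (by simp) a b) (hharm y hy)
      lower := fun ε w hε => by rw [← hpt]; exact hlow ε w hε }
  have hO : ∀ w, f ((g * nStar p q w) *ᵥ basePoint p q) = F (O.pt 1 w) := fun w => by
    have h1 : negPart p q (g *ᵥ orbitPoint p q 1 w) = O.pt 1 w := hpt 1 w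
    rw [mul_nStar_mulVec_basePoint, hf _ (h1 ▸ O.pt_ne_zero zero_le_one w), h1]
  unfold RadonConverges radon
  simp_rw [hO]
  refine ⟨O.integrable_F zero_le_one, O.integral_eq_zero ?_ one_pos⟩
  rcases le_total q (p - 1) with h | h
  · left
    intro j
    change 0 ≤ signCoef p q j
    unfold signCoef; split_ifs <;> first | omega | norm_num
  · right
    refine ⟨fun j => ?_, ?_⟩
    · change signCoef p q j ≤ 0
      unfold signCoef; split_ifs <;> first | omega | norm_num
    -- For `p - 1 ≤ q` this quantity is `λ + (p - q + 1)/2`, which is `hmu`.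
    · change 0 < lam + 1 - (∑ j, signCoef p q j ^ 2) / 2
      rw [sum_signCoef_sq p q hp, max_eq_right h, rho]
      linarith

end Frame

end Hyperbolic

/-! ### Harmonic functions away from the origin. -/

namespace Hyperbolic

open MeasureTheory Filter Topology Set
open scoped Matrix ContDiff

section Harmonic

variable {κ W : Type*} [Fintype κ] [DecidableEq κ] [NormedAddCommGroup W] [NormedSpace ℝ W]

/-- `G` is smooth and harmonic away from the origin. -/
def IsHarmonicOffZero (G : EuclideanSpace ℝ κ → W) : Prop :=
  (∀ y, y ≠ 0 → ContDiffAt ℝ ∞ G y) ∧ ∀ y, y ≠ 0 →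
    ∑ k, fderiv ℝ (fun x => fderiv ℝ G x (EuclideanSpace.single k 1)) y
      (EuclideanSpace.single k 1) = 0

lemma fderiv_fderiv_apply {E : Type*} [NormedAddCommGroup E] [NormedSpace ℝ E] {G : E → W} {y : E}
    (h : ContDiffAt ℝ 2 G y) (a b : E) :
    fderiv ℝ (fun x => fderiv ℝ G x b) y a = fderiv ℝ (fderiv ℝ G) y a b := by
  have h1 : DifferentiableAt ℝ (fderiv ℝ G) y :=
    (h.fderiv_right (m := 1) (by norm_num)).differentiableAt (by norm_num)
  rw [fderiv_clm_apply h1 (differentiableAt_const b)]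
  simp

lemma fderiv_apply_comm {E : Type*} [NormedAddCommGroup E] [NormedSpace ℝ E] {G : E → W} {y : E}
    (h : ContDiffAt ℝ 2 G y) (a b : E) :
    fderiv ℝ (fun x => fderiv ℝ G x b) y a = fderiv ℝ (fun x => fderiv ℝ G x a) y b := by
  rw [fderiv_fderiv_apply h, fderiv_fderiv_apply h]
  exact h.isSymmSndFDerivAt (by simp) a b

lemma contDiffAt_fderiv_apply {E : Type*} [NormedAddCommGroup E] [NormedSpace ℝ E] {G : E → W}
    {y : E} (h : ContDiffAt ℝ ∞ G y) (a : E) : ContDiffAt ℝ ∞ (fun x => fderiv ℝ G x a) y :=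
  (h.fderiv_right (m := ∞) (by simp)).clm_apply contDiffAt_const

lemma eventually_ne_zero {E : Type*} [NormedAddCommGroup E] {y : E} (hy : y ≠ 0) :
    ∀ᶠ x in 𝓝 y, x ≠ 0 := isOpen_ne.mem_nhds hy

lemma two_le_infty : (2 : WithTop ℕ∞) ≤ ∞ := ENat.LEInfty.out

lemma IsHarmonicOffZero.congr {G G' : EuclideanSpace ℝ κ → W} (h : IsHarmonicOffZero G)
    (hG : ∀ y, y ≠ 0 → G' y = G y) : IsHarmonicOffZero G' := by
  have h1 : ∀ y, y ≠ 0 → G' =ᶠ[𝓝 y] G := fun y hy =>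
    (eventually_ne_zero hy).mono hG
  refine ⟨fun y hy => (h.1 y hy).congr_of_eventuallyEq (h1 y hy), fun y hy => ?_⟩
  rw [← h.2 y hy]
  refine Finset.sum_congr rfl fun k _ => ?_
  congr 1
  refine Filter.EventuallyEq.fderiv_eq ?_
  filter_upwards [eventually_ne_zero hy] with x hx
  rw [(h1 x hx).fderiv_eq]

lemma IsHarmonicOffZero.clm_comp {W' : Type*} [NormedAddCommGroup W'] [NormedSpace ℝ W']
    {G : EuclideanSpace ℝ κ → W} (h : IsHarmonicOffZero G) (L : W →L[ℝ] W') :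
    IsHarmonicOffZero fun y => L (G y) := by
  refine ⟨fun y hy => L.contDiff.contDiffAt.comp y (h.1 y hy), fun y hy => ?_⟩
  have h1 : ∀ x, x ≠ 0 → ∀ a, fderiv ℝ (fun y => L (G y)) x a = L (fderiv ℝ G x a) := by
    intro x hx a
    exact congrArg (fun T : EuclideanSpace ℝ κ →L[ℝ] W' => T a)
      (L.hasFDerivAt.comp x ((h.1 x hx).differentiableAt (by simp)).hasFDerivAt).fderiv
  have h2 : ∀ a, fderiv ℝ (fun x => fderiv ℝ (fun y => L (G y)) x a) y a =
      L (fderiv ℝ (fun x => fderiv ℝ G x a) y a) := by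
    intro a
    have h3 : (fun x => fderiv ℝ (fun y => L (G y)) x a) =ᶠ[𝓝 y]
        fun x => L (fderiv ℝ G x a) := by
      filter_upwards [eventually_ne_zero hy] with x hx using h1 x hx a
    rw [h3.fderiv_eq]
    exact congrArg (fun T : EuclideanSpace ℝ κ →L[ℝ] W' => T a)
      (L.hasFDerivAt.comp y ((contDiffAt_fderiv_apply (h.1 y hy)
        a).differentiableAt (by simp)).hasFDerivAt).fderiv
  simp_rw [h2]
  rw [← map_sum, h.2 y hy, map_zero]

/-- Directional derivatives of harmonic functions are harmonic. -/
lemma IsHarmonicOffZero.fderiv_apply {G : EuclideanSpace ℝ κ → W} (h : IsHarmonicOffZero G)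
    (a : EuclideanSpace ℝ κ) : IsHarmonicOffZero fun y => fderiv ℝ G y a := by
  refine ⟨fun y hy => contDiffAt_fderiv_apply (h.1 y hy) a, fun y hy => ?_⟩
  have h2 : ∀ b, fderiv ℝ (fun x => fderiv ℝ (fun z => fderiv ℝ G z a) x b) y b =
      fderiv ℝ (fun x => fderiv ℝ (fun z => fderiv ℝ G z b) x b) y a := by
    intro b
    have h3 : (fun x => fderiv ℝ (fun z => fderiv ℝ G z a) x b) =ᶠ[𝓝 y]
        fun x => fderiv ℝ (fun z => fderiv ℝ G z b) x a := by
      filter_upwards [eventually_ne_zero hy] with x hx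
      exact fderiv_apply_comm ((h.1 x hx).of_le two_le_infty) b a
    rw [h3.fderiv_eq]
    exact fderiv_apply_comm ((contDiffAt_fderiv_apply (h.1 y hy) b).of_le two_le_infty) b a
  simp_rw [h2]
  have h4 : ∀ k, DifferentiableAt ℝ (fun x => fderiv ℝ (fun z => fderiv ℝ G z
      (EuclideanSpace.single k 1)) x (EuclideanSpace.single k 1)) y := fun k =>
    (contDiffAt_fderiv_apply (contDiffAt_fderiv_apply (h.1 y hy) _) _).differentiableAt (by simp)
  have h5 := fderiv_fun_sum (u := Finset.univ) fun k _ => h4 k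
  have h6 : (fun x => ∑ k, fderiv ℝ (fun z => fderiv ℝ G z (EuclideanSpace.single k 1)) x
      (EuclideanSpace.single k 1)) =ᶠ[𝓝 y] fun _ => 0 := by
    filter_upwards [eventually_ne_zero hy] with x hx using h.2 x hx
  rw [h6.fderiv_eq] at h5
  have h7 := congrArg (fun T : EuclideanSpace ℝ κ →L[ℝ] W => T a) h5
  simpa using h7.symm

lemma IsHarmonicOffZero.sum_fderiv_fderiv {G : EuclideanSpace ℝ κ → W} (h : IsHarmonicOffZero G)
    {y : EuclideanSpace ℝ κ} (hy : y ≠ 0) :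
    ∑ k, fderiv ℝ (fderiv ℝ G) y (EuclideanSpace.single k 1) (EuclideanSpace.single k 1) = 0 := by
  rw [← h.2 y hy]
  exact Finset.sum_congr rfl fun k _ =>
    (fderiv_fderiv_apply ((h.1 y hy).of_le two_le_infty) _ _).symm

lemma hasFDerivAt_norm_sq_rpow {V : Type*} [NormedAddCommGroup V] [InnerProductSpace ℝ V]
    {y : V} (c a : ℝ) (hy : c + ‖y‖ ^ 2 ≠ 0) :
    HasFDerivAt (fun x : V => (c + ‖x‖ ^ 2) ^ a)
      ((2 * a * (c + ‖y‖ ^ 2) ^ (a - 1)) • innerSL ℝ y) y := by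
  have h1 := ((hasStrictFDerivAt_norm_sq y).hasFDerivAt.const_add c).rpow_const (p := a)
    (Or.inl hy)
  refine h1.congr_fderiv ?_
  ext v
  simp
  ring

/-- The Newtonian potential is harmonic. -/
lemma isHarmonicOffZero_newton {ν : ℝ} (hν : 2 * ν + 2 = Fintype.card κ) :
    IsHarmonicOffZero fun y : EuclideanSpace ℝ κ => (0 + ‖y‖ ^ 2) ^ (-ν) := by
  have hne : ∀ y : EuclideanSpace ℝ κ, y ≠ 0 → 0 + ‖y‖ ^ 2 ≠ 0 := fun y hy => by
    rw [zero_add]; exact pow_ne_zero _ (norm_ne_zero_iff.2 hy)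
  refine ⟨fun y hy => ?_, fun y hy => ?_⟩
  · exact ContDiffAt.rpow_const_of_ne (contDiffAt_const.add (contDiff_norm_sq ℝ).contDiffAt)
      (hne y hy)
  · have h1 : ∀ k, fderiv ℝ (fun x => fderiv ℝ (fun y : EuclideanSpace ℝ κ =>
        (0 + ‖y‖ ^ 2) ^ (-ν)) x (EuclideanSpace.single k 1)) y (EuclideanSpace.single k 1) =
        -2 * ν * (‖y‖ ^ 2) ^ (-ν - 1) + 4 * ν * (ν + 1) * (‖y‖ ^ 2) ^ (-ν - 1 - 1) * y k ^ 2 := by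
      intro k
      have h2 : (fun x => fderiv ℝ (fun y : EuclideanSpace ℝ κ => (0 + ‖y‖ ^ 2) ^ (-ν)) x
          (EuclideanSpace.single k 1)) =ᶠ[𝓝 y]
          fun x => -2 * ν * ((0 + ‖x‖ ^ 2) ^ (-ν - 1) * x k) := by
        filter_upwards [eventually_ne_zero hy] with x hx
        rw [(hasFDerivAt_norm_sq_rpow 0 (-ν) (hne x hx)).fderiv]
        simp [EuclideanSpace.inner_single_right]
        ring
      have h3 := ((hasFDerivAt_norm_sq_rpow 0 (-ν - 1) (hne y hy)).mul
        (EuclideanSpace.proj k : EuclideanSpace ℝ κ →L[ℝ] ℝ).hasFDerivAt).const_mul (-2 * ν)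
      rw [h2.fderiv_eq]
      refine (congrArg (fun T : EuclideanSpace ℝ κ →L[ℝ] ℝ => T (EuclideanSpace.single k 1))
        h3.fderiv).trans ?_
      simp [EuclideanSpace.inner_single_right]
      ring
    rw [Finset.sum_congr rfl fun k _ => h1 k, Finset.sum_add_distrib,
      ← Finset.mul_sum (f := fun k => y k ^ 2)]
    have h4 : ∑ k, y k ^ 2 = ‖y‖ ^ 2 := by rw [EuclideanSpace.norm_sq_eq]; simp
    have h5 := hne y hy
    rw [zero_add] at h5
    rw [h4, Real.rpow_sub_one h5 (-ν - 1)]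
    simp only [Finset.sum_const, Finset.card_univ, nsmul_eq_mul, ← hν]
    field_simp
    ring

end Harmonic

end Hyperbolic

/-! ### Kelvin transforms of zonal harmonics. -/

namespace Hyperbolic

open MeasureTheory Filter Topology Set
open scoped Matrix ContDiff

section Kelvin

variable {κ : Type*} [Fintype κ]

/-- The zonal harmonic function of degree `-n - 2ν` with axis `l`, given by the Gegenbauer
polynomial `C_n^{(ν)}`. -/
noncomputable def kelvin (ν : ℝ) (l : κ) (n : ℕ) (y : EuclideanSpace ℝ κ) : ℝ :=
  gegenbauer ν n (y l / ‖y‖) * ‖y‖ ^ (-((n : ℝ) + 2 * ν))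

variable (ν : ℝ) (l : κ)

lemma kelvin_zero (y : EuclideanSpace ℝ κ) : kelvin ν l 0 y = (0 + ‖y‖ ^ 2) ^ (-ν) := by
  rw [kelvin, gegenbauer, zero_add, one_mul, ← Real.rpow_natCast, ← Real.rpow_mul (norm_nonneg _)]
  congr 1
  push_cast; ring

lemma norm_sq_mul_kelvin_one {y : EuclideanSpace ℝ κ} (hy : y ≠ 0) :
    ‖y‖ ^ 2 * kelvin ν l 1 y = 2 * ν * (y l * kelvin ν l 0 y) := by
  have hn : 0 < ‖y‖ := norm_pos_iff.2 hy
  simp only [kelvin, gegenbauer]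
  rw [show -(((1 : ℕ) : ℝ) + 2 * ν) = -(((0 : ℕ) : ℝ) + 2 * ν) - 1 by push_cast; ring,
    Real.rpow_sub_one hn.ne']
  field_simp

lemma norm_sq_mul_kelvin_add_two (n : ℕ) {y : EuclideanSpace ℝ κ} (hy : y ≠ 0) :
    ((n : ℝ) + 2) * (‖y‖ ^ 2 * kelvin ν l (n + 2) y) =
      2 * (n + 1 + ν) * (y l * kelvin ν l (n + 1) y) - (n + 2 * ν) * kelvin ν l n y := by
  have hn : 0 < ‖y‖ := norm_pos_iff.2 hy
  simp only [kelvin, gegenbauer]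
  rw [show -(((n + 2 : ℕ) : ℝ) + 2 * ν) = -((n : ℝ) + 2 * ν) - 1 - 1 by push_cast; ring,
    show -(((n + 1 : ℕ) : ℝ) + 2 * ν) = -((n : ℝ) + 2 * ν) - 1 by push_cast; ring,
    Real.rpow_sub_one hn.ne', Real.rpow_sub_one hn.ne']
  have h2 : (n : ℝ) + 2 ≠ 0 := by positivity
  field_simp

lemma isHomogeneousNeg_kelvin (n : ℕ) : IsHomogeneousNeg (kelvin ν l n) (n + 2 * ν) := by
  intro r hr y hy
  simp only [kelvin, norm_smul, Real.norm_of_nonneg hr.le, PiLp.smul_apply, smul_eq_mul]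
  rw [mul_div_mul_left _ _ hr.ne', Real.mul_rpow hr.le (norm_nonneg _)]
  ring

variable [DecidableEq κ]

lemma fderiv_norm_sq_mul {G : EuclideanSpace ℝ κ → ℝ} {y : EuclideanSpace ℝ κ}
    (h : DifferentiableAt ℝ G y) :
    fderiv ℝ (fun x => ‖x‖ ^ 2 * G x) y (EuclideanSpace.single l 1) =
      ‖y‖ ^ 2 * fderiv ℝ G y (EuclideanSpace.single l 1) + 2 * y l * G y := by
  refine (congrArg (fun T : EuclideanSpace ℝ κ →L[ℝ] ℝ => T (EuclideanSpace.single l 1))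
    ((hasStrictFDerivAt_norm_sq y).hasFDerivAt.mul h.hasFDerivAt).fderiv).trans ?_
  simp [EuclideanSpace.inner_single_right]
  ring

lemma fderiv_coord_mul {G : EuclideanSpace ℝ κ → ℝ} {y : EuclideanSpace ℝ κ}
    (h : DifferentiableAt ℝ G y) :
    fderiv ℝ (fun x => x l * G x) y (EuclideanSpace.single l 1) =
      y l * fderiv ℝ G y (EuclideanSpace.single l 1) + G y := by
  refine (congrArg (fun T : EuclideanSpace ℝ κ →L[ℝ] ℝ => T (EuclideanSpace.single l 1))
    ((EuclideanSpace.proj l : EuclideanSpace ℝ κ →L[ℝ] ℝ).hasFDerivAt.mul h.hasFDerivAt).fderiv).trans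
    ?_
  simp

/-- Differentiating along the axis raises the degree. -/
lemma kelvin_smooth_and_fderiv (n : ℕ) : ∀ y : EuclideanSpace ℝ κ, y ≠ 0 →
    ContDiffAt ℝ ∞ (kelvin ν l n) y ∧
    fderiv ℝ (kelvin ν l n) y (EuclideanSpace.single l 1) = -(n + 1) * kelvin ν l (n + 1) y ∧
    fderiv ℝ (kelvin ν l (n + 1)) y (EuclideanSpace.single l 1) =
      -(n + 2) * kelvin ν l (n + 2) y := by
  -- Once the derivative formula is known in degree `n`, the function of degree `n + 1` is a
  -- multiple of a derivative of a smooth function.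
  have hstep : ∀ n : ℕ, (∀ y : EuclideanSpace ℝ κ, y ≠ 0 → ContDiffAt ℝ ∞ (kelvin ν l n) y ∧
      fderiv ℝ (kelvin ν l n) y (EuclideanSpace.single l 1) = -(n + 1) * kelvin ν l (n + 1) y) →
      ∀ y : EuclideanSpace ℝ κ, y ≠ 0 → ContDiffAt ℝ ∞ (kelvin ν l (n + 1)) y := by
    intro n h y hy
    have h1 : kelvin ν l (n + 1) =ᶠ[𝓝 y] fun x => -((n : ℝ) + 1)⁻¹ *
        fderiv ℝ (kelvin ν l n) x (EuclideanSpace.single l 1) := by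
      filter_upwards [eventually_ne_zero hy] with x hx
      rw [(h x hx).2]
      have : (n : ℝ) + 1 ≠ 0 := by positivity
      field_simp
    exact (contDiffAt_const.mul (contDiffAt_fderiv_apply (h y hy).1 _)).congr_of_eventuallyEq h1
  -- The Gegenbauer recursion has three terms, so the induction carries two consecutive derivative
  -- formulas. The next one comes from differentiating the recursion, multiplied by `‖x‖²`, along
  -- the axis.
  induction n with
  | zero =>
    have hne : ∀ y : EuclideanSpace ℝ κ, y ≠ 0 → 0 + ‖y‖ ^ 2 ≠ 0 := fun y hy => by
      rw [zero_add]; exact pow_ne_zero _ (norm_ne_zero_iff.2 hy)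
    have h0 : kelvin ν l 0 = fun y => (0 + ‖y‖ ^ 2) ^ (-ν) := funext (kelvin_zero ν l)
    have hs : ∀ y : EuclideanSpace ℝ κ, y ≠ 0 → ContDiffAt ℝ ∞ (kelvin ν l 0) y := fun y hy => by
      rw [h0]
      exact ContDiffAt.rpow_const_of_ne (contDiffAt_const.add (contDiff_norm_sq ℝ).contDiffAt)
        (hne y hy)
    have hd : ∀ y : EuclideanSpace ℝ κ, y ≠ 0 → fderiv ℝ (kelvin ν l 0) y
        (EuclideanSpace.single l 1) = -(((0 : ℕ) : ℝ) + 1) * kelvin ν l (0 + 1) y := fun y hy => by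
      have h1 := norm_sq_mul_kelvin_one ν l hy
      have h2 := hne y hy
      rw [h0, (hasFDerivAt_norm_sq_rpow 0 (-ν) h2).fderiv, Real.rpow_sub_one h2, ← kelvin_zero ν l]
      simp only [zero_add] at h2 ⊢
      simp only [EuclideanSpace.inner_single_right, _root_.smul_apply, innerSL_apply_apply,
        smul_eq_mul]
      rw [← mul_right_inj' h2]
      field_simp
      simp
      linear_combination -h1
    have hs1 := hstep 0 fun y hy => ⟨hs y hy, hd y hy⟩
    refine fun y hy => ⟨hs y hy, hd y hy, ?_⟩
    have h2 : (fun x => ‖x‖ ^ 2 * kelvin ν l 1 x) =ᶠ[𝓝 y]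
        fun x => 2 * ν * (x l * kelvin ν l 0 x) := by
      filter_upwards [eventually_ne_zero hy] with x hx using norm_sq_mul_kelvin_one ν l hx
    have hd0 := (hs y hy).differentiableAt (by simp)
    have h3 := congrArg (fun T : EuclideanSpace ℝ κ →L[ℝ] ℝ => T (EuclideanSpace.single l 1))
      h2.fderiv_eq
    have hd2 : DifferentiableAt ℝ (fun x : EuclideanSpace ℝ κ => x l * kelvin ν l 0 x) y :=
      (EuclideanSpace.proj l : EuclideanSpace ℝ κ →L[ℝ] ℝ).differentiableAt.mul hd0
    simp only at h3
    rw [fderiv_norm_sq_mul l ((hs1 y hy).differentiableAt (by simp)), fderiv_const_mul hd2,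
      _root_.smul_apply, fderiv_coord_mul l hd0, hd y hy, smul_eq_mul] at h3
    have h4 := norm_sq_mul_kelvin_add_two ν l 0 hy
    have h5 : ‖y‖ ^ 2 ≠ 0 := pow_ne_zero _ (norm_ne_zero_iff.2 hy)
    rw [← mul_right_inj' h5]
    push_cast at h3 h4 ⊢
    simp only [zero_add] at h3 h4 ⊢
    linear_combination h3 + h4
  | succ n ih =>
    have hs1 := hstep n fun y hy => ⟨(ih y hy).1, (ih y hy).2.1⟩
    have hd1 : ∀ y : EuclideanSpace ℝ κ, y ≠ 0 → fderiv ℝ (kelvin ν l (n + 1)) y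
        (EuclideanSpace.single l 1) = -(((n + 1 : ℕ) : ℝ) + 1) * kelvin ν l (n + 1 + 1) y :=
      fun y hy => by rw [(ih y hy).2.2]; push_cast; ring
    have hs2 := hstep (n + 1) fun y hy => ⟨hs1 y hy, hd1 y hy⟩
    refine fun y hy => ⟨hs1 y hy, hd1 y hy, ?_⟩
    have h2 : (fun x => ((n : ℝ) + 2) * (‖x‖ ^ 2 * kelvin ν l (n + 2) x)) =ᶠ[𝓝 y]
        fun x => 2 * (n + 1 + ν) * (x l * kelvin ν l (n + 1) x) - (n + 2 * ν) * kelvin ν l n x := by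
      filter_upwards [eventually_ne_zero hy] with x hx using norm_sq_mul_kelvin_add_two ν l n hx
    have hd0 := (ih y hy).1.differentiableAt (by simp)
    have hd1' := (hs1 y hy).differentiableAt (by simp)
    have hd2' := (hs2 y hy).differentiableAt (by simp)
    have hdl : DifferentiableAt ℝ (fun x : EuclideanSpace ℝ κ => x l * kelvin ν l (n + 1) x) y :=
      (EuclideanSpace.proj l : EuclideanSpace ℝ κ →L[ℝ] ℝ).differentiableAt.mul hd1'
    have hdn : DifferentiableAt ℝ (fun x : EuclideanSpace ℝ κ => ‖x‖ ^ 2 * kelvin ν l (n + 2) x) y :=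
      (hasStrictFDerivAt_norm_sq y).differentiableAt.mul hd2'
    have h3 := congrArg (fun T : EuclideanSpace ℝ κ →L[ℝ] ℝ => T (EuclideanSpace.single l 1))
      h2.fderiv_eq
    simp only at h3
    rw [fderiv_const_mul hdn, fderiv_fun_sub (hdl.const_mul _) (hd0.const_mul _),
      fderiv_const_mul hdl, fderiv_const_mul hd0, _root_.sub_apply, _root_.smul_apply,
      _root_.smul_apply, _root_.smul_apply, fderiv_norm_sq_mul l hd2', fderiv_coord_mul l hd1',
      hd1 y hy, (ih y hy).2.1, smul_eq_mul, smul_eq_mul, smul_eq_mul] at h3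
    have h4 := norm_sq_mul_kelvin_add_two ν l (n + 1) hy
    have h5 : ‖y‖ ^ 2 ≠ 0 := pow_ne_zero _ (norm_ne_zero_iff.2 hy)
    have h6 : (n : ℝ) + 2 ≠ 0 := by positivity
    rw [← mul_right_inj' h5, ← mul_right_inj' h6]
    push_cast at h3 h4 ⊢
    linear_combination h3 + ((n : ℝ) + 2) * h4

/-- Up to a nonzero factor these functions are the iterated derivatives, along the axis, of the
Newtonian potential `‖y‖^{-2ν}`, and differentiation preserves harmonicity. -/
lemma isHarmonicOffZero_kelvin {ν : ℝ} (hν : 2 * ν + 2 = Fintype.card κ) (n : ℕ) :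
    IsHarmonicOffZero (kelvin ν l n) := by
  induction n with
  | zero =>
    rw [show kelvin ν l 0 = fun y => (0 + ‖y‖ ^ 2) ^ (-ν) from funext (kelvin_zero ν l)]
    exact isHarmonicOffZero_newton hν
  | succ n ih =>
    refine ((ih.fderiv_apply (EuclideanSpace.single l 1)).clm_comp
      ((-((n : ℝ) + 1)⁻¹) • ContinuousLinearMap.id ℝ ℝ)).congr fun y hy => ?_
    simp only [_root_.smul_apply, ContinuousLinearMap.id_apply, smul_eq_mul]
    rw [(kelvin_smooth_and_fderiv ν l n y hy).2.1]
    have : (n : ℝ) + 1 ≠ 0 := by positivity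
    field_simp

end Kelvin

/-! ### Integer powers of an isotropic complex linear form. -/

section Holomorphic

variable {κ : Type*} [Fintype κ]

lemma isHomogeneousNeg_zpow (L : EuclideanSpace ℝ κ →L[ℝ] ℂ) {m : ℤ} {N : ℝ} (hm : (m : ℝ) = -N) :
    IsHomogeneousNeg (fun y => L y ^ m) N := by
  intro r hr y _
  change L (r • y) ^ m = r ^ (-N) • L y ^ m
  rw [map_smul, Complex.real_smul, mul_zpow, Complex.real_smul, ← hm, Real.rpow_intCast,
    Complex.ofReal_zpow]

variable [DecidableEq κ]

/-- The Laplacian of `L^m` is `m (m - 1) L^{m-2} Σ L(e_k)²`, and the sum vanishes for an isotropic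
`L`. -/
lemma isHarmonicOffZero_zpow (L : EuclideanSpace ℝ κ →L[ℝ] ℂ) (hL : ∀ y, y ≠ 0 → L y ≠ 0)
    (hL2 : ∑ k, L (EuclideanSpace.single k 1) ^ 2 = 0) (m : ℤ) :
    IsHarmonicOffZero fun y => L y ^ m := by
  have hd : ∀ (m : ℤ) y, y ≠ 0 → HasFDerivAt (fun y => L y ^ m)
      ((m * L y ^ (m - 1)) • L) y := by
    intro m y hy
    have h1 := ((hasDerivAt_zpow m (L y) (Or.inl (hL y hy))).hasFDerivAt.restrictScalars ℝ).comp y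
      L.hasFDerivAt
    refine h1.congr_fderiv ?_
    ext v
    simp [mul_comm]
  refine ⟨fun y hy => ?_, fun y hy => ?_⟩
  · have h1 : ContDiffAt ℂ ∞ (fun z : ℂ => z ^ m) (L y) := by
      rcases m with m | m
      · simpa using contDiffAt_id.pow m
      · simp only [zpow_negSucc]
        exact (contDiffAt_id.pow (m + 1)).inv (pow_ne_zero _ (hL y hy))
    exact (h1.restrict_scalars ℝ).comp y L.contDiff.contDiffAt
  · have h2 : ∀ a, fderiv ℝ (fun x => fderiv ℝ (fun y => L y ^ m) x a) y a =
        m * ((m - 1) * L y ^ (m - 1 - 1)) * L a ^ 2 := by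
      intro a
      have h3 : (fun x => fderiv ℝ (fun y => L y ^ m) x a) =ᶠ[𝓝 y]
          fun x => (m * L a) * L x ^ (m - 1) := by
        filter_upwards [eventually_ne_zero hy] with x hx
        rw [(hd m x hx).fderiv]
        simp
        ring
      rw [h3.fderiv_eq, ((hd (m - 1) y hy).const_mul (m * L a)).fderiv]
      simp
      ring
    rw [Finset.sum_congr rfl fun k _ => h2 _, ← Finset.mul_sum, hL2, mul_zero]

end Holomorphic

end Hyperbolic

/-! ### Vanishing of the Radon transform of the generating functions. -/

namespace Hyperbolic

open MeasureTheory Filter Topology Set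
open scoped Matrix ContDiff

lemma preserves_form_of_mem_groupG {p q : ℕ} {g : Mat p q} (hg : g ∈ groupG p q) :
    gᵀ * form p q * g = form p q :=
  (connectedComponentIn_subset _ _ hg).1

/-- The complex coordinate `y_{l} + σ i y_{0}` on the plane. -/
noncomputable def planeCoord (σ : ℝ) : EuclideanSpace ℝ (Fin 1 ⊕ Unit) →L[ℝ] ℂ :=
  Complex.ofRealCLM.comp (EuclideanSpace.proj (Sum.inr ())) +
    ((σ : ℂ) * Complex.I) • Complex.ofRealCLM.comp (EuclideanSpace.proj (Sum.inl 0))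

lemma planeCoord_apply (σ : ℝ) (y : EuclideanSpace ℝ (Fin 1 ⊕ Unit)) :
    planeCoord σ y = (y (Sum.inr ()) : ℂ) + σ * Complex.I * (y (Sum.inl 0) : ℂ) := by
  simp [planeCoord]

lemma planeCoord_ne_zero {σ : ℝ} (hσ : σ ≠ 0) {y : EuclideanSpace ℝ (Fin 1 ⊕ Unit)} (hy : y ≠ 0) :
    planeCoord σ y ≠ 0 := by
  intro h
  rw [planeCoord_apply] at h
  have h1 := congrArg Complex.re h
  have h2 := congrArg Complex.im h
  simp at h1 h2
  apply hy
  ext (k | k)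
  · rw [Subsingleton.elim k 0]; simpa using h2.resolve_left hσ
  · simpa using h1

lemma sum_planeCoord_sq {σ : ℝ} (hσ : σ ^ 2 = 1) :
    ∑ k, planeCoord σ (EuclideanSpace.single k 1) ^ 2 = 0 := by
  have h : (σ : ℂ) ^ 2 = 1 := by exact_mod_cast hσ
  simp [planeCoord_apply, mul_pow, h]

lemma planeCoord_mul (y : EuclideanSpace ℝ (Fin 1 ⊕ Unit)) :
    planeCoord 1 y * planeCoord (-1) y = (‖y‖ : ℂ) ^ 2 := by
  have h : (‖y‖ : ℝ) ^ 2 = y (Sum.inr ()) ^ 2 + y (Sum.inl 0) ^ 2 := by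
    rw [EuclideanSpace.norm_sq_eq]; simp [add_comm]
  rw [planeCoord_apply, planeCoord_apply, ← Complex.ofReal_pow, h]
  push_cast
  linear_combination -(y (Sum.inl 0) : ℂ) ^ 2 * Complex.I_sq

lemma generatingFunction_one (p : ℕ) (lam : ℝ) (μ : ℤ) (x : Idx p 1 → ℝ) :
    generatingFunction p 1 lam μ x =
      (planeCoord 1 (negPart p 1 x) / ‖negPart p 1 x‖) ^ μ *
        ((‖negPart p 1 x‖ ^ (-|lam| - rho p 1) : ℝ) : ℂ) := by
  rw [generatingFunction, dif_pos rfl, ← norm_negPart, planeCoord_apply]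
  congr 2
  rw [show lastCoord p 1 x = negPart p 1 x (Sum.inr ()) from rfl,
    show x (Sum.inr (Sum.inl ⟨0, by omega⟩)) = negPart p 1 x (Sum.inl 0) from rfl]
  push_cast
  ring

/-- The vanishing of the Radon transform for `q = 1`. -/
theorem radon_eq_zero_one {p : ℕ} (hp : 1 ≤ p) {lam : ℝ} (hlam : lam ≠ 0) {μ : ℤ}
    (hμ : (μ : ℝ) = muParam p 1 lam) {g : Mat p 1} (hg : gᵀ * form p 1 * g = form p 1) :
    RadonConverges p 1 (generatingFunction p 1 lam μ) g ∧
      radon p 1 (generatingFunction p 1 lam μ) g = 0 := by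
  have hp' : (1 : ℝ) ≤ p := by exact_mod_cast hp
  have habs : 0 < |lam| := abs_pos.2 hlam
  -- For `q = 1` the condition at infinity is `|λ| + p/2 > 0` and holds automatically.
  have hmu : 0 < |lam| + ((p : ℝ) - (1 : ℕ) + 1) / 2 := by push_cast; linarith
  have key : ∀ (σ : ℝ) (m : ℤ), σ ^ 2 = 1 → (m : ℝ) = -(|lam| + rho p 1) →
      (∀ x, negPart p 1 x ≠ 0 →
        generatingFunction p 1 lam μ x = planeCoord σ (negPart p 1 x) ^ m) →
      RadonConverges p 1 (generatingFunction p 1 lam μ) g ∧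
        radon p 1 (generatingFunction p 1 lam μ) g = 0 := by
    intro σ m hσ hm hf
    have hσ0 : σ ≠ 0 := by rintro rfl; norm_num at hσ
    have hh := isHarmonicOffZero_zpow (planeCoord σ) (fun y hy => planeCoord_ne_zero hσ0 hy)
      (sum_planeCoord_sq hσ) m
    exact radon_eq_zero_of_harmonic hp le_rfl hg habs hmu
      (fun y hy => (hh.1 y hy).of_le two_le_infty) (isHomogeneousNeg_zpow _ hm)
      (fun y hy => hh.sum_fderiv_fderiv hy) hf
  rcases lt_or_gt_of_ne hlam with h | h
  · rw [muParam, if_neg h.le.not_gt] at hμ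
    have hm : (μ : ℝ) = -|lam| - rho p 1 := by rw [hμ, abs_of_neg h]; ring
    -- Here `μ = -|λ| - ρ`, so the powers of the norm cancel and `f` is the power `μ` of the complex
    -- coordinate.
    refine key 1 μ (by norm_num) (by rw [hm]; ring) fun x hx => ?_
    have hn : (‖negPart p 1 x‖ : ℂ) ≠ 0 := by exact_mod_cast norm_ne_zero_iff.2 hx
    rw [generatingFunction_one, ← hm, Real.rpow_intCast, Complex.ofReal_zpow, div_zpow,
      div_mul_cancel₀ _ (zpow_ne_zero _ hn)]
  · rw [muParam, if_pos h, rhoC] at hμ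
    have hm : ((-μ : ℤ) : ℝ) = -|lam| - rho p 1 := by
      push_cast; rw [hμ, abs_of_pos h]; norm_num; ring
    -- Here `-μ = -|λ| - ρ`. Since the product of the two conjugate coordinates is `‖y‖²`, the
    -- function is a power of the conjugate one.
    refine key (-1) (-μ) (by norm_num) (by rw [hm]; ring) fun x hx => ?_
    have hn : (‖negPart p 1 x‖ : ℂ) ≠ 0 := by exact_mod_cast norm_ne_zero_iff.2 hx
    have h1 := planeCoord_mul (negPart p 1 x)
    have h2 := planeCoord_ne_zero (σ := -1) (by norm_num) hx
    rw [generatingFunction_one, ← hm, Real.rpow_intCast, Complex.ofReal_zpow,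
      (eq_div_iff h2).2 h1, ← inv_zpow', ← inv_zpow', ← mul_zpow]
    congr 1
    field_simp

/-- The vanishing of the Radon transform for `q > 1`. -/
theorem radon_eq_zero_of_one_lt {p q : ℕ} (hp : 1 ≤ p) (hq : 1 < q) {lam : ℝ} (hlam : 0 < lam)
    {μ : ℤ} (hμ : (μ : ℝ) = muParam p q lam) (hμ0 : 0 < μ) {g : Mat p q}
    (hg : gᵀ * form p q * g = form p q) :
    RadonConverges p q (generatingFunction p q lam μ) g ∧
      radon p q (generatingFunction p q lam μ) g = 0 := by
  rw [muParam, if_pos hlam] at hμ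
  have hμr : (0 : ℝ) < μ := by exact_mod_cast hμ0
  have hmu : 0 < lam + ((p : ℝ) - q + 1) / 2 := by
    rw [hμ, rho, rhoC] at hμr; linarith
  have hn : ((μ.toNat : ℕ) : ℝ) = μ := by
    have : ((μ.toNat : ℕ) : ℤ) = μ := Int.toNat_of_nonneg hμ0.le
    exact_mod_cast this
  -- Kelvin inversion of a harmonic polynomial of degree `μ` on `ℝ^{q+1}` has degree `-(μ + q - 1)`,
  -- which equals `-(λ + ρ)` by the definition of `μ_λ`.
  have hN : lam + rho p q = (μ.toNat : ℝ) + 2 * rhoC q := by rw [hn, hμ]; ring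
  set n := μ.toNat
  set l : Fin q ⊕ Unit := Sum.inr ()
  set T : ℝ →L[ℝ] ℂ := (gegenbauer (rhoC q) n 1)⁻¹ • Complex.ofRealCLM
  have hh := (isHarmonicOffZero_kelvin (κ := Fin q ⊕ Unit) l (ν := rhoC q)
    (by simp [rhoC]; ring) n).clm_comp T
  refine radon_eq_zero_of_harmonic hp hq.le hg hlam hmu
      (fun y hy => (hh.1 y hy).of_le two_le_infty) ?_
      (fun y hy => hh.sum_fderiv_fderiv hy) fun x _ => ?_
  · intro r hr y hy
    change T (kelvin (rhoC q) l n (r • y)) = r ^ (-(lam + rho p q)) • T (kelvin (rhoC q) l n y)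
    rw [hN, isHomogeneousNeg_kelvin (rhoC q) l n r hr y hy, map_smul]
  · rw [generatingFunction, dif_neg hq.ne', if_pos hμ0.le, ← norm_negPart,
      show -lam - rho p q = -((n : ℝ) + 2 * rhoC q) by rw [← hN]; ring]
    simp only [T, kelvin, zonal, _root_.smul_apply, Complex.ofRealCLM_apply, Complex.real_smul]
    rw [show lastCoord p q x = negPart p q x l from rfl]
    push_cast
    ring

end Hyperbolic

/-! ### Powers of the Laplace operator on powers of `1 + |x|²`, and integration over subspaces. -/

namespace Hyperbolic

open MeasureTheory Filter Topology Set
open scoped Matrix ContDiff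

section Radial

/-- The `m`-th power of the Laplace operator of a space of dimension `d`, applied to
`(1 + |x|²)^a`, as a function of `t = |x|²`. -/
noncomputable def lapPow (d : ℝ) : ℕ → ℝ → ℝ → ℝ
  | 0, a, t => (1 + t) ^ a
  | m + 1, a, t => 2 * a * (d + 2 * (a - 1)) * lapPow d m (a - 1) t -
      4 * a * (a - 1) * lapPow d m (a - 2) t

lemma contDiff_lapPow_norm_sq {V : Type*} [NormedAddCommGroup V] [InnerProductSpace ℝ V]
    (d : ℝ) (m : ℕ) (a : ℝ) : ContDiff ℝ ∞ fun x : V => lapPow d m a (‖x‖ ^ 2) := by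
  induction m generalizing a with
  | zero =>
    simp only [lapPow]
    exact ContDiff.rpow_const_of_ne (contDiff_const.add (contDiff_norm_sq ℝ))
      fun x => by positivity
  | succ m ih =>
    simp only [lapPow]
    exact (contDiff_const.mul (ih _)).sub (contDiff_const.mul (ih _))

/-- Each Laplacian lowers the growth by one power of `1 + t`; the term with exponent `a - 2` is even
smaller. -/
lemma exists_lapPow_bound (d : ℝ) (m : ℕ) (a : ℝ) :
    ∃ C, 0 ≤ C ∧ ∀ t, 0 ≤ t → |lapPow d m a t| ≤ C * (1 + t) ^ (a - m) := by
  induction m generalizing a with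
  | zero =>
    refine ⟨1, zero_le_one, fun t ht => ?_⟩
    simp only [lapPow, Nat.cast_zero, sub_zero, one_mul]
    rw [abs_of_nonneg (by positivity)]
  | succ m ih =>
    obtain ⟨C1, h1, hC1⟩ := ih (a - 1)
    obtain ⟨C2, h2, hC2⟩ := ih (a - 2)
    refine ⟨|2 * a * (d + 2 * (a - 1))| * C1 + |4 * a * (a - 1)| * C2, by positivity,
      fun t ht => ?_⟩
    simp only [lapPow]
    refine (abs_sub _ _).trans ?_
    rw [abs_mul (2 * a * (d + 2 * (a - 1))), abs_mul (4 * a * (a - 1)), add_mul]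
    have e1 : (1 + t) ^ (a - 1 - (m : ℝ)) = (1 + t) ^ (a - ((m + 1 : ℕ) : ℝ)) := by
      congr 1; push_cast; ring
    have e2 : (1 + t) ^ (a - 2 - (m : ℝ)) ≤ (1 + t) ^ (a - ((m + 1 : ℕ) : ℝ)) :=
      Real.rpow_le_rpow_of_exponent_le (by linarith) (by push_cast; linarith)
    have f1 := hC1 t ht
    have f2 := (hC2 t ht).trans (mul_le_mul_of_nonneg_left e2 h2)
    rw [e1] at f1
    refine add_le_add ?_ ?_
    · rw [mul_assoc |_| C1]; exact mul_le_mul_of_nonneg_left f1 (abs_nonneg _)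
    · rw [mul_assoc |_| C2]; exact mul_le_mul_of_nonneg_left f2 (abs_nonneg _)

variable {κ : Type*} [Fintype κ]

lemma laplacian_one_add_norm_sq_rpow (a : ℝ) (x : EuclideanSpace ℝ κ) :
    (Laplacian.laplacian (fun y : EuclideanSpace ℝ κ => ((1 + ‖y‖ ^ 2) ^ a : ℝ)) :
      EuclideanSpace ℝ κ → ℝ) x =
      2 * a * (Fintype.card κ + 2 * (a - 1)) * (1 + ‖x‖ ^ 2) ^ (a - 1) -
        4 * a * (a - 1) * (1 + ‖x‖ ^ 2) ^ (a - 2) := by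
  classical
  have hne : ∀ y : EuclideanSpace ℝ κ, 1 + ‖y‖ ^ 2 ≠ 0 := fun y => by positivity
  have hsm : ContDiff ℝ ∞ fun y : EuclideanSpace ℝ κ => (1 + ‖y‖ ^ 2) ^ a :=
    contDiff_lapPow_norm_sq 0 0 a
  rw [InnerProductSpace.laplacian_eq_iteratedFDeriv_orthonormalBasis _
    (EuclideanSpace.basisFun κ ℝ)]
  have h1 : ∀ k, iteratedFDeriv ℝ 2 (fun y : EuclideanSpace ℝ κ => (1 + ‖y‖ ^ 2) ^ a) x
      ![EuclideanSpace.basisFun κ ℝ k, EuclideanSpace.basisFun κ ℝ k] =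
      2 * a * (1 + ‖x‖ ^ 2) ^ (a - 1) +
        4 * a * (a - 1) * (1 + ‖x‖ ^ 2) ^ (a - 1 - 1) * x k ^ 2 := by
    intro k
    rw [iteratedFDeriv_two_apply]
    simp only [Matrix.cons_val_zero, Matrix.cons_val_one, EuclideanSpace.basisFun_apply]
    rw [← fderiv_fderiv_apply (hsm.contDiffAt.of_le two_le_infty)]
    have h2 : (fun y => fderiv ℝ (fun y : EuclideanSpace ℝ κ => (1 + ‖y‖ ^ 2) ^ a) y
        (EuclideanSpace.single k 1)) = fun y => 2 * a * ((1 + ‖y‖ ^ 2) ^ (a - 1) * y k) := by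
      ext y
      rw [(hasFDerivAt_norm_sq_rpow 1 a (hne y)).fderiv]
      simp [EuclideanSpace.inner_single_right]
      ring
    have h3 := ((hasFDerivAt_norm_sq_rpow 1 (a - 1) (hne x)).mul
      (EuclideanSpace.proj k : EuclideanSpace ℝ κ →L[ℝ] ℝ).hasFDerivAt).const_mul (2 * a)
    rw [h2]
    refine (congrArg (fun T : EuclideanSpace ℝ κ →L[ℝ] ℝ => T (EuclideanSpace.single k 1))
      h3.fderiv).trans ?_
    simp [EuclideanSpace.inner_single_right]
    ring
  beta_reduce
  rw [Finset.sum_congr rfl fun k _ => h1 k, Finset.sum_add_distrib,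
    ← Finset.mul_sum (f := fun k => x k ^ 2)]
  have h4 : ∑ k, x k ^ 2 = ‖x‖ ^ 2 := by rw [EuclideanSpace.norm_sq_eq]; simp
  rw [h4, show a - 2 = a - 1 - 1 by ring, Real.rpow_sub_one (hne x) (a - 1)]
  simp only [Finset.sum_const, Finset.card_univ, nsmul_eq_mul]
  have := hne x
  field_simp
  ring

/-- The recursion for `lapPow` applies the first Laplacian to the power itself, which keeps the
functions in a fixed explicit span. By linearity the last Laplacian may be peeled off instead. -/
lemma laplacian_lapPow (m : ℕ) (a : ℝ) :
    Laplacian.laplacian (fun x : EuclideanSpace ℝ κ => lapPow (Fintype.card κ) m a (‖x‖ ^ 2)) =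
      fun x => lapPow (Fintype.card κ) (m + 1) a (‖x‖ ^ 2) := by
  induction m generalizing a with
  | zero => ext x; simp only [lapPow]; exact laplacian_one_add_norm_sq_rpow a x
  | succ m ih =>
    ext x
    have hs : ∀ b, ContDiffAt ℝ 2 (fun x : EuclideanSpace ℝ κ =>
        lapPow (Fintype.card κ) m b (‖x‖ ^ 2)) x := fun b =>
      (contDiff_lapPow_norm_sq _ m b).contDiffAt.of_le two_le_infty
    have hs' : ∀ c b : ℝ, ContDiffAt ℝ 2 (c • fun x : EuclideanSpace ℝ κ =>
        lapPow (Fintype.card κ) m b (‖x‖ ^ 2)) x := fun c b => (hs b).const_smul c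
    have h1 : (fun x : EuclideanSpace ℝ κ => lapPow (Fintype.card κ) (m + 1) a (‖x‖ ^ 2)) =
        (2 * a * (Fintype.card κ + 2 * (a - 1))) •
          (fun x : EuclideanSpace ℝ κ => lapPow (Fintype.card κ) m (a - 1) (‖x‖ ^ 2)) -
        (4 * a * (a - 1)) •
          (fun x : EuclideanSpace ℝ κ => lapPow (Fintype.card κ) m (a - 2) (‖x‖ ^ 2)) := by
      ext x; simp [lapPow]
    rw [h1, ContDiffAt.laplacian_sub (hs' _ _) (hs' _ _),
      InnerProductSpace.laplacian_smul _ (hs _), InnerProductSpace.laplacian_smul _ (hs _), ih, ih]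
    simp only [lapPow, smul_eq_mul]

lemma iterate_laplacian (m : ℕ) (a : ℝ) :
    (fun h : EuclideanSpace ℝ κ → ℝ => Laplacian.laplacian h)^[m]
      (fun x => (1 + ‖x‖ ^ 2) ^ a) = fun x => lapPow (Fintype.card κ) m a (‖x‖ ^ 2) := by
  induction m with
  | zero => rfl
  | succ m ih => rw [Function.iterate_succ_apply', ih, laplacian_lapPow]

/-- The integral of `(1 + |x|²)^b` over a Euclidean space. -/
noncomputable def betaInt (V : Type*) [NormedAddCommGroup V] [MeasureSpace V] (b : ℝ) : ℝ :=
  ∫ x : V, (1 + ‖x‖ ^ 2) ^ b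

section Beta

variable {V : Type*} [NormedAddCommGroup V] [InnerProductSpace ℝ V] [FiniteDimensional ℝ V]
  [MeasurableSpace V] [BorelSpace V]

lemma integrable_one_add_norm_sq_rpow {b : ℝ} (hb : 2 * b < -(Module.finrank ℝ V : ℝ)) :
    Integrable fun x : V => (1 + ‖x‖ ^ 2) ^ b := by
  have := integrable_rpow_neg_one_add_norm_sq (E := V) (μ := volume) (r := -2 * b) (by linarith)
  convert this using 3
  ring

lemma betaInt_pos {b : ℝ} (hb : 2 * b < -(Module.finrank ℝ V : ℝ)) : 0 < betaInt V b := by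
  rw [betaInt, integral_pos_iff_support_of_nonneg (fun x => by positivity)
    (integrable_one_add_norm_sq_rpow hb)]
  have : Function.support (fun x : V => (1 + ‖x‖ ^ 2) ^ b) = univ := by
    ext x
    simpa using (Real.rpow_pos_of_pos (by positivity) b).ne'
  rw [this]
  exact Measure.measure_univ_pos.2 (NeZero.ne _)

lemma integral_add_norm_sq_rpow {c : ℝ} (hc : 0 < c) (b : ℝ) :
    ∫ x : V, (c + ‖x‖ ^ 2) ^ b = c ^ (b + Module.finrank ℝ V / 2) * betaInt V b := by
  have h := Measure.integral_comp_smul (volume : Measure V)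
    (fun x : V => (c + ‖x‖ ^ 2) ^ b) (√c)
  have h1 : ∀ x : V, (c + ‖√c • x‖ ^ 2) ^ b = c ^ b * (1 + ‖x‖ ^ 2) ^ b := fun x => by
    rw [norm_smul, Real.norm_of_nonneg (Real.sqrt_nonneg _), mul_pow, Real.sq_sqrt hc.le,
      ← Real.mul_rpow hc.le (by positivity)]
    congr 1; ring
  simp_rw [h1] at h
  rw [integral_const_mul, smul_eq_mul, abs_of_nonneg (by positivity)] at h
  have h2 : √c ^ Module.finrank ℝ V = c ^ ((Module.finrank ℝ V : ℝ) / 2) := by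
    rw [Real.sqrt_eq_rpow, ← Real.rpow_natCast, ← Real.rpow_mul hc.le]
    congr 1; ring
  rw [h2] at h
  have h3 : 0 < c ^ ((Module.finrank ℝ V : ℝ) / 2) := Real.rpow_pos_of_pos hc _
  rw [Real.rpow_add hc, betaInt, mul_right_comm, h]
  field_simp

/-- Integrate `x_k ∂_k (1 + |x|²)^a` by parts, sum over `k`, and write `|x|²` as `(1 + |x|²) - 1`.
The hypothesis makes `x_k (1 + |x|²)^a` integrable. -/
lemma betaInt_sub_one {a : ℝ} (ha : 2 * a + 1 < -(Module.finrank ℝ (EuclideanSpace ℝ κ) : ℝ)) :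
    a * betaInt (EuclideanSpace ℝ κ) (a - 1) =
      (a + Fintype.card κ / 2) * betaInt (EuclideanSpace ℝ κ) a := by
  classical
  have hne : ∀ y : EuclideanSpace ℝ κ, 1 + ‖y‖ ^ 2 ≠ 0 := fun y => by positivity
  have hi : Integrable fun x : EuclideanSpace ℝ κ => (1 + ‖x‖ ^ 2) ^ a :=
    integrable_one_add_norm_sq_rpow (by linarith)
  have hi1 : Integrable fun x : EuclideanSpace ℝ κ => (1 + ‖x‖ ^ 2) ^ (a - 1) :=
    integrable_one_add_norm_sq_rpow (by linarith)
  have hi2 : Integrable fun x : EuclideanSpace ℝ κ => (1 + ‖x‖ ^ 2) ^ (a + 1 / 2) :=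
    integrable_one_add_norm_sq_rpow (by linarith)
  have hc : ∀ b : ℝ, Continuous fun x : EuclideanSpace ℝ κ => (1 + ‖x‖ ^ 2) ^ b := fun b =>
    Continuous.rpow_const (by fun_prop) fun x => Or.inl (hne x)
  have hk : ∀ (x : EuclideanSpace ℝ κ) k, x k ^ 2 ≤ 1 + ‖x‖ ^ 2 := fun x k => by
    have h1 : ∑ k, x k ^ 2 = ‖x‖ ^ 2 := by rw [EuclideanSpace.norm_sq_eq]; simp
    have h2 := Finset.single_le_sum (f := fun k => x k ^ 2) (fun i _ => sq_nonneg (x i))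
      (Finset.mem_univ k)
    simp only at h2
    linarith
  have hi3 : ∀ k, Integrable fun x : EuclideanSpace ℝ κ => x k ^ 2 * (1 + ‖x‖ ^ 2) ^ (a - 1) := by
    intro k
    refine Integrable.mono' hi ((by fun_prop : Continuous fun x : EuclideanSpace ℝ κ =>
      x k ^ 2).mul (hc _)).aestronglyMeasurable (Eventually.of_forall fun x => ?_)
    rw [Real.norm_of_nonneg (by positivity)]
    calc _ ≤ (1 + ‖x‖ ^ 2) * (1 + ‖x‖ ^ 2) ^ (a - 1) := by gcongr; exact hk x k
      _ = _ := by rw [Real.rpow_sub_one (hne x)]; field_simp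
  have hi4 : ∀ k, Integrable fun x : EuclideanSpace ℝ κ => x k * (1 + ‖x‖ ^ 2) ^ a := by
    intro k
    refine Integrable.mono' hi2 ((by fun_prop : Continuous fun x : EuclideanSpace ℝ κ =>
      x k).mul (hc _)).aestronglyMeasurable (Eventually.of_forall fun x => ?_)
    rw [norm_mul, Real.norm_of_nonneg (Real.rpow_nonneg (by positivity) a),
      Real.rpow_add (by positivity), mul_comm, ← Real.sqrt_eq_rpow]
    gcongr
    exact Real.abs_le_sqrt (hk x k)
  have hfd : ∀ (x : EuclideanSpace ℝ κ) k, fderiv ℝ (fun x : EuclideanSpace ℝ κ =>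
      (1 + ‖x‖ ^ 2) ^ a) x (EuclideanSpace.single k 1) =
      2 * a * ((1 + ‖x‖ ^ 2) ^ (a - 1) * x k) := by
    intro x k
    rw [(hasFDerivAt_norm_sq_rpow 1 a (hne x)).fderiv]
    simp [EuclideanSpace.inner_single_right]
    ring
  have hfd2 : ∀ (x : EuclideanSpace ℝ κ) k, fderiv ℝ (fun x : EuclideanSpace ℝ κ => x k) x
      (EuclideanSpace.single k 1) = 1 := by
    intro x k
    have h := (EuclideanSpace.proj k : EuclideanSpace ℝ κ →L[ℝ] ℝ).hasFDerivAt (x := x)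
    refine (congrArg (fun T : EuclideanSpace ℝ κ →L[ℝ] ℝ => T (EuclideanSpace.single k 1))
      h.fderiv).trans ?_
    simp
  have hparts : ∀ k, 2 * a * ∫ x : EuclideanSpace ℝ κ, x k ^ 2 * (1 + ‖x‖ ^ 2) ^ (a - 1) =
      -betaInt (EuclideanSpace ℝ κ) a := by
    intro k
    have hmul : ∀ x : EuclideanSpace ℝ κ, x k * (2 * a * ((1 + ‖x‖ ^ 2) ^ (a - 1) * x k)) =
        2 * a * (x k ^ 2 * (1 + ‖x‖ ^ 2) ^ (a - 1)) := fun x => by ring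
    have h := integral_mul_fderiv_eq_neg_fderiv_mul_of_integrable
      (μ := (volume : Measure (EuclideanSpace ℝ κ))) (f := fun x => x k)
      (g := fun x => (1 + ‖x‖ ^ 2) ^ a) (v := EuclideanSpace.single k 1)
      (by simp_rw [hfd2, one_mul]; exact hi)
      (by simp_rw [hfd, hmul]; exact (hi3 k).const_mul _)
      (hi4 k)
      (fun x _ => (EuclideanSpace.proj k : EuclideanSpace ℝ κ →L[ℝ] ℝ).differentiableAt)
      (fun x _ => (hasFDerivAt_norm_sq_rpow 1 a (hne x)).differentiableAt)
    simp_rw [hfd, hfd2, one_mul, hmul, integral_const_mul] at h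
    exact h
  have hsum := Finset.sum_congr (rfl : (Finset.univ : Finset κ) = _) fun k _ => hparts k
  rw [← Finset.mul_sum, ← integral_finsetSum _ fun k _ => hi3 k] at hsum
  have hrw : ∀ x : EuclideanSpace ℝ κ, ∑ k, x k ^ 2 * (1 + ‖x‖ ^ 2) ^ (a - 1) =
      (1 + ‖x‖ ^ 2) ^ a - (1 + ‖x‖ ^ 2) ^ (a - 1) := by
    intro x
    have h4 : ∑ k, x k ^ 2 = ‖x‖ ^ 2 := by rw [EuclideanSpace.norm_sq_eq]; simp
    have := hne x
    rw [← Finset.sum_mul, h4, Real.rpow_sub_one (hne x)]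
    field_simp
    ring
  simp_rw [hrw] at hsum
  rw [integral_sub hi hi1] at hsum
  simp only [Finset.sum_const, Finset.card_univ, nsmul_eq_mul] at hsum
  unfold betaInt at hsum ⊢
  linear_combination -hsum / 2

end Beta

/-- Integration over a subspace turns powers of the Laplace operator into derivatives in the
remaining variable. -/
lemma integral_lapPow (m : ℕ) {a : ℝ}
    (ha : 2 * a + 1 < -(Module.finrank ℝ (EuclideanSpace ℝ κ) : ℝ)) (t : ℝ) (ht : 0 ≤ t) :
    Integrable (fun x : EuclideanSpace ℝ κ => lapPow (Fintype.card κ + 1) m a (t + ‖x‖ ^ 2)) ∧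
    ∫ x : EuclideanSpace ℝ κ, lapPow (Fintype.card κ + 1) m a (t + ‖x‖ ^ 2) =
      betaInt (EuclideanSpace ℝ κ) a * lapPow 1 m (a + Fintype.card κ / 2) t := by
  induction m generalizing a with
  | zero =>
    simp only [lapPow]
    constructor
    · refine Integrable.mono' (integrable_one_add_norm_sq_rpow (b := a) (by linarith))
        (Continuous.aestronglyMeasurable (Continuous.rpow_const (by fun_prop)
          fun x => Or.inl (by positivity))) (Eventually.of_forall fun x => ?_)
      rw [Real.norm_of_nonneg (by positivity)]
      have : (0 : ℝ) ≤ Module.finrank ℝ (EuclideanSpace ℝ κ) := by positivity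
      exact Real.rpow_le_rpow_of_nonpos (by positivity) (by linarith) (by linarith)
    · simp_rw [← add_assoc]
      rw [integral_add_norm_sq_rpow (by positivity), finrank_euclideanSpace, mul_comm]
  | succ m ih =>
    obtain ⟨i1, e1⟩ := ih (a := a - 1) (by linarith)
    obtain ⟨i2, e2⟩ := ih (a := a - 2) (by linarith)
    simp only [lapPow]
    refine ⟨(i1.const_mul _).sub (i2.const_mul _), ?_⟩
    rw [integral_sub (i1.const_mul _) (i2.const_mul _), integral_const_mul, integral_const_mul,
      e1, e2, show a - 1 + (Fintype.card κ : ℝ) / 2 = a + Fintype.card κ / 2 - 1 by ring,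
      show a - 2 + (Fintype.card κ : ℝ) / 2 = a + Fintype.card κ / 2 - 2 by ring]
    -- Integration over `ℝ^d` shifts the exponent by `d/2`; two uses of the recursion for `betaInt`
    -- change the coefficients in dimension `d + 1` into those in dimension `1`.
    have b1 := betaInt_sub_one ha
    have b2 := betaInt_sub_one (κ := κ) (a := a - 1) (by linarith)
    rw [show a - 1 - 1 = a - 2 by ring] at b2
    set A := lapPow 1 m (a + Fintype.card κ / 2 - 1) t
    set B := lapPow 1 m (a + Fintype.card κ / 2 - 2) t
    linear_combination (2 * (Fintype.card κ + 1 + 2 * (a - 1)) * A -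
      4 * (a - 1 + Fintype.card κ / 2) * B) * b1 - 4 * a * B * b2

end Radial

end Hyperbolic

/-! ### One-variable integrals. -/

namespace Hyperbolic

open MeasureTheory Filter Topology Set
open scoped Matrix ContDiff

section OneVariable

/-- The `i`-th derivative of `(1 + x²)^a`. -/
noncomputable def derivPow : ℕ → ℝ → ℝ → ℝ
  | 0, a, x => (1 + x ^ 2) ^ a
  | 1, a, x => 2 * a * x * (1 + x ^ 2) ^ (a - 1)
  | i + 2, a, x => 2 * a * (2 * a - 1) * derivPow i (a - 1) x -
      4 * a * (a - 1) * derivPow i (a - 2) x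

lemma hasDerivAt_derivPow (i : ℕ) (a x : ℝ) :
    HasDerivAt (derivPow i a) (derivPow (i + 1) a x) x := by
  have hne : ∀ x : ℝ, 1 + x ^ 2 ≠ 0 := fun x => by positivity
  have h0 : ∀ a, HasDerivAt (derivPow 0 a) (derivPow 1 a x) x := fun a => by
    have := ((hasDerivAt_pow 2 x).const_add 1).rpow_const (p := a) (Or.inl (hne x))
    refine this.congr_deriv ?_
    simp only [derivPow]
    push_cast
    ring
  induction i using Nat.twoStepInduction generalizing a with
  | zero => exact h0 a
  | one =>
    have h := ((hasDerivAt_id x).const_mul (2 * a)).mul (h0 (a - 1))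
    refine h.congr_deriv ?_
    simp only [derivPow, id]
    rw [show a - 2 = a - 1 - 1 by ring, Real.rpow_sub_one (hne x) (a - 1)]
    have := hne x
    field_simp
    ring
  | more i ih _ => exact ((ih (a - 1)).const_mul _).sub ((ih (a - 2)).const_mul _)

lemma continuous_derivPow (i : ℕ) (a : ℝ) : Continuous (derivPow i a) :=
  continuous_iff_continuousAt.2 fun x => (hasDerivAt_derivPow i a x).continuousAt

/-- In dimension one, where the Laplacian is the second derivative, the two recursions agree. -/
lemma derivPow_two_mul (m : ℕ) (a x : ℝ) : derivPow (2 * m) a x = lapPow 1 m a (x ^ 2) := by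
  induction m generalizing a with
  | zero => rfl
  | succ m ih =>
    rw [show 2 * (m + 1) = 2 * m + 2 by ring, derivPow, lapPow, ih, ih]
    ring

lemma exists_derivPow_bound (i : ℕ) (a : ℝ) :
    ∃ C, 0 ≤ C ∧ ∀ x, |derivPow i a x| ≤ C * (1 + x ^ 2) ^ (a - i / 2) := by
  induction i using Nat.twoStepInduction generalizing a with
  | zero =>
    refine ⟨1, zero_le_one, fun x => ?_⟩
    rw [derivPow, abs_of_nonneg (by positivity)]
    simp
  | one =>
    refine ⟨|2 * a|, abs_nonneg _, fun x => ?_⟩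
    have h : |x| ≤ (1 + x ^ 2) ^ (1 / 2 : ℝ) := by
      rw [← Real.sqrt_eq_rpow]
      exact Real.abs_le_sqrt (by linarith)
    rw [derivPow, abs_mul, abs_mul _ x, mul_assoc,
      abs_of_nonneg (a := (1 + x ^ 2) ^ (a - 1)) (by positivity)]
    refine mul_le_mul_of_nonneg_left ?_ (abs_nonneg _)
    calc _ ≤ (1 + x ^ 2) ^ (1 / 2 : ℝ) * (1 + x ^ 2) ^ (a - 1) := by gcongr
      _ = _ := by rw [← Real.rpow_add (by positivity)]; congr 1; push_cast; ring
  | more i ih _ =>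
    obtain ⟨C1, h1, hC1⟩ := ih (a - 1)
    obtain ⟨C2, h2, hC2⟩ := ih (a - 2)
    refine ⟨|2 * a * (2 * a - 1)| * C1 + |4 * a * (a - 1)| * C2, by positivity, fun x => ?_⟩
    have hx := sq_nonneg x
    rw [derivPow]
    refine (abs_sub _ _).trans ?_
    rw [abs_mul (2 * a * (2 * a - 1)), abs_mul (4 * a * (a - 1)), add_mul]
    have e1 : (1 + x ^ 2) ^ (a - 1 - (i : ℝ) / 2) =
        (1 + x ^ 2) ^ (a - ((i + 2 : ℕ) : ℝ) / 2) := by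
      congr 1; push_cast; ring
    have e2 : (1 + x ^ 2) ^ (a - 2 - (i : ℝ) / 2) ≤
        (1 + x ^ 2) ^ (a - ((i + 2 : ℕ) : ℝ) / 2) :=
      Real.rpow_le_rpow_of_exponent_le (by linarith) (by push_cast; linarith)
    have f1 := hC1 x
    have f2 := (hC2 x).trans (mul_le_mul_of_nonneg_left e2 h2)
    rw [e1] at f1
    refine add_le_add ?_ ?_
    · rw [mul_assoc |_| C1]; exact mul_le_mul_of_nonneg_left f1 (abs_nonneg _)
    · rw [mul_assoc |_| C2]; exact mul_le_mul_of_nonneg_left f2 (abs_nonneg _)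

lemma derivPow_isBigO (i : ℕ) {a : ℝ} (ha : a ≤ 0) (S : ℝ) :
    (fun τ => derivPow i a (S - τ)) =O[atTop] fun τ => τ ^ (-(i - 2 * a)) := by
  obtain ⟨C, hC, hb⟩ := exists_derivPow_bound i a
  have hi : (0 : ℝ) ≤ i := by positivity
  refine Asymptotics.IsBigO.of_bound (C * (2 + 2 * S ^ 2) ^ (i / 2 - a)) ?_
  filter_upwards [eventually_gt_atTop 0] with τ hτ
  have h1 : τ ^ 2 ≤ (2 + 2 * S ^ 2) * (1 + (S - τ) ^ 2) := by
    nlinarith [sq_nonneg (τ - 2 * S), sq_nonneg (S * (S - τ))]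
  have h2 := rpow_neg_le_of_le (r := i / 2 - a) (by positivity) (by positivity) (by linarith) h1
  have h3 : (τ ^ 2) ^ (-((i : ℝ) / 2 - a)) = τ ^ (-(i - 2 * a)) := by
    rw [← Real.rpow_natCast, ← Real.rpow_mul hτ.le]
    congr 1; push_cast; ring
  rw [h3] at h2
  rw [Real.norm_of_nonneg (Real.rpow_nonneg hτ.le _), mul_assoc]
  refine (hb _).trans (mul_le_mul_of_nonneg_left ?_ hC)
  rwa [show a - (i : ℝ) / 2 = -(i / 2 - a) by ring]

lemma integrableOn_rpow_mul_derivPow (i : ℕ) {a α : ℝ} (ha : a ≤ 0) (S : ℝ) (h1 : -1 < α)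
    (h2 : α + 1 < i - 2 * a) :
    IntegrableOn (fun τ => τ ^ α * derivPow i a (S - τ)) (Ioi 0) := by
  have hc : Continuous fun τ => derivPow i a (S - τ) :=
    (continuous_derivPow i a).comp (continuous_const.sub continuous_id)
  have h := mellin_convergent_of_isBigO_scalar (s := α + 1) (b := 0)
    (hc.locallyIntegrable.locallyIntegrableOn _) (derivPow_isBigO i ha S) h2 (by
      simp only [neg_zero, Real.rpow_zero]
      exact (hc.tendsto 0).isBigO_one ℝ |>.mono nhdsWithin_le_nhds) (by linarith)
  simpa using h

/-- The fractional integrals of the derivatives of `(1 + x²)^a`. -/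
noncomputable def fracInt (a S : ℝ) (i : ℕ) (α : ℝ) : ℝ :=
  ∫ τ in Ioi 0, τ ^ α * derivPow i a (S - τ)

/-- Integration by parts in `τ`. The boundary term vanishes at `0` because `α > 0`, and at infinity
because the derivative decays of order `i - 2a > α`. -/
lemma fracInt_succ (i : ℕ) {a α : ℝ} (ha : a ≤ 0) (S : ℝ) (h1 : 0 < α) (h2 : α < i - 2 * a) :
    fracInt a S (i + 1) α = α * fracInt a S i (α - 1) := by
  have hd : ∀ τ, HasDerivAt (fun τ => -derivPow i a (S - τ)) (derivPow (i + 1) a (S - τ)) τ := by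
    intro τ
    have h := ((hasDerivAt_derivPow i a (S - τ)).comp τ ((hasDerivAt_id τ).const_sub S)).neg
    refine h.congr_deriv ?_
    simp
  have hint := integrableOn_rpow_mul_derivPow i (α := α - 1) ha S (by linarith) (by linarith)
  have hc : Continuous fun τ => derivPow i a (S - τ) :=
    (continuous_derivPow i a).comp (continuous_const.sub continuous_id)
  have h := integral_Ioi_mul_deriv_eq_deriv_mul (a := 0) (u := fun τ => τ ^ α)
    (v := fun τ => -derivPow i a (S - τ)) (u' := fun τ => α * τ ^ (α - 1))
    (v' := fun τ => derivPow (i + 1) a (S - τ)) (a' := 0) (b' := 0)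
    (fun τ hτ => Real.hasDerivAt_rpow_const (Or.inl (ne_of_gt hτ))) (fun τ _ => hd τ)
    (integrableOn_rpow_mul_derivPow (i + 1) ha S (by linarith) (by push_cast; linarith))
    (by
      refine Integrable.congr (hint.const_mul (-α)) (Eventually.of_forall fun τ => ?_)
      simp only [Pi.mul_apply]; ring)
    (by
      have := (Real.continuousAt_rpow_const 0 α (Or.inr h1.le)).tendsto.mul (hc.neg.tendsto 0)
      rw [Real.zero_rpow h1.ne', zero_mul] at this
      exact this.mono_left nhdsWithin_le_nhds)
    (by
      have hO : (fun τ : ℝ => τ ^ α * -derivPow i a (S - τ)) =O[atTop]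
          fun τ => τ ^ α * τ ^ (-((i : ℝ) - 2 * a)) :=
        (Asymptotics.isBigO_refl _ _).mul (derivPow_isBigO i ha S).neg_left
      refine hO.trans_tendsto ?_
      have : Tendsto (fun τ : ℝ => τ ^ (-((i : ℝ) - 2 * a - α))) atTop (𝓝 0) :=
        tendsto_rpow_neg_atTop (by linarith)
      refine this.congr' ?_
      filter_upwards [eventually_gt_atTop 0] with τ hτ
      rw [← Real.rpow_add hτ]
      congr 1; ring)
  rw [fracInt, h, fracInt, ← integral_const_mul, sub_self, zero_sub, ← integral_neg]
  refine integral_congr_ae (Eventually.of_forall fun τ => ?_)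
  simp only
  ring

lemma fracInt_add (i : ℕ) {a α : ℝ} (ha : a ≤ 0) (S : ℝ) (h1 : -1 < α) (h2 : α + 1 < -(2 * a)) :
    fracInt a S i (α + i) = (∏ j ∈ Finset.range i, (α + j + 1)) * fracInt a S 0 α := by
  induction i with
  | zero => simp
  | succ i ih =>
    have hi : (0 : ℝ) ≤ i := by positivity
    rw [fracInt_succ i ha S (by push_cast; linarith) (by push_cast; linarith),
      Finset.prod_range_succ, Nat.cast_succ, show α + ((i : ℝ) + 1) - 1 = α + i by ring, ih]
    ring

lemma one_add_sinh_sub_sq (s τ : ℝ) :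
    1 + (Real.sinh s - τ) ^ 2 = τ ^ 2 - 2 * Real.sinh s * τ + Real.cosh s ^ 2 := by
  linear_combination -Real.cosh_sq_sub_sinh_sq s

/-- The effect of the inversion `τ ↦ cosh² s / τ`. -/
lemma cosh_mul_fracInt (lam s : ℝ) :
    Real.cosh s * fracInt (-lam - 1 / 2) (Real.sinh s) 0 (lam - 1) =
      fracInt (-lam - 1 / 2) (Real.sinh s) 0 lam := by
  set c := Real.cosh s with hc
  have hc0 : 0 < c := Real.cosh_pos s
  have himg : (fun σ : ℝ => c ^ 2 / σ) '' Ioi 0 = Ioi 0 := by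
    ext x
    simp only [mem_image, mem_Ioi]
    constructor
    · rintro ⟨σ, hσ, rfl⟩; positivity
    · intro hx; exact ⟨c ^ 2 / x, by positivity, by field_simp⟩
  have h := integral_image_eq_integral_abs_deriv_smul (s := Ioi (0 : ℝ)) (f := fun σ => c ^ 2 / σ)
    (f' := fun σ => -(c ^ 2 / σ ^ 2)) measurableSet_Ioi
    (fun σ hσ => by
      have hσ' : σ ≠ 0 := ne_of_gt hσ
      refine HasDerivAt.hasDerivWithinAt ?_
      refine ((hasDerivAt_inv hσ').const_mul (c ^ 2)).congr_deriv ?_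
      field_simp)
    (fun σ hσ τ hτ hst => by
      have h1 : σ ≠ 0 := ne_of_gt hσ
      have h2 : τ ≠ 0 := ne_of_gt hτ
      simp only at hst
      field_simp at hst
      exact hst.symm)
    (fun τ => τ ^ (lam - 1) * derivPow 0 (-lam - 1 / 2) (Real.sinh s - τ))
  rw [himg] at h
  rw [fracInt, h, fracInt, ← integral_const_mul]
  refine setIntegral_congr_fun measurableSet_Ioi fun σ hσ => ?_
  have hσ' : 0 < σ := hσ
  have hQ : 0 < σ ^ 2 - 2 * Real.sinh s * σ + c ^ 2 := by
    rw [hc, ← one_add_sinh_sub_sq]; positivity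
  simp only [derivPow, one_add_sinh_sub_sq, ← hc, smul_eq_mul]
  -- The quadratic `Q(τ) = τ² - 2τ sinh s + cosh² s` reproduces itself under the inversion: `Q(c²/σ)
  -- = (c²/σ²) Q(σ)`.
  rw [abs_neg, abs_of_pos (by positivity),
    show (c ^ 2 / σ) ^ 2 - 2 * Real.sinh s * (c ^ 2 / σ) + c ^ 2 =
      (c ^ 2 / σ ^ 2) * (σ ^ 2 - 2 * Real.sinh s * σ + c ^ 2) by field_simp; ring,
    Real.mul_rpow (by positivity) hQ.le]
  have e : c * (c ^ 2 / σ ^ 2 * ((c ^ 2 / σ) ^ (lam - 1) * (c ^ 2 / σ ^ 2) ^ (-lam - 1 / 2))) =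
      σ ^ lam := by
    refine Real.log_injOn_pos (by simp only [mem_Ioi]; positivity)
      (by simp only [mem_Ioi]; positivity) ?_
    rw [Real.log_mul (by positivity) (by positivity), Real.log_mul (by positivity) (by positivity),
      Real.log_mul (by positivity) (by positivity), Real.log_rpow (by positivity),
      Real.log_rpow (by positivity), Real.log_rpow (by positivity),
      Real.log_div (by positivity) (by positivity), Real.log_div (by positivity) (by positivity),
      Real.log_pow, Real.log_pow]
    push_cast
    ring
  linear_combination (σ ^ 2 - 2 * Real.sinh s * σ + c ^ 2) ^ (-lam - 1 / 2) * e

lemma hasDerivAt_sqrt_sub (c : ℝ) {τ : ℝ} (hτ : 0 < τ) :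
    HasDerivAt (fun τ => √τ - c / √τ) (1 / (2 * √τ) * (1 + c / τ)) τ := by
  have hs : 0 < √τ := Real.sqrt_pos.2 hτ
  have h := (Real.hasDerivAt_sqrt hτ.ne').sub
    (((Real.hasDerivAt_sqrt hτ.ne').inv hs.ne').const_mul c)
  refine h.congr_deriv ?_
  rw [Real.sq_sqrt hτ.le]
  field_simp
  ring

lemma image_sqrt_sub {c : ℝ} (hc : 0 < c) : (fun τ => √τ - c / √τ) '' Ioi 0 = univ := by
  refine eq_univ_of_forall fun v => ?_
  have h1 : |v| < √(v ^ 2 + 4 * c) := by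
    rw [← Real.sqrt_sq_eq_abs]
    exact Real.sqrt_lt_sqrt (sq_nonneg v) (by linarith)
  have h2 := Real.sq_sqrt (show 0 ≤ v ^ 2 + 4 * c by positivity)
  have hx : 0 < (v + √(v ^ 2 + 4 * c)) / 2 := by linarith [neg_abs_le v]
  -- The preimage of `v` is the square of the positive root of `x² - v x - c = 0`.
  refine ⟨((v + √(v ^ 2 + 4 * c)) / 2) ^ 2, by simp only [mem_Ioi]; positivity, ?_⟩
  simp only
  rw [Real.sqrt_sq hx.le]
  rw [sub_eq_iff_eq_add, ← sub_eq_iff_eq_add', eq_div_iff hx.ne']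
  linear_combination h2 / 4

lemma injOn_sqrt_sub {c : ℝ} (hc : 0 < c) : InjOn (fun τ => √τ - c / √τ) (Ioi 0) := by
  refine StrictMonoOn.injOn fun σ hσ τ hτ hst => ?_
  have h1 : 0 < √σ := Real.sqrt_pos.2 hσ
  have h2 : √σ < √τ := Real.sqrt_lt_sqrt (le_of_lt hσ) hst
  have h3 : c / √τ < c / √σ := div_lt_div_of_pos_left hc h1 h2
  change √σ - c / √σ < √τ - c / √τ
  linarith

/-- With `c = cosh s` and `v = √τ - c/√τ` one has `1 + (sinh s - τ)² = τ (v² + 2e^{-s})`. The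
Jacobian `(1 + c/τ)/(2√τ)` turns `∫ (2e^{-s} + v²)^{-λ-1/2} dv` into the mean of two integrals,
which `cosh_mul_fracInt` identifies. The integral over `v` scales like `(2e^{-s})^{-λ}`. -/
lemma fracInt_zero {lam : ℝ} (hlam : 0 < lam) (s : ℝ) :
    fracInt (-lam - 1 / 2) (Real.sinh s) 0 lam =
      2 ^ (-lam) * betaInt ℝ (-lam - 1 / 2) * Real.exp (lam * s) := by
  set c := Real.cosh s with hc
  have hc0 : 0 < c := Real.cosh_pos s
  have hd : 0 < 2 * Real.exp (-s) := by positivity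
  have h := integral_image_eq_integral_abs_deriv_smul (s := Ioi (0 : ℝ)) measurableSet_Ioi
    (fun τ hτ => (hasDerivAt_sqrt_sub c hτ).hasDerivWithinAt) (injOn_sqrt_sub hc0)
    (fun v : ℝ => (2 * Real.exp (-s) + ‖v‖ ^ 2) ^ (-lam - 1 / 2))
  rw [image_sqrt_sub hc0, setIntegral_univ, integral_add_norm_sq_rpow hd] at h
  have i1 := integrableOn_rpow_mul_derivPow 0 (a := -lam - 1 / 2) (α := lam) (by linarith)
    (Real.sinh s) (by linarith) (by push_cast; linarith)
  have i2 := integrableOn_rpow_mul_derivPow 0 (a := -lam - 1 / 2) (α := lam - 1) (by linarith)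
    (Real.sinh s) (by linarith) (by push_cast; linarith)
  have key : ∫ τ in Ioi 0, |1 / (2 * √τ) * (1 + c / τ)| •
      (2 * Real.exp (-s) + ‖√τ - c / √τ‖ ^ 2) ^ (-lam - 1 / 2) =
      1 / 2 * fracInt (-lam - 1 / 2) (Real.sinh s) 0 lam +
        1 / 2 * (c * fracInt (-lam - 1 / 2) (Real.sinh s) 0 (lam - 1)) := by
    rw [fracInt, fracInt, ← integral_const_mul, ← integral_const_mul, ← integral_const_mul,
      ← integral_add (i1.const_mul _) ((i2.const_mul _).const_mul _)]
    refine setIntegral_congr_fun measurableSet_Ioi fun τ hτ => ?_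
    have hτ' : 0 < τ := hτ
    have hs : 0 < √τ := Real.sqrt_pos.2 hτ'
    have hs2 := Real.sq_sqrt hτ'.le
    have hQ : 2 * Real.exp (-s) + (√τ - c / √τ) ^ 2 =
        (1 + (Real.sinh s - τ) ^ 2) * τ⁻¹ := by
      rw [one_add_sinh_sub_sq, ← Real.cosh_sub_sinh, ← hc, sub_sq, div_pow, hs2]
      field_simp
      ring
    simp only [derivPow, smul_eq_mul]
    rw [abs_of_pos (by positivity), Real.norm_eq_abs, sq_abs, hQ,
      Real.mul_rpow (by positivity) (by positivity), Real.inv_rpow hτ'.le,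
      ← Real.rpow_neg hτ'.le, show -(-lam - 1 / 2) = lam + 1 / 2 by ring, Real.rpow_add hτ',
      ← Real.sqrt_eq_rpow, Real.rpow_sub_one hτ'.ne']
    field_simp
  rw [key, cosh_mul_fracInt] at h
  have hr : (2 * Real.exp (-s)) ^ (-lam - 1 / 2 + (Module.finrank ℝ ℝ : ℝ) / 2) =
      2 ^ (-lam) * Real.exp (lam * s) := by
    rw [Module.finrank_self, Real.mul_rpow (by norm_num) (Real.exp_pos _).le, ← Real.exp_mul]
    congr 2
    · push_cast; ring
    · push_cast; ring
  rw [hr] at h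
  linarith

lemma exists_integral_lapPow_even (m : ℕ) {lam : ℝ} (hlam : 0 < lam) : ∃ A : ℝ, A ≠ 0 ∧ ∀ s : ℝ,
    ∫ τ in Ioi 0, τ ^ (lam + (2 * m : ℕ)) *
      lapPow 1 m (-lam - 1 / 2) ((Real.sinh s - τ) ^ 2) = A * Real.exp (lam * s) := by
  have hb : 0 < betaInt ℝ (-lam - 1 / 2) := betaInt_pos (by
    rw [Module.finrank_self]; push_cast; linarith)
  refine ⟨(∏ j ∈ Finset.range (2 * m), (lam + j + 1)) *
    (2 ^ (-lam) * betaInt ℝ (-lam - 1 / 2)), ?_, fun s => ?_⟩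
  · have : 0 < ∏ j ∈ Finset.range (2 * m), (lam + j + 1) :=
      Finset.prod_pos fun j _ => by positivity
    positivity
  · have h := fracInt_add (2 * m) (a := -lam - 1 / 2) (α := lam) (by linarith) (Real.sinh s)
      (by linarith) (by linarith)
    rw [fracInt_zero hlam] at h
    simp only [fracInt, derivPow_two_mul] at h
    rw [h]
    ring

/-- The two terms of `cosh s - τ` are integrated by parts `n + 1` times, down to the exponents `λ -
1` and `λ`, and `cosh_mul_fracInt` makes them comparable. Their products of factors differ by `λ -
(λ + n + 1) = -(n + 1)`, so they do not cancel. -/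
lemma exists_integral_lapPow_odd (m : ℕ) {lam : ℝ} (hlam : 0 < lam) : ∃ A : ℝ, A ≠ 0 ∧ ∀ s : ℝ,
    ∫ τ in Ioi 0, τ ^ (lam + (2 * m + 1 : ℕ)) * ((Real.cosh s - τ) *
      lapPow 1 (m + 1) (-lam - 1 / 2) ((Real.sinh s - τ) ^ 2)) = A * Real.exp (lam * s) := by
  have hb : 0 < betaInt ℝ (-lam - 1 / 2) := betaInt_pos (by
    rw [Module.finrank_self]; push_cast; linarith)
  set n := 2 * m + 1 with hn
  refine ⟨-(n + 1) * (∏ j ∈ Finset.range n, (lam + j + 1)) *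
    (2 ^ (-lam) * betaInt ℝ (-lam - 1 / 2)), ?_, fun s => ?_⟩
  · have : 0 < ∏ j ∈ Finset.range n, (lam + j + 1) :=
      Finset.prod_pos fun j _ => by positivity
    have h2 : -((n : ℝ) + 1) ≠ 0 := by
      have : (0 : ℝ) ≤ n := by positivity
      linarith
    exact mul_ne_zero (mul_ne_zero h2 this.ne') (by positivity)
  · have hn0 : (0 : ℝ) ≤ n := by positivity
    have h1 := fracInt_add (n + 1) (a := -lam - 1 / 2) (α := lam) (by linarith) (Real.sinh s)
      (by linarith) (by linarith)
    have h2 := fracInt_add (n + 1) (a := -lam - 1 / 2) (α := lam - 1) (by linarith) (Real.sinh s)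
      (by linarith) (by linarith)
    have i1 := integrableOn_rpow_mul_derivPow (n + 1) (a := -lam - 1 / 2) (α := lam + (n + 1 : ℕ))
      (by linarith) (Real.sinh s) (by push_cast; linarith) (by push_cast; linarith)
    have i2 := integrableOn_rpow_mul_derivPow (n + 1) (a := -lam - 1 / 2)
      (α := lam - 1 + (n + 1 : ℕ))
      (by linarith) (Real.sinh s) (by push_cast; linarith) (by push_cast; linarith)
    have h0 := cosh_mul_fracInt lam s
    rw [fracInt_zero hlam] at h0 h1
    have hprod : ∏ j ∈ Finset.range (n + 1), (lam - 1 + (j : ℝ) + 1) =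
        lam * ∏ j ∈ Finset.range n, (lam + j + 1) := by
      rw [Finset.prod_range_succ', mul_comm]
      congr 1
      · push_cast; ring
      · exact Finset.prod_congr rfl fun j _ => by push_cast; ring
    rw [hprod] at h2
    rw [Finset.prod_range_succ] at h1
    have hsplit : ∫ τ in Ioi 0, τ ^ (lam + (n : ℕ)) * ((Real.cosh s - τ) *
        lapPow 1 (m + 1) (-lam - 1 / 2) ((Real.sinh s - τ) ^ 2)) =
        Real.cosh s * fracInt (-lam - 1 / 2) (Real.sinh s) (n + 1) (lam - 1 + (n + 1 : ℕ)) -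
          fracInt (-lam - 1 / 2) (Real.sinh s) (n + 1) (lam + (n + 1 : ℕ)) := by
      rw [fracInt, fracInt, ← integral_const_mul, ← integral_sub (i2.const_mul _) i1]
      refine setIntegral_congr_fun measurableSet_Ioi fun τ hτ => ?_
      have hτ' : 0 < τ := hτ
      rw [show n + 1 = 2 * (m + 1) by omega, derivPow_two_mul, ← show n + 1 = 2 * (m + 1) by omega,
        show lam + ((n + 1 : ℕ) : ℝ) = lam + n + 1 by push_cast; ring,
        show lam - 1 + ((n + 1 : ℕ) : ℝ) = lam + n by push_cast; ring, Real.rpow_add_one hτ'.ne']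
      ring
    rw [hsplit, h1, h2]
    linear_combination (lam * ∏ j ∈ Finset.range n, (lam + j + 1)) * h0

end OneVariable

end Hyperbolic

/-! ### The Radon transform on the boosts for `μ_λ ≤ 0`. -/

namespace Hyperbolic

open MeasureTheory Filter Topology Set
open scoped Matrix ContDiff

lemma measurable_lapPow (d : ℝ) (m : ℕ) (a : ℝ) : Measurable (lapPow d m a) := by
  induction m generalizing a with
  | zero => exact (measurable_const.add measurable_id).pow_const a
  | succ m ih => exact ((ih _).const_mul _).sub ((ih _).const_mul _)

/-- Polar coordinates, followed by the substitution `v = b r²`. -/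
lemma integral_comp_mul_norm_sq {V : Type*} [NormedAddCommGroup V] [InnerProductSpace ℝ V]
    [FiniteDimensional ℝ V] [MeasurableSpace V] [BorelSpace V] [Nontrivial V] {b : ℝ} (hb : 0 < b)
    (F : ℝ → ℝ) :
    ∫ y : V, F (b * ‖y‖ ^ 2) = (Module.finrank ℝ V * (volume : Measure V).real (Metric.ball 0 1) /
      2) * b ^ (-(Module.finrank ℝ V / 2 : ℝ)) *
        ∫ v in Ioi 0, v ^ ((Module.finrank ℝ V : ℝ) / 2 - 1) * F v := by
  set d := Module.finrank ℝ V with hd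
  have hd1 : 1 ≤ d := Module.finrank_pos
  rw [integral_fun_norm_addHaar volume (fun r : ℝ => F (b * r ^ 2)), ← hd]
  have h1 := integral_comp_rpow_Ioi
    (fun u : ℝ => b ^ (1 - (d : ℝ) / 2) * ((b * u) ^ ((d : ℝ) / 2 - 1) * F (b * u)))
    (two_ne_zero (α := ℝ))
  rw [integral_const_mul,
    integral_comp_mul_left_Ioi (fun v => v ^ ((d : ℝ) / 2 - 1) * F v) 0 hb, mul_zero] at h1
  have h2 : ∫ r in Ioi (0 : ℝ), r ^ (d - 1) • F (b * r ^ 2) = 1 / 2 *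
      ∫ r in Ioi (0 : ℝ), (|(2 : ℝ)| * r ^ ((2 : ℝ) - 1)) • (b ^ (1 - (d : ℝ) / 2) *
        ((b * r ^ (2 : ℝ)) ^ ((d : ℝ) / 2 - 1) * F (b * r ^ (2 : ℝ)))) := by
    rw [← integral_const_mul]
    refine setIntegral_congr_fun measurableSet_Ioi fun r hr => ?_
    have hr' : 0 < r := hr
    have e1 : (b * r ^ 2) ^ ((d : ℝ) / 2 - 1) =
        b ^ ((d : ℝ) / 2 - 1) * r ^ ((d : ℝ) - 2) := by
      rw [Real.mul_rpow hb.le (by positivity), ← Real.rpow_natCast r 2, ← Real.rpow_mul hr'.le]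
      congr 2; push_cast; ring
    have e2 : r * r ^ ((d : ℝ) - 2) = r ^ (d - 1) := by
      nth_rw 1 [← Real.rpow_one r]
      rw [← Real.rpow_add hr', ← Real.rpow_natCast, Nat.cast_sub hd1]
      congr 1; push_cast; ring
    have e3 : b ^ (1 - (d : ℝ) / 2) * b ^ ((d : ℝ) / 2 - 1) = 1 := by
      rw [← Real.rpow_add hb]; simp
    simp only [smul_eq_mul]
    rw [show (2 : ℝ) - 1 = 1 by norm_num, Real.rpow_one, Real.rpow_two, e1, abs_two, ← e2]
    linear_combination (-(r * r ^ ((d : ℝ) - 2) * F (b * r ^ 2))) * e3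
  rw [h2, h1, show -((d : ℝ) / 2) = 1 - d / 2 - 1 by ring, Real.rpow_sub_one hb.ne']
  simp only [smul_eq_mul, nsmul_eq_mul]
  field_simp

section Boost

variable {p q : ℕ}

lemma boost_preserves_form (s : ℝ) : (boost p q s)ᵀ * form p q * boost p q s = form p q := by
  have h := Real.cosh_sq_sub_sinh_sq s
  rw [form_eq]
  ext ((i | i) | (i | i)) ((j | j) | (j | j)) <;>
    simp [boost, Matrix.fromBlocks, Matrix.mul_apply, Matrix.diagonal_apply, formSign,
      Fintype.sum_sum_type, Matrix.one_apply] <;> first | linarith | grind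

/-- The square of the length of the first `p` coordinates. -/
def posNormSq (p q : ℕ) (x : Idx p q → ℝ) : ℝ := ∑ i, x (Sum.inl i) ^ 2

lemma posNormSq_nonneg (x : Idx p q → ℝ) : 0 ≤ posNormSq p q x :=
  Finset.sum_nonneg fun _ _ => sq_nonneg _

lemma coshPart_sq_orbit {g : Mat p q} (hg : gᵀ * form p q * g = form p q)
    (w : Fin (max (p - 1) q) → ℝ) :
    coshPart p q (g *ᵥ orbitPoint p q 1 w) ^ 2 = 1 + posNormSq p q (g *ᵥ orbitPoint p q 1 w) := by
  have h := sum_formSign_mulVec hg (orbitPoint p q 1 w)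
  rw [sum_formSign_orbitPoint, Fintype.sum_sum_type] at h
  simp only [formSign, Sum.elim_inl, Sum.elim_inr, one_mul, neg_one_mul,
    Finset.sum_neg_distrib] at h
  rw [← norm_negPart, norm_negPart_sq, posNormSq]
  linarith

lemma abs_lastCoord_le (x : Idx p q → ℝ) : |lastCoord p q x| ≤ coshPart p q x := by
  rw [coshPart]
  exact Real.abs_le_sqrt (Finset.single_le_sum (f := fun k => x (Sum.inr k) ^ 2)
    (fun k _ => sq_nonneg _) (Finset.mem_univ (Sum.inr ())))

lemma phi_eq (hp : 1 ≤ p) (n m : ℕ) (x : Idx p q → ℝ) :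
    phi p q n m x = lapPow p m (n - rhoC q) (posNormSq p q x) := by
  rw [phi, iterate_laplacian]
  have hc : Fintype.card (Unit ⊕ Fin (p - 1)) = p := by simp; omega
  simp only [hc, EuclideanSpace.norm_sq_eq, posNormSq, Real.norm_eq_abs, sq_abs]

/-- The entries of `u` cancel against those of `v`; what remains are the `q - p + 1` further entries
of `v`, with negative sign. -/
lemma sum_signCoef_mul_sq (hpq : p - 1 < q) (w : Fin (max (p - 1) q) → ℝ) :
    ∑ j, signCoef p q j * w j ^ 2 =
      -‖(splitEquiv (fun j : Fin (max (p - 1) q) => (j : ℕ) < p - 1) w).2‖ ^ 2 := by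
  rw [norm_splitEquiv_snd,
    ← Fintype.sum_subtype_add_sum_subtype (fun j : Fin (max (p - 1) q) => (j : ℕ) < p - 1),
    Finset.sum_eq_zero, zero_add, ← Finset.sum_neg_distrib]
  · refine Finset.sum_congr rfl fun j _ => ?_
    have h1 := j.1.2
    have h2 := j.2
    rw [signCoef, if_neg h2, if_pos (by omega)]
    ring
  · intro j _
    have h2 := j.2
    rw [signCoef, if_pos h2, if_pos (by omega)]
    ring

lemma sum_sq_uPart (w : Fin (max (p - 1) q) → ℝ) : ∑ i, uPart p q w i ^ 2 =
    ‖(splitEquiv (fun j : Fin (max (p - 1) q) => (j : ℕ) < p - 1) w).1‖ ^ 2 := by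
  rw [norm_splitEquiv_fst, sum_uPart p q (· ^ 2),
    ← Fintype.sum_subtype_add_sum_subtype (fun j : Fin (max (p - 1) q) => (j : ℕ) < p - 1)]
  rw [Finset.sum_congr rfl fun (j : {j : Fin (max (p - 1) q) // (j : ℕ) < p - 1}) _ => if_pos j.2,
    Finset.sum_congr rfl fun (j : {j : Fin (max (p - 1) q) // ¬(j : ℕ) < p - 1}) _ => if_neg j.2]
  simp

lemma lastCoord_boost (hpq : p - 1 < q) (s : ℝ) (w : Fin (max (p - 1) q) → ℝ) :
    lastCoord p q (boost p q s *ᵥ orbitPoint p q 1 w) = Real.cosh s - Real.exp s / 2 *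
      ‖(splitEquiv (fun j : Fin (max (p - 1) q) => (j : ℕ) < p - 1) w).2‖ ^ 2 := by
  have h := sum_signCoef_mul_sq hpq w
  have he := Real.cosh_add_sinh s
  simp only [lastCoord, boost, orbitPoint, Matrix.mulVec, dotProduct, Fintype.sum_sum_type,
    Matrix.fromBlocks, h]
  simp
  rw [← he]
  ring

lemma posNormSq_boost (hpq : p - 1 < q) (s : ℝ) (w : Fin (max (p - 1) q) → ℝ) :
    posNormSq p q (boost p q s *ᵥ orbitPoint p q 1 w) = (Real.sinh s - Real.exp s / 2 *
      ‖(splitEquiv (fun j : Fin (max (p - 1) q) => (j : ℕ) < p - 1) w).2‖ ^ 2) ^ 2 +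
      ‖(splitEquiv (fun j : Fin (max (p - 1) q) => (j : ℕ) < p - 1) w).1‖ ^ 2 := by
  have h := sum_signCoef_mul_sq hpq w
  have he := Real.cosh_add_sinh s
  rw [← sum_sq_uPart, posNormSq, Fintype.sum_sum_type]
  have h1 : ∀ i, (boost p q s *ᵥ orbitPoint p q 1 w) (Sum.inl (Sum.inr i)) = uPart p q w i := by
    intro i
    simp [boost, orbitPoint, Matrix.mulVec, dotProduct, Fintype.sum_sum_type,
      Matrix.fromBlocks, Matrix.one_apply]
  have h2 : (boost p q s *ᵥ orbitPoint p q 1 w) (Sum.inl (Sum.inl ())) =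
      Real.sinh s - Real.exp s / 2 *
      ‖(splitEquiv (fun j : Fin (max (p - 1) q) => (j : ℕ) < p - 1) w).2‖ ^ 2 := by
    simp only [boost, orbitPoint, Matrix.mulVec, dotProduct, Fintype.sum_sum_type,
      Matrix.fromBlocks, h]
    simp
    rw [← he]
    ring
  simp only [h1, Finset.univ_unique, Finset.sum_singleton]
  rw [← h2]

/-- On the orbit the last coordinate is at most `coshPart` and `1 + |x|²` is its square. The
hypothesis on `a` thus gives the order `-(λ + ρ)` in `coshPart`, and the weight of the vanishing
case is again an integrable majorant. -/
lemma integrable_lastCoord_pow_mul_lapPow (hp : 1 ≤ p) (hq : 1 ≤ q) {lam : ℝ} (hlam : 0 < lam)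
    {m l : ℕ} {a : ℝ} (ha : 2 * a + l - 2 * m = -(lam + rho p q)) {g : Mat p q}
    (hg : gᵀ * form p q * g = form p q) :
    Integrable fun w : Fin (max (p - 1) q) → ℝ =>
      lastCoord p q (g *ᵥ orbitPoint p q 1 w) ^ l *
        lapPow p m a (posNormSq p q (g *ᵥ orbitPoint p q 1 w)) := by
  have : Nonempty (Fin (max (p - 1) q)) := ⟨⟨0, lt_max_of_lt_right hq⟩⟩
  have hcont : Continuous fun w : Fin (max (p - 1) q) → ℝ => g *ᵥ orbitPoint p q 1 w := by
    refine continuous_pi fun b => ?_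
    simp only [Matrix.mulVec, dotProduct, Fintype.sum_sum_type, orbitPoint, Sum.elim_inl,
      Sum.elim_inr, uPart, vPart, Pi.neg_apply]
    fun_prop
  obtain ⟨C, hC, hb⟩ := exists_lapPow_bound p m a
  obtain ⟨c, hc, hlow⟩ := exists_lower_bound hg
  have hN : 0 ≤ lam + rho p q := by
    have h1 : (1 : ℝ) ≤ p := by exact_mod_cast hp
    have h2 : (1 : ℝ) ≤ q := by exact_mod_cast hq
    rw [rho]; linarith
  refine Integrable.mono' ((integrable_orbitWeight_rpow (signCoef_cube p q) (signCoef_sign p q)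
    hlam (congrArg (lam + ·) (sum_one_sub_signCoef_sq p q hp).symm)).const_mul
      (C * (4 / c) ^ ((lam + rho p q) / 2))) ?_ (Eventually.of_forall fun w => ?_)
  · refine Measurable.aestronglyMeasurable ?_
    refine Measurable.mul ?_ ((measurable_lapPow _ _ _).comp ?_)
    · exact ((continuous_apply _).comp hcont).measurable.pow_const l
    · exact (continuous_finsetSum _ fun i _ =>
        ((continuous_apply (Sum.inl i)).comp hcont).pow 2).measurable
  · set x := g *ᵥ orbitPoint p q 1 w with hx
    have hQ := coshPart_sq_orbit hg w
    rw [← hx] at hQ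
    have hs := posNormSq_nonneg x
    have h0 : 0 ≤ coshPart p q x := Real.sqrt_nonneg _
    have hpos : 0 < coshPart p q x := by nlinarith
    have h1 : orbitWeight (signCoef p q) 0 w ≤ 4 / c * coshPart p q x ^ 2 := by
      have e1 := orbitWeight_zero_le (e := signCoef p q) zero_le_one le_rfl w
      have e2 := hlow 1 w zero_le_one
      rw [norm_negPart] at e2
      rw [div_mul_eq_mul_div, le_div_iff₀ hc]
      nlinarith
    have h2 := rpow_neg_le_of_le (r := (lam + rho p q) / 2) (orbitWeight_pos _ _) (by positivity)
      (by positivity) h1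
    rw [norm_mul, norm_pow, Real.norm_eq_abs, Real.norm_eq_abs, mul_assoc]
    calc |lastCoord p q x| ^ l * |lapPow p m a (posNormSq p q x)|
        ≤ coshPart p q x ^ l * (C * (coshPart p q x ^ 2) ^ (a - m)) := by
          rw [hQ]
          gcongr
          · exact abs_lastCoord_le x
          · exact hb _ hs
      _ = C * (coshPart p q x ^ 2) ^ (-((lam + rho p q) / 2)) := by
          rw [← Real.rpow_natCast _ l, ← Real.rpow_natCast _ 2, ← Real.rpow_mul h0,
            ← Real.rpow_mul h0, mul_left_comm, ← Real.rpow_add hpos]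
          congr 2
          push_cast
          linarith
      _ ≤ _ := by gcongr

/-- The Radon transform on the boosts, as a one-dimensional integral. -/
lemma integral_lastCoord_pow_mul_lapPow (hp : 1 ≤ p) (hpq : p - 1 < q) {lam : ℝ} (hlam : 0 < lam)
    {n m l : ℕ} (hn : 2 * m = n + l) (hN : lam + n = ((q : ℝ) - p + 1) / 2 - 1) :
    ∃ B : ℝ, B ≠ 0 ∧ ∀ s, ∫ w : Fin (max (p - 1) q) → ℝ,
      lastCoord p q (boost p q s *ᵥ orbitPoint p q 1 w) ^ l *
        lapPow p m (n - rhoC q) (posNormSq p q (boost p q s *ᵥ orbitPoint p q 1 w)) =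
      B * Real.exp (-(((q : ℝ) - p + 1) / 2) * s) *
        ∫ τ in Ioi 0, τ ^ (lam + n) * ((Real.cosh s - τ) ^ l *
          lapPow 1 m (-lam - 1 / 2) ((Real.sinh s - τ) ^ 2)) := by
  set P : Fin (max (p - 1) q) → Prop := fun j => (j : ℕ) < p - 1 with hP
  set a := (n : ℝ) - rhoC q with ha
  have hcard : Fintype.card {j // P j} = p - 1 := by
    have := sum_ite_lt_eq_sum_castLE (le_max_left (p - 1) q) fun _ => 1
    simp only [Finset.sum_const, Finset.card_univ, Fintype.card_fin, smul_eq_mul, mul_one] at this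
    rw [Fintype.card_subtype, Finset.card_filter]
    exact this
  have hcard' : Fintype.card {j // ¬P j} = q - (p - 1) := by
    rw [Fintype.card_subtype_compl, hcard, Fintype.card_fin]
    omega
  have hcr : (Fintype.card {j // P j} : ℝ) = p - 1 := by
    rw [hcard, Nat.cast_sub hp, Nat.cast_one]
  have hcr' : (Fintype.card {j // ¬P j} : ℝ) = q - p + 1 := by
    rw [hcard', Nat.cast_sub hpq.le, Nat.cast_sub hp, Nat.cast_one]; ring
  have hfr : (Module.finrank ℝ (EuclideanSpace ℝ {j // P j}) : ℝ) = p - 1 := by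
    rw [finrank_euclideanSpace, hcr]
  have hfr' : (Module.finrank ℝ (EuclideanSpace ℝ {j // ¬P j}) : ℝ) = q - p + 1 := by
    rw [finrank_euclideanSpace, hcr']
  have : Nonempty {j // ¬P j} := Fintype.card_pos_iff.1 (by omega)
  have ha1 : 2 * a + 1 < -(Module.finrank ℝ (EuclideanSpace ℝ {j // P j}) : ℝ) := by
    rw [hfr, ha, rhoC]; linarith
  -- Integrating out the `p - 1` coordinates of `u` raises the exponent by `(p - 1)/2`, to the value
  -- for which the one-variable integrals are exponentials.
  have ha2 : a + (Fintype.card {j // P j} : ℝ) / 2 = -lam - 1 / 2 := by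
    rw [hcr, ha, rhoC]; linarith
  have hn' : (2 : ℝ) * m = n + l := by exact_mod_cast hn
  set v := (volume : Measure (EuclideanSpace ℝ {j // ¬P j})).real (Metric.ball 0 1)
  have hv : 0 < v := ENNReal.toReal_pos (Metric.measure_ball_pos volume 0 one_pos).ne'
    measure_ball_lt_top.ne
  have hb : 0 < betaInt (EuclideanSpace ℝ {j // P j}) a := betaInt_pos (by linarith)
  have hk : 0 < (q : ℝ) - p + 1 := by rw [← hcr']; exact_mod_cast Fintype.card_pos
  refine ⟨betaInt (EuclideanSpace ℝ {j // P j}) a * (((q : ℝ) - p + 1) * v / 2 *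
    2 ^ (((q : ℝ) - p + 1) / 2)), by positivity, fun s => ?_⟩
  have hint := integrable_lastCoord_pow_mul_lapPow (g := boost p q s) (m := m) (l := l) (a := a) hp
    (by omega) hlam (by rw [ha, rho, rhoC]; linarith) (boost_preserves_form s)
  simp_rw [lastCoord_boost hpq, posNormSq_boost hpq] at hint ⊢
  set E := Real.exp s / 2 with hE
  have hE0 : 0 < E := by positivity
  have hint' := ((measurePreserving_splitEquiv P).integrable_comp_emb
    (splitEquiv P).measurableEmbedding (g := fun z => (Real.cosh s - E * ‖z.2‖ ^ 2) ^ l *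
      lapPow p m a ((Real.sinh s - E * ‖z.2‖ ^ 2) ^ 2 + ‖z.1‖ ^ 2))).1 hint
  rw [(measurePreserving_splitEquiv P).integral_comp' (g := fun z =>
      (Real.cosh s - E * ‖z.2‖ ^ 2) ^ l *
      lapPow p m a ((Real.sinh s - E * ‖z.2‖ ^ 2) ^ 2 + ‖z.1‖ ^ 2)), Measure.volume_eq_prod,
    integral_prod_symm _ hint']
  have hin : ∀ y : EuclideanSpace ℝ {j // ¬P j}, ∫ x : EuclideanSpace ℝ {j // P j},
      (Real.cosh s - E * ‖y‖ ^ 2) ^ l *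
      lapPow p m a ((Real.sinh s - E * ‖y‖ ^ 2) ^ 2 + ‖x‖ ^ 2) =
      betaInt (EuclideanSpace ℝ {j // P j}) a * ((Real.cosh s - E * ‖y‖ ^ 2) ^ l *
        lapPow 1 m (-lam - 1 / 2) ((Real.sinh s - E * ‖y‖ ^ 2) ^ 2)) := by
    intro y
    have h := (integral_lapPow m ha1 ((Real.sinh s - E * ‖y‖ ^ 2) ^ 2) (sq_nonneg _)).2
    rw [ha2, show (Fintype.card {j // P j} : ℝ) + 1 = p by rw [hcr]; ring] at h
    rw [integral_const_mul, h]
    ring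
  simp only [hin]
  rw [integral_const_mul, integral_comp_mul_norm_sq hE0 (fun τ => (Real.cosh s - τ) ^ l *
    lapPow 1 m (-lam - 1 / 2) ((Real.sinh s - τ) ^ 2)), hfr', ← hN]
  -- The factor `e^{-ρ_1 s}` is the Jacobian of `τ = E ‖y‖²` in dimension `q - p + 1 = 2ρ_1`.
  have hEr : E ^ (-(((q : ℝ) - p + 1) / 2)) =
      2 ^ (((q : ℝ) - p + 1) / 2) * Real.exp (-(((q : ℝ) - p + 1) / 2) * s) := by
    rw [hE, div_eq_inv_mul, Real.mul_rpow (by positivity) (Real.exp_pos _).le, ← Real.exp_mul,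
      Real.inv_rpow zero_le_two, Real.rpow_neg zero_le_two, inv_inv]
    congr 2
    ring
  rw [hEr]
  ring

/-- The Radon transform of the generating function in the non-vanishing case. -/
theorem radon_boost (hp : 1 ≤ p) {lam : ℝ} (hlam : 0 < lam)
    {μ : ℤ} (hμ : (μ : ℝ) = muParam p q lam) (hμ0 : μ ≤ 0) :
    ∃ C : ℂ, C ≠ 0 ∧ ∀ s : ℝ,
      RadonConverges p q (generatingFunction p q lam μ) (boost p q s) ∧
      radon p q (generatingFunction p q lam μ) (boost p q s) =
        C * (Real.exp ((-rhoOne p q + lam) * s) : ℂ) := by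
  rw [muParam, if_pos hlam] at hμ
  have hp' : (1 : ℝ) ≤ p := by exact_mod_cast hp
  obtain ⟨n, rfl⟩ : ∃ n : ℕ, μ = -n := ⟨(-μ).toNat, by omega⟩
  push_cast at hμ
  have hN : lam + n = ((q : ℝ) - p + 1) / 2 - 1 := by
    rw [rho, rhoC] at hμ; linarith
  have hn0 : (0 : ℝ) ≤ n := by positivity
  -- `λ > 0` and `n ≥ 0` force this; hence `q > 1` and the second case in the definition of `rhoOne`
  -- applies.
  have hqp : (p : ℝ) + 1 < q := by linarith
  have hqp' : p + 1 < q := by exact_mod_cast hqp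
  have hq1 : q ≠ 1 := by omega
  have hrho : rhoOne p q = ((q : ℝ) - p + 1) / 2 := by rw [rhoOne, if_neg (by omega)]
  obtain ⟨m, l, hml, A, hA, hf, hI⟩ : ∃ m l : ℕ, 2 * m = n + l ∧ ∃ A : ℝ, A ≠ 0 ∧
      (∀ x : Idx p q → ℝ, coshPart p q x ^ 2 = 1 + posNormSq p q x →
        generatingFunction p q lam (-n) x =
          ((lastCoord p q x ^ l * lapPow p m (n - rhoC q) (posNormSq p q x) : ℝ) : ℂ)) ∧
      ∀ s : ℝ, ∫ τ in Ioi 0, τ ^ (lam + n) * ((Real.cosh s - τ) ^ l *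
        lapPow 1 m (-lam - 1 / 2) ((Real.sinh s - τ) ^ 2)) = A * Real.exp (lam * s) := by
    rcases Nat.even_or_odd' n with ⟨m, hm | hm⟩
    · obtain ⟨A, hA, hI⟩ := exists_integral_lapPow_even m hlam
      refine ⟨m, 0, by omega, A, hA, fun x hx => ?_, by simpa [hm] using hI⟩
      rw [generatingFunction, dif_neg hq1, pow_zero, one_mul]
      -- For `n = 0` the generating function is defined by the Gegenbauer case. It has the same
      -- form, since the polynomial of degree `0` is constant and `λ + ρ = 2ρ_c`.
      rcases Nat.eq_zero_or_pos n with h0 | h0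
      · have hm0 : m = 0 := by omega
        subst hm0
        subst h0
        have hc : 0 ≤ coshPart p q x := Real.sqrt_nonneg _
        rw [if_pos (by simp), lapPow, ← hx, ← Real.rpow_natCast, ← Real.rpow_mul hc]
        simp only [Nat.cast_zero, neg_zero, Int.toNat_zero, zonal, gegenbauer, div_one, one_mul]
        congr 2
        push_cast at hμ ⊢
        linarith
      · rw [if_neg (by omega), if_pos (by simp [hm]), phi_eq hp, neg_neg, Int.toNat_natCast,
          show n / 2 = m by omega]
    · obtain ⟨A, hA, hI⟩ := exists_integral_lapPow_odd m hlam
      refine ⟨m + 1, 1, by omega, A, hA, fun x hx => ?_, by simpa [hm] using hI⟩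
      rw [generatingFunction, dif_neg hq1, if_neg (by omega), if_neg (by
        rw [even_neg, Int.even_coe_nat, Nat.not_even_iff_odd]; exact ⟨m, hm⟩), phi_eq hp, neg_neg,
        Int.toNat_natCast, pow_one, show (n + 1) / 2 = m + 1 by omega]
  obtain ⟨B, hB, hBI⟩ := integral_lastCoord_pow_mul_lapPow hp (by omega) hlam hml hN
  have hml' : (2 : ℝ) * m = n + l := by exact_mod_cast hml
  refine ⟨((B * A : ℝ) : ℂ), by exact_mod_cast mul_ne_zero hB hA, fun s => ?_⟩
  have hform := boost_preserves_form (p := p) (q := q) s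
  have hfun : (fun w : Fin (max (p - 1) q) → ℝ =>
      generatingFunction p q lam (-n) ((boost p q s * nStar p q w) *ᵥ basePoint p q)) =
      fun w => ((lastCoord p q (boost p q s *ᵥ orbitPoint p q 1 w) ^ l *
        lapPow p m (n - rhoC q) (posNormSq p q (boost p q s *ᵥ orbitPoint p q 1 w)) : ℝ) : ℂ) := by
    ext w
    rw [mul_nStar_mulVec_basePoint, hf _ (coshPart_sq_orbit hform w)]
  rw [RadonConverges, radon, hfun]
  constructor
  · exact (integrable_lastCoord_pow_mul_lapPow hp (by omega) hlam
      (by rw [rho, rhoC]; linarith) hform).ofReal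
  · rw [integral_complex_ofReal, hBI s, hI s, ← Complex.ofReal_mul, hrho, add_mul, Real.exp_add]
    congr 1
    ring

end Boost

end Hyperbolic

theorem theorem5p2 (p q : ℕ) (hp : 1 ≤ p) (hq : 1 ≤ q) (lam : ℝ)
    (hlam : Hyperbolic.IsDiscreteSeriesParameter p q lam)
    (μ : ℤ) (hμ : (μ : ℝ) = Hyperbolic.muParam p q lam) :
    ((0 < lam ∧ 0 < μ) ∨ (lam < 0 ∧ μ < 0) →
      ∀ g ∈ Hyperbolic.groupG p q,
        Hyperbolic.RadonConverges p q (Hyperbolic.generatingFunction p q lam μ) g ∧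
        Hyperbolic.radon p q (Hyperbolic.generatingFunction p q lam μ) g = 0) ∧
    (0 < lam ∧ μ ≤ 0 →
      ∃ C : ℂ, C ≠ 0 ∧ ∀ s : ℝ,
        Hyperbolic.RadonConverges p q (Hyperbolic.generatingFunction p q lam μ)
          (Hyperbolic.boost p q s) ∧
        Hyperbolic.radon p q (Hyperbolic.generatingFunction p q lam μ)
          (Hyperbolic.boost p q s) =
            C * (Real.exp ((-Hyperbolic.rhoOne p q + lam) * s) : ℂ)) := by
  refine ⟨fun h g hg => ?_, fun h => ?_⟩
  · have hg' := Hyperbolic.preserves_form_of_mem_groupG hg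
    rcases eq_or_lt_of_le hq with rfl | hq1
    · exact Hyperbolic.radon_eq_zero_one hp (by rcases h with h | h; exacts [h.1.ne', h.1.ne]) hμ hg'
    · rw [Hyperbolic.IsDiscreteSeriesParameter, if_neg hq1.ne'] at hlam
      rcases h with h | h
      · exact Hyperbolic.radon_eq_zero_of_one_lt hp hq1 h.1 hμ h.2 hg'
      -- Negative parameters occur only for `q = 1`.
      · exact absurd hlam.1 h.1.le.not_gt
  · exact Hyperbolic.radon_boost hp h.1 hμ h.2
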